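/- Let $\Sigma$ be a finite alphabet, $A\subseteq\Sigma^*$ an oracle and $k\in\mathbb N$. Then $$\mathrm{CL}^A_{k\text{-round}}\subseteq \mathrm{ZPP}^A .$$ Here the two classes of languages $L\subseteq\{0,1\}^*$ are defined as follows. **$\mathrm{CL}^A_{k\text{-round}}$.** A catalytic logspace machine has, on inputs $x$ of length $n$, a read-only input tape, a read-write work tape of $O(\log n)$ bits, and a read-write catalytic tape of $n^{c}$ bits ($c$ a constant) with arbitrary initial contents $\tau$. In addition to ordinary steps it can make rounds of oracle queries. A round consists of a query phase and an answer phase. In the query phase the machine writes queries $q_1,\dots,q_m\in\Sigma^*$ ($m \geq 1$) on a one-way write-only query tape by a logspace computation that uses its work tape and treats the catalytic tape as read-only, except that between $q_i$ and $q_{i+1}$ it may perform a one-way in-place computation (see below). In the answer phase it performs a one-way in-place computation, then reads the bit $A(q_1)$, performs a one-way in-place computation, reads $A(q_2)$, and so on; after the one following $A(q_m)$ it resumes its ordinary computation. A one-way in-place computation is a deterministic computation that has a single read-write input/output tape $z$, which consists of the contents of the work tape followed by those of the catalytic tape, an auxiliary work tape of $O(\log n)$ bits that is blank at the start, and read-only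 access to $x$. Both heads on $z$ start at its left end; the write head moves only to the right, and the read head moves in both directions but never to the left of the write head. $L\in\mathrm{CL}^A_{k\text{-round}}$ if there are such a machine $M$ and a polynomial $p$ such that, for every input $x$ and every initial catalytic contents $\tau$, $M$ with oracle $A$ halts, accepts if and only if $x\in L$, halts with $\tau$ on its catalytic tape, and makes at most $k$ rounds of queries with at most $p(|x|)$ queries in each round. **$\mathrm{ZPP}^A$.** $L\in\mathrm{ZPP}^A$ if there is a probabilistic multitape Turing machine with oracle $A$ that halts on every input $x$ within $p(|x|)$ steps for a polynomial $p$, whatever the coin tosses are, such that its output is always either the correct answer to "is $x\in L$?" or "don't know", and the latter has probability at most $1/3$. -/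

import Mathlib

noncomputable section

namespace Catalytic

/-! ### Tapes and heads -/

/-- Head movements. -/
inductive Dir
  | left
  | stay
  | right

/-- What a head sees on a tape of bounded length: the left end marker, a symbol, or the right end
marker. -/
inductive Scan (α : Type)
  | leftEnd
  | sym (a : α)
  | rightEnd

/-- Moving a head on a bounded tape with `len` cells. The cells have positions `1, …, len`,
position `0` is the left end marker and position `len + 1` is the right end marker. -/
def moveBounded (len pos : ℕ) : Dir → ℕ
  | .left => pos - 1
  | .stay => pos
  | .right => min (pos + 1) (len + 1)

/-- The symbol at position `pos` of a bounded tape. -/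
def scan {α : Type} (cells : List α) (pos : ℕ) : Scan α :=
  if pos = 0 then .leftEnd
  else match cells[pos - 1]? with
    | some a => .sym a
    | none => .rightEnd

/-- Writing at position `pos` of a bounded tape (`none`: write nothing; the end markers cannot be
overwritten). -/
def writeAt (cells : List Bool) (pos : ℕ) : Option Bool → List Bool
  | none => cells
  | some b => if pos = 0 then cells else cells.set (pos - 1) b

/-- The answer of the oracle `A` to the query `w`. -/
def answer {σ : Type} (A : Language σ) (w : List σ) : Bool :=
  open Classical in decide (w ∈ A)

/-! ### Catalytic logspace machines with rounds of nonadaptive oracle queries -/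

/-- Instructions of the ordinary catalytic computation. -/
inductive MainAct (Q : Type)
  /-- Halt, and accept (`true`) or reject (`false`). -/
  | halt (b : Bool)
  /-- Enter the query phase of a round. -/
  | enterQuery (q : Q)
  /-- One step; the work tape and the catalytic tape are both read-write. -/
  | step (q : Q) (inMove : Dir) (workWrite : Option Bool) (workMove : Dir)
      (catWrite : Option Bool) (catMove : Dir)

/-- Instructions of the query phase. The catalytic tape is read-only, and the query tape is a
write-only tape whose head moves from left to right only. -/
inductive QueryAct (σ Q : Type)
  /-- One step, in which at most one symbol `out` is appended to the query tape. -/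
  | step (q : Q) (inMove : Dir) (workWrite : Option Bool) (workMove : Dir) (catMove : Dir)
      (out : Option σ)
  /-- The current query is complete and further queries follow in this round. Before the next query
  an in-place computation on (work tape, catalytic tape) is performed. -/
  | next (q : Q)
  /-- The current query is complete and is the last one of this round: submit all of them. -/
  | ask (q : Q)

/-- Instructions of a one-way in-place computation. Its input/output tape `z` is the work tape
followed by the catalytic tape. It has a read head and a write head on `z`, an auxiliary work tape,
and access to the (read-only) input tape. -/
inductive InPlaceAct (Q : Type)
  /-- The in-place computation is finished. -/
  | finish (q : Q)
  /-- One step: `zWrite` is written (or nothing, for `none`) at the write head, which then moves one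
  cell to the right if `zAdvance` holds and stays otherwise. The read head moves by `zRead`. -/
  | step (q : Q) (inMove : Dir) (auxWrite : Option Bool) (auxMove : Dir)
      (zWrite : Option Bool) (zAdvance : Bool) (zRead : Dir)

/-- A catalytic logspace machine that makes its oracle queries (strings over `σ`) in rounds.
Inputs are bit strings. On inputs of length `n`, the work tape has `workConst * (log₂ n + 1)` bits,
the catalytic tape has `n ^ catExp` bits, and the auxiliary work tape of the in-place computations
has `auxConst * (log₂ n + 1)` bits (the tape `z` that they work on has length polynomial in `n`). -/
structure RoundMachine (σ : Type) where
  Q : Type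
  finiteQ : Finite Q
  start : Q
  workConst : ℕ
  catExp : ℕ
  auxConst : ℕ
  /-- Ordinary computation: state, scanned input, work and catalytic cells. -/
  main : Q → Scan Bool → Scan Bool → Scan Bool → MainAct Q
  /-- Query phase: state, scanned input, work and catalytic cells. -/
  query : Q → Scan Bool → Scan Bool → Scan Bool → QueryAct σ Q
  /-- In-place computations: state, scanned input, auxiliary and `z` cells. -/
  inPlace : Q → Scan Bool → Scan Bool → Scan Bool → InPlaceAct Q
  /-- The state after reading the next answer bit. -/
  receive : Q → Bool → Q

/-- The part of a configuration that is private to a running in-place computation. -/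
structure InPlaceCfg where
  aux : List Bool
  auxPos : ℕ
  readPos : ℕ
  writePos : ℕ

/-- The phases of the computation of a `RoundMachine`. -/
inductive Phase (σ : Type)
  /-- Ordinary catalytic computation. -/
  | main
  /-- Halted, with the verdict `b`. -/
  | halted (b : Bool)
  /-- Writing the query `cur`, after the complete queries `prev` of this round. -/
  | query (prev : List (List σ)) (cur : List σ)
  /-- In-place computation between two queries of a round. -/
  | between (prev : List (List σ)) (ip : InPlaceCfg)
  /-- In-place computation in the answer phase; `rest` are the answer bits not yet read. -/
  | answers (rest : List Bool) (ip : InPlaceCfg)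

/-- Configurations of a `RoundMachine`; `rounds` counts the rounds of queries made so far. -/
structure RoundCfg (σ Q : Type) where
  state : Q
  phase : Phase σ
  inPos : ℕ
  work : List Bool
  workPos : ℕ
  cat : List Bool
  catPos : ℕ
  rounds : ℕ

namespace RoundMachine

variable {σ : Type} (M : RoundMachine σ)

/-- Number of cells of the work tape. -/
def workLen (n : ℕ) : ℕ := M.workConst * (Nat.log 2 n + 1)

/-- Number of cells of the catalytic tape. -/
def catLen (n : ℕ) : ℕ := n ^ M.catExp

/-- Number of cells of the auxiliary work tape of the in-place computations. -/
def auxLen (n : ℕ) : ℕ := M.auxConst * (Nat.log 2 n + 1)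

/-- Start of an in-place computation on inputs of length `n`: the auxiliary tape is blank, and both
heads are on the first cell of `z`. -/
def freshInPlace (n : ℕ) : InPlaceCfg where
  aux := List.replicate (M.auxLen n) false
  auxPos := 0
  readPos := 1
  writePos := 1

/-- One step of an in-place computation on the tape `z = work ++ cat`. The first component of the
result is the new configuration without its phase, the second one tells how the in-place computation
goes on (`none` if it has finished). The read head never gets to the left of the write head. -/
def inPlaceStep (x : List Bool) (c : RoundCfg σ M.Q) (ip : InPlaceCfg) :
    RoundCfg σ M.Q × Option InPlaceCfg :=
  let z := c.work ++ c.cat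
  match M.inPlace c.state (scan x c.inPos) (scan ip.aux ip.auxPos) (scan z ip.readPos) with
  | .finish q => ({ c with state := q }, none)
  | .step q inMove auxWrite auxMove zWrite zAdvance zRead =>
    let z' := writeAt z ip.writePos zWrite
    let w := if zAdvance then moveBounded z.length ip.writePos .right else ip.writePos
    ({ c with
        state := q
        inPos := moveBounded x.length c.inPos inMove
        work := z'.take c.work.length
        cat := z'.drop c.work.length },
     some
      { aux := writeAt ip.aux ip.auxPos auxWrite
        auxPos := moveBounded ip.aux.length ip.auxPos auxMove
        readPos := max w (moveBounded z.length ip.readPos zRead)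
        writePos := w })

/-- One step of the machine on input `x` with oracle `A`. Halted configurations do not change. -/
def step (A : Language σ) (x : List Bool) (c : RoundCfg σ M.Q) : RoundCfg σ M.Q :=
  match c.phase with
  | .halted _ => c
  | .main =>
    match M.main c.state (scan x c.inPos) (scan c.work c.workPos) (scan c.cat c.catPos) with
    | .halt b => { c with phase := .halted b }
    | .enterQuery q => { c with state := q, phase := .query [] [] }
    | .step q inMove workWrite workMove catWrite catMove =>
      { c with
        state := q
        inPos := moveBounded x.length c.inPos inMove
        work := writeAt c.work c.workPos workWrite
        workPos := moveBounded c.work.length c.workPos workMove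
        cat := writeAt c.cat c.catPos catWrite
        catPos := moveBounded c.cat.length c.catPos catMove }
  | .query prev cur =>
    match M.query c.state (scan x c.inPos) (scan c.work c.workPos) (scan c.cat c.catPos) with
    | .step q inMove workWrite workMove catMove out =>
      { c with
        state := q
        phase := .query prev (cur ++ out.toList)
        inPos := moveBounded x.length c.inPos inMove
        work := writeAt c.work c.workPos workWrite
        workPos := moveBounded c.work.length c.workPos workMove
        catPos := moveBounded c.cat.length c.catPos catMove }
    | .next q =>
      { c with state := q, phase := .between (prev ++ [cur]) (M.freshInPlace x.length) }
    | .ask q =>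
      { c with
        state := q
        phase := .answers ((prev ++ [cur]).map (answer A)) (M.freshInPlace x.length)
        rounds := c.rounds + 1 }
  | .between prev ip =>
    match M.inPlaceStep x c ip with
    | (d, some ip') => { d with phase := .between prev ip' }
    | (d, none) => { d with phase := .query prev [] }
  | .answers rest ip =>
    match M.inPlaceStep x c ip with
    | (d, some ip') => { d with phase := .answers rest ip' }
    | (d, none) =>
      match rest with
      | [] => { d with phase := .main }
      | b :: rest' =>
        { d with
          state := M.receive d.state b
          phase := .answers rest' (M.freshInPlace x.length) }

/-- The initial configuration on input `x` and initial catalytic contents `τ`. -/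
def init (x τ : List Bool) : RoundCfg σ M.Q where
  state := M.start
  phase := .main
  inPos := 0
  work := List.replicate (M.workLen x.length) false
  workPos := 0
  cat := τ
  catPos := 0
  rounds := 0

/-- The configuration after `t` steps. -/
def run (A : Language σ) (x τ : List Bool) (t : ℕ) : RoundCfg σ M.Q :=
  (M.step A x)^[t] (M.init x τ)

end RoundMachine

/-- The class `CL^A_{k-round}`: for every input `x` and every initial contents `τ` of the catalytic
tape, the machine halts with the correct verdict and with `τ` restored on the catalytic tape, and it
makes at most `k` rounds of queries, each with polynomially many queries. -/
def CLRound {σ : Type} (A : Language σ) (k : ℕ) : Set (Language Bool) :=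
  {L | ∃ (M : RoundMachine σ) (m : Polynomial ℕ),
    ∀ x τ : List Bool, τ.length = M.catLen x.length →
      (∃ (t : ℕ) (b : Bool), (M.run A x τ t).phase = .halted b ∧ (b = true ↔ x ∈ L) ∧
        (M.run A x τ t).cat = τ) ∧
      (∀ t, (M.run A x τ t).rounds ≤ k) ∧
      (∀ t rest ip, (M.run A x τ t).phase = .answers rest ip → rest.length ≤ m.eval x.length)}

/-! ### Zero-error probabilistic polynomial time with an oracle -/

/-- Possible outputs of a zero-error probabilistic machine. -/
inductive Verdict
  | accept
  | reject
  | dontKnow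

/-- Instructions of a probabilistic oracle machine with `K` work tapes. -/
inductive ProbAct (σ Q Γ : Type) (K : ℕ)
  | halt (v : Verdict)
  /-- One step on the input tape and all work tapes; at most one symbol `out` is appended to the
  query tape. -/
  | step (q : Q) (inMove : Dir) (write : Fin K → Γ) (move : Fin K → Dir) (out : Option σ)
  /-- Ask the oracle about the contents of the query tape, continue in the state given by the
  answer, and erase the query tape. -/
  | ask (qYes qNo : Q)

/-- A probabilistic oracle Turing machine with a read-only input tape, `K` one-way infinite
read-write work tapes over a finite alphabet, and a query tape. In every step it receives one coin
toss (the Boolean argument of `trans`), which it may ignore. -/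
structure ProbMachine (σ : Type) where
  Q : Type
  finiteQ : Finite Q
  Γ : Type
  finiteΓ : Finite Γ
  blank : Γ
  K : ℕ
  start : Q
  trans : Q → Bool → Scan Bool → (Fin K → Γ) → ProbAct σ Q Γ K

/-- Configurations of a probabilistic oracle machine; `verdict` is `none` while it is running. -/
structure ProbCfg (σ Q Γ : Type) (K : ℕ) where
  state : Q
  verdict : Option Verdict
  inPos : ℕ
  tape : Fin K → ℕ → Γ
  pos : Fin K → ℕ
  query : List σ

/-- Moving a head on a one-way infinite tape. -/
def moveInf (pos : ℕ) : Dir → ℕ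
  | .left => pos - 1
  | .stay => pos
  | .right => pos + 1

namespace ProbMachine

variable {σ : Type} (M : ProbMachine σ)

/-- One step on input `x` with oracle `A` and coin toss `coin`. -/
def step (A : Language σ) (x : List Bool) (c : ProbCfg σ M.Q M.Γ M.K) (coin : Bool) :
    ProbCfg σ M.Q M.Γ M.K :=
  match c.verdict with
  | some _ => c
  | none =>
    match M.trans c.state coin (scan x c.inPos) (fun i => c.tape i (c.pos i)) with
    | .halt v => { c with verdict := some v }
    | .step q inMove write move out =>
      { c with
        state := q
        inPos := moveBounded x.length c.inPos inMove
        tape := fun i => Function.update (c.tape i) (c.pos i) (write i)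
        pos := fun i => moveInf (c.pos i) (move i)
        query := c.query ++ out.toList }
    | .ask qYes qNo =>
      { c with state := if answer A c.query then qYes else qNo, query := [] }

/-- The initial configuration. -/
def init : ProbCfg σ M.Q M.Γ M.K where
  state := M.start
  verdict := none
  inPos := 0
  tape := fun _ _ => M.blank
  pos := fun _ => 0
  query := []

/-- The verdict after as many steps as there are coin tosses in `coins`. -/
def output (A : Language σ) (x : List Bool) {T : ℕ} (coins : Fin T → Bool) : Option Verdict :=
  ((List.ofFn coins).foldl (M.step A x) M.init).verdict

end ProbMachine

/-- The class `ZPP^A`: some probabilistic oracle machine halts on every input `x` within `p(|x|)`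
steps (for a polynomial `p`) whatever the coin tosses are, its output is correct or "don't know",
and the latter has probability at most `1/3` over uniform coin tosses. -/
def ZPP {σ : Type} (A : Language σ) : Set (Language Bool) :=
  {L | ∃ (M : ProbMachine σ) (p : Polynomial ℕ), ∀ x : List Bool,
    (∀ coins : Fin (p.eval x.length) → Bool,
      (M.output A x coins = some .accept ∧ x ∈ L) ∨
      (M.output A x coins = some .reject ∧ x ∉ L) ∨
      M.output A x coins = some .dontKnow) ∧
    (Nat.card {coins : Fin (p.eval x.length) → Bool //
        M.output A x coins = some .dontKnow} : ℝ) / 2 ^ (p.eval x.length) ≤ 1 / 3}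

end Catalytic

end

/-! The core is an averaging argument. Two runs of the catalytic machine on the same input that
share a configuration coincide from then on, hence halt with the same catalytic tape; as that tape
is restored, they started with the same contents. Within one halting run no configuration recurs
before the end. So all runs together, over all initial contents of the catalytic tape, meet every
configuration before halting at most once (`eq_of_run_eq`). With a catalytic tape of N bits there
are only 2 ^ N times polynomially many configurations outside the rounds of queries, so on average a
run spends polynomially many steps there (`sum_mainTimes_le`).

This count is useless inside a round, where a configuration also contains the queries written or the
answers still to be read. There the time is bounded for each run separately (`Tame.exists_main`).
While a query is written, the catalytic tape is constant, and what governs the computation has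
polynomially many values. While the write head of an in-place computation rests, only the cell under
it can change, and again polynomially many values govern the computation. A repeated value would
mean that the computation never leaves this stage, contrary to halting (`exists_leave`). The stages
of a round are polynomially many, since the write head only moves to the right and the number of
queries is bounded. Hence a round takes polynomial time (`Tame.progress`), and the whole run is
polynomially long on average (`Tame.haltTime_le`). By Markov's inequality at most a third of the
initial contents lead to a run longer than three times the bound on the average (`card_slow_le`).

The probabilistic machine therefore fills the catalytic tape with coin tosses, simulates the run
under a polynomial clock, and says "don't know" when the clock expires. The verdict is correct for
every initial contents, so errors are impossible. Each query of a round is put to the oracle as soon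
as it is complete, and the answer is queued until the simulated machine reads it; this is harmless
because the oracle is fixed.

The rest is an implementation on a Turing machine. It is built in two layers: `simulator`, a machine
with many heads on one memory tape, and `sweeper`, which simulates such a machine on a single tape
with quadratic slowdown (`sweeper_output`). The tape lengths are computed by repeated halving
(`halving_total`), and the clock is a reflected base-n counter whose digits are head positions
(`rank_tick`). The simulation is kept correct by the invariant `SimRel`, and `simulator_run` sums up
its outcome. -/

noncomputable section

/-! ### Multi-head machines and their simulation on one tape -/

namespace Catalytic

/-- The state after `t` steps of a machine `f` started in `a` and driven by coin tosses. -/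
def drive {α : Type*} (f : α → Bool → α) (a : α) (coins : ℕ → Bool) : ℕ → α
  | 0 => a
  | t + 1 => f (drive f a coins t) (coins t)

theorem foldl_ofFn_eq_drive {α : Type*} (f : α → Bool → α) (a : α) (coins : ℕ → Bool) (T : ℕ) :
    (List.ofFn (fun i : Fin T => coins i)).foldl f a = drive f a coins T := by
  induction T with
  | zero => simp [drive]
  | succ T ih =>
    rw [List.ofFn_succ']
    simp only [List.concat_eq_append, List.foldl_append, List.foldl_cons, List.foldl_nil,
      Fin.val_castSucc, Fin.val_last, drive]
    rw [ih]

theorem drive_fixed {α : Type*} {f : α → Bool → α} {a : α} {coins : ℕ → Bool} {t : ℕ}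
    (h : ∀ b, f (drive f a coins t) b = drive f a coins t) (s : ℕ) :
    drive f a coins (t + s) = drive f a coins t := by
  induction s with
  | zero => rfl
  | succ s ih => rw [← Nat.add_assoc, drive, ih, h]

/-! ### Machines with several heads on one memory -/

/-- Moves of the heads of a `HeadMachine`; `zero` and `one` are jumps to the first two cells. -/
inductive HeadMove
  | left
  | stay
  | right
  | zero
  | one

/-- The new position of a head. -/
def HeadMove.apply : HeadMove → ℕ → ℕ
  | .left, p => p - 1
  | .stay, p => p
  | .right, p => p + 1
  | .zero, _ => 0
  | .one, _ => 1

/-- What a head sees: its cell, the heads on that cell, and the heads on the cell to the left. -/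
structure View (C ι : Type) where
  cell : C
  here : ι → Bool
  before : ι → Bool

/-- Instructions of a `HeadMachine`. -/
inductive HeadAct (σ S C ι : Type)
  | halt (v : Verdict)
  /-- Every memory cell is updated as a function of its contents and of the heads on it. -/
  | step (s : S) (inMove : Dir) (out : Option σ) (upd : (ι → Bool) → C → C) (mv : ι → HeadMove)

/-- A probabilistic oracle machine whose memory is a one-way infinite tape with several heads.
In a step it may first ask the oracle about the contents of the query tape. -/
structure HeadMachine (σ : Type) where
  S : Type
  finiteS : Finite S
  C : Type
  finiteC : Finite C
  ι : Type
  finiteι : Finite ι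
  start : S
  /-- Initial contents of the cells other than the first one. -/
  blank : C
  /-- Initial contents of the first cell. -/
  corner : C
  asks : S → Scan Bool → (ι → View C ι) → Bool
  /-- The instruction for a state, a coin toss, the answer of the oracle (`false` if it has not been
  asked), the scanned input symbol and the views of the heads. -/
  act : S → Bool → Bool → Scan Bool → (ι → View C ι) → HeadAct σ S C ι
  upd_blank : ∀ {s coin ans sc g s' im out upd mv},
    act s coin ans sc g = .step s' im out upd mv → upd (fun _ => false) blank = blank

/-- Configurations of a `HeadMachine`. -/
structure HeadCfg (σ S C ι : Type) where
  state : S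
  verdict : Option Verdict
  inPos : ℕ
  mem : ℕ → C
  head : ι → ℕ
  query : List σ

/-- What the heads see. -/
def HeadCfg.view {σ S C ι : Type} (c : HeadCfg σ S C ι) (h : ι) : View C ι where
  cell := c.mem (c.head h)
  here := fun h' => decide (c.head h' = c.head h)
  before := fun h' => decide (c.head h' + 1 = c.head h)

namespace HeadMachine

variable {σ : Type} (H : HeadMachine σ)

/-- Whether the oracle is asked in the next step. -/
def asking (x : List Bool) (c : HeadCfg σ H.S H.C H.ι) : Bool :=
  H.asks c.state (scan x c.inPos) c.view

/-- One step on input `x` with oracle `A`. -/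
def step (A : Language σ) (x : List Bool) (c : HeadCfg σ H.S H.C H.ι) (coin : Bool) :
    HeadCfg σ H.S H.C H.ι :=
  match c.verdict with
  | some _ => c
  | none =>
    match H.act c.state coin (H.asking x c && answer A c.query) (scan x c.inPos) c.view with
    | .halt v => { c with verdict := some v }
    | .step s im out upd mv =>
      { state := s
        verdict := none
        inPos := moveBounded x.length c.inPos im
        mem := fun j => upd (fun h => decide (c.head h = j)) (c.mem j)
        head := fun h => (mv h).apply (c.head h)
        query := (if H.asking x c then [] else c.query) ++ out.toList }

/-- The initial configuration. -/
def init : HeadCfg σ H.S H.C H.ι where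
  state := H.start
  verdict := none
  inPos := 0
  mem := fun j => if j = 0 then H.corner else H.blank
  head := fun _ => 0
  query := []

/-- The configuration after `t` steps. -/
def run (A : Language σ) (x : List Bool) (coins : ℕ → Bool) (t : ℕ) : HeadCfg σ H.S H.C H.ι :=
  drive (H.step A x) H.init coins t

/-! ### Simulation by sweeps of a single head -/

/-- States of the sweeping machine. -/
inductive SweepState (S C ι : Type)
  | boot
  /-- Sweep to the right: complete pending right moves and collect the views of the heads. -/
  | right (s : S) (pending carry prev : ι → Bool) (g : ι → View C ι)
  | decide (s : S) (g : ι → View C ι)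
  | apply (s : S) (g : ι → View C ι) (ans : Bool)
  /-- Sweep to the left: update the cells and move the heads, except for moves to the right. -/
  | left (s : S) (upd : (ι → Bool) → C → C) (mv : ι → HeadMove) (carry : ι → Bool)

theorem finite_headMove : Finite HeadMove := by
  refine Finite.of_injective (β := Fin 5)
    (fun | .left => 0 | .stay => 1 | .right => 2 | .zero => 3 | .one => 4) ?_
  intro a b h
  cases a <;> cases b <;> simp_all

theorem finite_view {C ι : Type} [Finite C] [Finite ι] : Finite (View C ι) :=
  Finite.of_injective (fun v => (v.cell, v.here, v.before)) (by
    rintro ⟨a, b, c⟩ ⟨a', b', c'⟩ h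
    simp_all)

theorem finite_sweepState {S C ι : Type} [Finite S] [Finite C] [Finite ι] :
    Finite (SweepState S C ι) := by
  have := finite_headMove
  have : Finite (View C ι) := finite_view
  refine Finite.of_injective (β := Unit ⊕ (S × (ι → Bool) × (ι → Bool) × (ι → Bool) × (ι → View C ι)) ⊕
    (S × (ι → View C ι)) ⊕ (S × (ι → View C ι) × Bool) ⊕
    (S × ((ι → Bool) → C → C) × (ι → HeadMove) × (ι → Bool)))
    (fun
      | .boot => .inl ()
      | .right s p c q g => .inr (.inl (s, p, c, q, g))
      | .decide s g => .inr (.inr (.inl (s, g)))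
      | .apply s g a => .inr (.inr (.inr (.inl (s, g, a))))
      | .left s u m c => .inr (.inr (.inr (.inr (s, u, m, c))))) ?_
  intro a b h
  cases a <;> cases b <;> simp_all

/-- Whether a move leaves a pending step to the right after the sweep to the left. -/
def _root_.Catalytic.HeadMove.pending : HeadMove → Bool
  | .right => true
  | .one => true
  | _ => false

/-- The position of a head after the sweep to the left. -/
def _root_.Catalytic.HeadMove.base : HeadMove → ℕ → ℕ
  | .left, p => p - 1
  | .stay, p => p
  | .right, p => p
  | .zero, _ => 0
  | .one, _ => 0

/-- A sweep to the left can carry heads to the left but not to the right. So each move splits into a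
part done by that sweep and at most one step to the right, which the next sweep to the right
performs; `one` becomes a jump to the first cell followed by such a step. -/
theorem _root_.Catalytic.HeadMove.apply_eq (m : HeadMove) (p : ℕ) :
    m.apply p = m.base p + if m.pending then 1 else 0 := by
  cases m <;> simp [HeadMove.apply, HeadMove.base, HeadMove.pending]

/-- Whether a head is left on a cell by the sweep to the left; `z`: the cell is the first one, `m`:
the head was there before, `carry`: the head moves here from the right. -/
def _root_.Catalytic.HeadMove.mark (z m carry : Bool) : HeadMove → Bool
  | .left => (z && m) || carry
  | .stay => m
  | .right => m
  | .zero => z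
  | .one => z

/-- Transitions of the sweeping machine. Tape cells are blank (`none`) or hold a flag for the first
cell, a memory cell, and the set of the heads on it. -/
def sweepTrans (q : SweepState H.S H.C H.ι) (coin : Bool) (sc : Scan Bool)
    (γ : Option (Bool × H.C × (H.ι → Bool))) :
    ProbAct σ (SweepState H.S H.C H.ι) (Option (Bool × H.C × (H.ι → Bool))) 1 :=
  match q with
  | .boot =>
    .step (.right H.start (fun _ => false) (fun _ => false) (fun _ => false)
      (fun _ => ⟨H.blank, fun _ => false, fun _ => false⟩)) .stay
      (fun _ => some (true, H.corner, fun _ => true)) (fun _ => .stay) none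
  | .right s pending carry prev g =>
    match γ with
    | some (z, c, m) =>
      let m' := fun h => (m h && !pending h) || carry h
      .step (.right s pending (fun h => m h && pending h) m'
        (fun h => if m' h then ⟨c, m', prev⟩ else g h)) .stay
        (fun _ => some (z, c, m')) (fun _ => .right) none
    | none =>
      .step (.decide s g) .stay (fun _ => some (false, H.blank, fun _ => false)) (fun _ => .stay)
        none
  | .decide s g =>
    if H.asks s sc g then .ask (.apply s g true) (.apply s g false)
    else .step (.apply s g false) .stay (fun _ => γ) (fun _ => .stay) none
  | .apply s g ans =>
    match H.act s coin ans sc g with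
    | .halt v => .halt v
    | .step s' im out upd mv =>
      .step (.left s' upd mv (fun _ => false)) im (fun _ => γ) (fun _ => .stay) out
  | .left s upd mv carry =>
    match γ with
    | some (z, c, m) =>
      let γ' := some (z, upd m c, fun h => (mv h).mark z (m h) (carry h))
      if z then
        .step (.right s (fun h => (mv h).pending) (fun _ => false) (fun _ => false)
          (fun _ => ⟨H.blank, fun _ => false, fun _ => false⟩)) .stay
          (fun _ => γ') (fun _ => .stay) none
      else
        .step (.left s upd mv (fun h => match mv h with | .left => m h | _ => false)) .stay
          (fun _ => γ') (fun _ => .left) none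
    | none => .halt .dontKnow

/-- The sweeping machine. -/
def sweeper : ProbMachine σ where
  Q := SweepState H.S H.C H.ι
  finiteQ := have := H.finiteS; have := H.finiteC; have := H.finiteι; finite_sweepState
  Γ := Option (Bool × H.C × (H.ι → Bool))
  finiteΓ := by
    have := H.finiteC; have := H.finiteι; infer_instance
  blank := none
  K := 1
  start := .boot
  trans := fun q coin sc γ => H.sweepTrans q coin sc (γ 0)

/-- A configuration of the sweeping machine. -/
def sweepCfg (q : SweepState H.S H.C H.ι) (inPos : ℕ)
    (tape : ℕ → Option (Bool × H.C × (H.ι → Bool))) (pos : ℕ) (query : List σ) :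
    ProbCfg σ H.sweeper.Q H.sweeper.Γ H.sweeper.K :=
  ⟨q, none, inPos, fun _ => tape, fun _ => pos, query⟩

/-- A tape cell with the heads at the positions `p`. -/
def cellAt (mem : ℕ → H.C) (p : H.ι → ℕ) (j : ℕ) : Option (Bool × H.C × (H.ι → Bool)) :=
  some (decide (j = 0), mem j, fun h => decide (p h = j))

variable {H}

theorem sweeper_step_step {A : Language σ} {x : List Bool} {q q' : SweepState H.S H.C H.ι}
    {inPos : ℕ} {tape tape' : ℕ → Option (Bool × H.C × (H.ι → Bool))} {pos : ℕ} {query : List σ}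
    {coin : Bool} {im : Dir} {γ : Option (Bool × H.C × (H.ι → Bool))} {d : Dir} {out : Option σ}
    (h : H.sweepTrans q coin (scan x inPos) (tape pos) =
      .step q' im (fun _ => γ) (fun _ => d) out)
    (htape : Function.update tape pos γ = tape') :
    H.sweeper.step A x (H.sweepCfg q inPos tape pos query) coin =
      H.sweepCfg q' (moveBounded x.length inPos im) tape' (moveInf pos d)
        (query ++ out.toList) := by
  have h' : H.sweeper.trans q coin (scan x inPos) (fun _ => tape pos) =
    .step q' im (fun _ => γ) (fun _ => d) out := h
  subst htape
  simp only [ProbMachine.step, sweepCfg, h']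
  rfl

theorem sweeper_step_halt {A : Language σ} {x : List Bool} {q : SweepState H.S H.C H.ι}
    {inPos : ℕ} {tape : ℕ → Option (Bool × H.C × (H.ι → Bool))} {pos : ℕ} {query : List σ}
    {coin : Bool} {v : Verdict}
    (h : H.sweepTrans q coin (scan x inPos) (tape pos) = .halt v) :
    (H.sweeper.step A x (H.sweepCfg q inPos tape pos query) coin).verdict = some v := by
  have h' : H.sweeper.trans q coin (scan x inPos) (fun _ => tape pos) = .halt v := h
  simp only [ProbMachine.step, sweepCfg, h']

theorem sweeper_step_ask {A : Language σ} {x : List Bool} {q q₁ q₂ : SweepState H.S H.C H.ι}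
    {inPos : ℕ} {tape : ℕ → Option (Bool × H.C × (H.ι → Bool))} {pos : ℕ} {query : List σ}
    {coin : Bool} (h : H.sweepTrans q coin (scan x inPos) (tape pos) = .ask q₁ q₂) :
    H.sweeper.step A x (H.sweepCfg q inPos tape pos query) coin =
      H.sweepCfg (if answer A query then q₁ else q₂) inPos tape pos [] := by
  have h' : H.sweeper.trans q coin (scan x inPos) (fun _ => tape pos) = .ask q₁ q₂ := h
  simp only [ProbMachine.step, sweepCfg, h']
  rfl

end HeadMachine
end Catalytic
end

/-! ### Correctness and running time of the sweeping machine -/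

noncomputable section

namespace Catalytic
namespace HeadMachine
variable {σ : Type} {H : HeadMachine σ}

/-- Configurations of the sweeping machine before the simulation of a step: `t + 1` cells are in
use, and the heads with pending moves are still at their old positions. -/
def AtLeft (c : HeadCfg σ H.S H.C H.ι) (t : ℕ)
    (d : ProbCfg σ H.sweeper.Q H.sweeper.Γ H.sweeper.K) : Prop :=
  ∃ (pending : H.ι → Bool) (base : H.ι → ℕ),
    (∀ h, c.head h = base h + if pending h then 1 else 0) ∧
    d = H.sweepCfg (.right c.state pending (fun _ => false) (fun _ => false)
      (fun _ => ⟨H.blank, fun _ => false, fun _ => false⟩)) c.inPos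
      (fun j => if j ≤ t then H.cellAt c.mem base j else none) 0 c.query

section sweeps

variable {A : Language σ} {x : List Bool} {coins : ℕ → Bool}

/-- The loop invariant of the sweep to the right: to the left of the scanned cell the marks already
show the true head positions, elsewhere still the old ones. The carry consists of the heads just
taken off the previous cell, and the views of all heads already passed are collected. -/
theorem sweep_right {c : HeadCfg σ H.S H.C H.ι} {t T : ℕ} {pending : H.ι → Bool} {base : H.ι → ℕ}
    {g : H.ι → View H.C H.ι}
    (hbase : ∀ h, c.head h = base h + if pending h then 1 else 0)
    (hd : drive (H.sweeper.step A x) H.sweeper.init coins T =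
      H.sweepCfg (.right c.state pending (fun _ => false) (fun _ => false) g) c.inPos
      (fun j => if j ≤ t then H.cellAt c.mem base j else none) 0 c.query)
    (i : ℕ) (hi : i ≤ t + 1) :
    drive (H.sweeper.step A x) H.sweeper.init coins (T + i) =
      H.sweepCfg (.right c.state pending (fun h => pending h && decide (base h + 1 = i))
        (fun h => decide (c.head h + 1 = i)) (fun h => if c.head h < i then c.view h else g h))
        c.inPos
        (fun j => if j < i then H.cellAt c.mem c.head j else
          if j ≤ t then H.cellAt c.mem base j else none) i c.query := by
  induction i with
  | zero => simpa using hd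
  | succ i ih =>
    rw [← Nat.add_assoc, drive, ih (by omega)]
    have hmark : (fun h => (decide (base h = i) && !pending h) ||
        (pending h && decide (base h + 1 = i))) = fun h => decide (c.head h = i) := by
      funext h
      rw [hbase h]
      cases pending h <;> simp
    rw [sweeper_step_step (q' := .right c.state pending
        (fun h => pending h && decide (base h + 1 = i + 1))
        (fun h => decide (c.head h + 1 = i + 1))
        (fun h => if c.head h < i + 1 then c.view h else g h))
      (γ := H.cellAt c.mem c.head i) (im := .stay) (d := .right) (out := none) ?_ rfl]
    · simp only [sweepCfg, moveBounded, moveInf, Option.toList_none, List.append_nil]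
      congr 1
      funext _ j
      by_cases hj : j = i
      · subst hj; simp
      · rw [Function.update_of_ne hj]
        have : j < i ↔ j < i + 1 := by omega
        simp only [this]
    · simp only [lt_irrefl, if_false, if_pos (show i ≤ t by omega), sweepTrans, cellAt, hmark]
      congr 2
      · funext h
        simp [Bool.and_comm]
      · funext h
        simp
      · funext h
        have e := congrFun hmark h
        simp only [e]
        by_cases hh : c.head h = i
        · simp [hh, HeadCfg.view]
        · have : c.head h < i ↔ c.head h < i + 1 := by omega
          simp only [hh, decide_false, Bool.false_eq_true, if_false, this]

/-- Here the invariant runs in the other direction: cells to the right of the scanned one are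
already updated. The carry holds the heads with move `left` that were on the cell visited just
before. -/
theorem sweep_left {c : HeadCfg σ H.S H.C H.ι} {s : H.S} {upd : (H.ι → Bool) → H.C → H.C}
    {mv : H.ι → HeadMove} {inPos : ℕ} {query : List σ} {t : ℕ} (j : ℕ) (hj : j ≤ t) {T : ℕ}
    (hd : drive (H.sweeper.step A x) H.sweeper.init coins T =
      H.sweepCfg (.left s upd mv
          (fun h => match mv h with | .left => decide (c.head h = j + 1) | _ => false)) inPos
        (fun k => if k ≤ j then H.cellAt c.mem c.head k else if k ≤ t then
          H.cellAt (fun j => upd (fun h => decide (c.head h = j)) (c.mem j))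
            (fun h => (mv h).base (c.head h)) k else none) j query) :
    drive (H.sweeper.step A x) H.sweeper.init coins (T + (j + 1)) =
      H.sweepCfg (.right s (fun h => (mv h).pending) (fun _ => false) (fun _ => false)
      (fun _ => ⟨H.blank, fun _ => false, fun _ => false⟩)) inPos
      (fun k => if k ≤ t then
          H.cellAt (fun j => upd (fun h => decide (c.head h = j)) (c.mem j))
            (fun h => (mv h).base (c.head h)) k else none) 0 query := by
  -- The local marking rule, which sees one cell and the carry, agrees with the global description
  -- of where the sweep leaves each head.
  have key : ∀ j, (fun h => (mv h).mark (decide (j = 0)) (decide (c.head h = j))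
      (match mv h with | .left => decide (c.head h = j + 1) | _ => false)) =
      fun h => decide ((mv h).base (c.head h) = j) := by
    intro j
    funext h
    cases mv h <;> simp only [HeadMove.mark, HeadMove.base, ← Bool.decide_and, ← Bool.decide_or]
      <;> apply decide_eq_decide.2 <;> omega
  induction j generalizing T with
  | zero =>
    rw [← Nat.add_assoc, Nat.add_zero, drive, hd,
      sweeper_step_step (q' := .right s (fun h => (mv h).pending) (fun _ => false) (fun _ => false)
      (fun _ => ⟨H.blank, fun _ => false, fun _ => false⟩))
      (γ := H.cellAt (fun j => upd (fun h => decide (c.head h = j)) (c.mem j))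
            (fun h => (mv h).base (c.head h)) 0) (im := .stay) (d := .stay) (out := none) ?_ rfl]
    · simp only [sweepCfg, moveBounded, moveInf, Option.toList_none, List.append_nil]
      congr 1
      funext _ k
      by_cases hk : k = 0
      · subst hk; simp
      · rw [Function.update_of_ne hk]
        simp [hk]
    · have := key 0
      simp only [decide_true, Nat.zero_add] at this
      simp [sweepTrans, cellAt, this]
  | succ j ih =>
    rw [show T + (j + 1 + 1) = T + 1 + (j + 1) by omega]
    apply ih (by omega)
    rw [drive, hd, sweeper_step_step (q' := .left s upd mv
          (fun h => match mv h with | .left => decide (c.head h = j + 1) | _ => false))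
      (γ := H.cellAt (fun j => upd (fun h => decide (c.head h = j)) (c.mem j))
            (fun h => (mv h).base (c.head h)) (j + 1)) (im := .stay) (d := .left) (out := none) ?_ rfl]
    · simp only [sweepCfg, moveBounded, moveInf, Option.toList_none, List.append_nil]
      congr 1
      funext _ k
      by_cases hk : k = j + 1
      · subst hk; simp [hj]
      · rw [Function.update_of_ne hk]
        have : k ≤ j + 1 ↔ k ≤ j := by omega
        simp only [this]
    · have := key (j + 1)
      simp only [Nat.add_eq_zero_iff, one_ne_zero, and_false, decide_false] at this
      simp only [le_refl, if_true, sweepTrans, cellAt, this, Nat.add_eq_zero_iff, one_ne_zero,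
        and_false, decide_false, Bool.false_eq_true, if_false]

/-- The 2 * t + 6 steps are: t + 1 for the sweep to the right, one to append a blank cell, one for
the oracle, one for the instruction itself, and t + 2 for the sweep to the left over one more cell.
The coin that counts is the one tossed at the instruction. -/
theorem sweep_step {c : HeadCfg σ H.S H.C H.ι} {t T : ℕ}
    (hv : c.verdict = none) (hhead : ∀ h, c.head h ≤ t) (hmem : ∀ j, t < j → c.mem j = H.blank)
    (hd : AtLeft c t (drive (H.sweeper.step A x) H.sweeper.init coins T)) :
    ((H.step A x c (coins (T + t + 3))).verdict = none →
      AtLeft (H.step A x c (coins (T + t + 3))) (t + 1)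
        (drive (H.sweeper.step A x) H.sweeper.init coins (T + (2 * t + 6)))) ∧
    ∀ v, (H.step A x c (coins (T + t + 3))).verdict = some v →
      (drive (H.sweeper.step A x) H.sweeper.init coins (T + t + 4)).verdict = some v := by
  obtain ⟨pending, base, hbase, hd⟩ := hd
  have h1 := sweep_right hbase hd (t + 1) le_rfl
  have h2 : drive (H.sweeper.step A x) H.sweeper.init coins (T + t + 2) =
      H.sweepCfg (.decide c.state c.view) c.inPos
      (fun j => if j ≤ t + 1 then H.cellAt c.mem c.head j else none) (t + 1) c.query := by
    rw [drive, show T + t + 1 = T + (t + 1) by omega, h1,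
      sweeper_step_step (q' := .decide c.state c.view)
      (γ := H.cellAt c.mem c.head (t + 1)) (im := .stay) (d := .stay) (out := none) ?_ rfl]
    · simp only [sweepCfg, moveBounded, moveInf, Option.toList_none, List.append_nil]
      congr 1
      funext _ k
      by_cases hk : k = t + 1
      · subst hk; simp
      · rw [Function.update_of_ne hk]
        have h1 : k < t + 1 ↔ k ≤ t := by omega
        have h2 : k ≤ t + 1 ↔ k ≤ t := by omega
        simp only [h1, h2]
        split_ifs <;> rfl
    · have e1 : (fun h => if c.head h < t + 1 then c.view h else
          ⟨H.blank, fun _ => false, fun _ => false⟩) = c.view := by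
        funext h
        simp [show c.head h < t + 1 by have := hhead h; omega]
      have e2 : (fun h => decide (c.head h = t + 1)) = fun _ => false := by
        funext h
        simp [show c.head h ≠ t + 1 by have := hhead h; omega]
      simp only [lt_irrefl, if_false, show ¬ (t + 1 ≤ t) by omega, sweepTrans, e1, cellAt,
        hmem (t + 1) (by omega), e2]
      simp
  have h3 : drive (H.sweeper.step A x) H.sweeper.init coins (T + t + 3) =
      H.sweepCfg (.apply c.state c.view (H.asking x c && answer A c.query)) c.inPos
      (fun j => if j ≤ t + 1 then H.cellAt c.mem c.head j else none) (t + 1)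
      (if H.asking x c then [] else c.query) := by
    rw [drive, h2]
    cases hask : H.asking x c
    · rw [sweeper_step_step (q' := .apply c.state c.view false)
        (γ := H.cellAt c.mem c.head (t + 1)) (im := .stay) (d := .stay) (out := none) ?_ rfl]
      · simp only [sweepCfg, moveBounded, moveInf, Option.toList_none, List.append_nil]
        congr 1
        funext _ k
        by_cases hk : k = t + 1
        · subst hk; simp
        · rw [Function.update_of_ne hk]
      · simp only [asking] at hask
        simp [sweepTrans, hask]
    · rw [sweeper_step_ask (q₁ := .apply c.state c.view true) (q₂ := .apply c.state c.view false)]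
      · cases answer A c.query <;> simp
      · simp only [asking] at hask
        simp [sweepTrans, hask]
  cases hact : H.act c.state (coins (T + t + 3)) (H.asking x c && answer A c.query)
    (scan x c.inPos) c.view with
  | halt v =>
    have e : H.step A x c (coins (T + t + 3)) = { c with verdict := some v } := by
      simp only [step, hv, hact]
    rw [e]
    refine ⟨by simp, fun v' hv' => ?_⟩
    have : v = v' := by simpa using hv'
    subst this
    rw [drive, h3]
    apply sweeper_step_halt
    simp only [sweepTrans, hact]
  | step s im out upd mv =>
    have e : H.step A x c (coins (T + t + 3)) =
      { state := s
        verdict := none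
        inPos := moveBounded x.length c.inPos im
        mem := fun j => upd (fun h => decide (c.head h = j)) (c.mem j)
        head := fun h => (mv h).apply (c.head h)
        query := (if H.asking x c then [] else c.query) ++ out.toList } := by
      simp only [step, hv, hact]
    rw [e]
    refine ⟨fun _ => ?_, by simp⟩
    refine ⟨fun h => (mv h).pending, fun h => (mv h).base (c.head h),
      fun h => (mv h).apply_eq _, ?_⟩
    rw [show T + (2 * t + 6) = T + t + 4 + (t + 1 + 1) by omega]
    apply sweep_left (t + 1) le_rfl (c := c)
    rw [drive, h3, sweeper_step_step (q' := .left s upd mv (fun _ => false))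
      (γ := H.cellAt c.mem c.head (t + 1)) (im := im) (d := .stay) (out := out) ?_ rfl]
    · simp only [sweepCfg, moveInf]
      congr 1
      · congr 1
        -- The sweep to the left starts with an empty carry: all heads are at most at `t`, so none
        -- comes from beyond the appended cell `t + 1`.
        funext h
        have := hhead h
        cases mv h <;> simp
        omega
      · funext _ k
        by_cases hk : k = t + 1
        · subst hk; simp
        · rw [Function.update_of_ne hk]
          by_cases hk' : k ≤ t + 1 <;> simp [hk']
    · simp only [sweepTrans, hact, le_refl, if_true]

end sweeps

/-- The number of steps after which the sweeping machine has simulated `t` steps. -/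
def sweepTime (t : ℕ) : ℕ := t ^ 2 + 5 * t + 1

/-- The coin toss of the sweeping machine that is used for the `t`-th simulated step. -/
def sweepCoin (t : ℕ) : ℕ := sweepTime t + t + 3

/-- In one step a head gets at most one cell further to the right, and by `upd_blank` a blank cell
without heads stays blank. This is why one new tape cell per simulated step suffices. -/
theorem step_bounds {A : Language σ} {x : List Bool} {c : HeadCfg σ H.S H.C H.ι} {t : ℕ}
    {coin : Bool} (hhead : ∀ h, c.head h ≤ t) (hmem : ∀ j, t < j → c.mem j = H.blank) :
    (∀ h, (H.step A x c coin).head h ≤ t + 1) ∧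
      ∀ j, t + 1 < j → (H.step A x c coin).mem j = H.blank := by
  unfold step
  split
  · exact ⟨fun h => (hhead h).trans (Nat.le_succ t), fun j hj => hmem j (by omega)⟩
  · split
    · exact ⟨fun h => (hhead h).trans (Nat.le_succ t), fun j hj => hmem j (by omega)⟩
    · rename_i s im out upd mv hact
      refine ⟨fun h => ?_, fun j hj => ?_⟩
      · have := hhead h
        cases hm : mv h <;> simp [HeadMove.apply, hm] <;> omega
      · have e : (fun h => decide (c.head h = j)) = fun _ => false := by
          funext h
          have := hhead h
          simp; omega
        simp only [hmem j (by omega), e]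
        exact H.upd_blank hact

theorem run_bounds (A : Language σ) (x : List Bool) (coins : ℕ → Bool) (t : ℕ) :
    (∀ h, (H.run A x coins t).head h ≤ t) ∧
      ∀ j, t < j → (H.run A x coins t).mem j = H.blank := by
  induction t with
  | zero =>
    refine ⟨fun h => le_rfl, fun j hj => ?_⟩
    simp [run, drive, init, show j ≠ 0 by omega]
  | succ t ih => exact step_bounds ih.1 ih.2

theorem run_of_verdict {A : Language σ} {x : List Bool} {coins : ℕ → Bool} {t : ℕ} {v : Verdict}
    (h : (H.run A x coins t).verdict = some v) (s : ℕ) :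
    H.run A x coins (t + s) = H.run A x coins t := by
  apply drive_fixed
  intro b
  change H.step A x (H.run A x coins t) b = _
  simp only [step, h]
  rfl

theorem sweeper_drive_of_verdict {A : Language σ} {x : List Bool} {coins : ℕ → Bool} {t : ℕ}
    {v : Verdict} (h : (drive (H.sweeper.step A x) H.sweeper.init coins t).verdict = some v)
    {s : ℕ} (hs : t ≤ s) :
    (drive (H.sweeper.step A x) H.sweeper.init coins s).verdict = some v := by
  obtain ⟨s, rfl⟩ := Nat.exists_eq_add_of_le hs
  rw [drive_fixed, h]
  intro b
  simp only [ProbMachine.step, h]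

/-- After the first step, which sets up the corner cell, the costs 2 * i + 6 for i < t add up to t ^
2 + 5 * t. The simulated machine sees the subsequence of the coins selected by `sweepCoin`. -/
theorem sweeper_drive (A : Language σ) (x : List Bool) (coins : ℕ → Bool) (t : ℕ) :
    ((H.run A x (fun i => coins (sweepCoin i)) t).verdict = none →
      AtLeft (H.run A x (fun i => coins (sweepCoin i)) t) t
        (drive (H.sweeper.step A x) H.sweeper.init coins (sweepTime t))) ∧
    ∀ v, (H.run A x (fun i => coins (sweepCoin i)) t).verdict = some v →
      (drive (H.sweeper.step A x) H.sweeper.init coins (sweepTime t)).verdict = some v := by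
  induction t with
  | zero =>
    refine ⟨fun _ => ⟨fun _ => false, fun _ => 0, by simp [run, drive, init], ?_⟩,
      by simp [run, drive, init]⟩
    have hinit : H.sweeper.init = H.sweepCfg .boot 0 (fun _ => none) 0 [] := rfl
    change H.sweeper.step A x H.sweeper.init (coins 0) = _
    rw [hinit, sweeper_step_step (im := .stay) (d := .stay) (out := none)
      (γ := some (true, H.corner, fun _ => true)) rfl rfl]
    simp only [sweepCfg, moveBounded, moveInf]
    congr 1
    funext _ k
    by_cases hk : k = 0
    · subst hk; simp [cellAt, run, drive, init]
    · rw [Function.update_of_ne hk]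
      simp [hk]
  | succ t ih =>
    have hrun : H.run A x (fun i => coins (sweepCoin i)) (t + 1) =
      H.step A x (H.run A x (fun i => coins (sweepCoin i)) t) (coins (sweepTime t + t + 3)) := rfl
    have htime : sweepTime (t + 1) = sweepTime t + (2 * t + 6) := by
      simp only [sweepTime]; ring
    cases hv : (H.run A x (fun i => coins (sweepCoin i)) t).verdict with
    | none =>
      obtain ⟨hb1, hb2⟩ := run_bounds A x (H := H) (fun i => coins (sweepCoin i)) t
      obtain ⟨h1, h2⟩ := sweep_step hv hb1 hb2 (ih.1 hv)
      rw [hrun, htime]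
      exact ⟨h1, fun v hv' => sweeper_drive_of_verdict (h2 v hv') (by omega)⟩
    | some v =>
      rw [run_of_verdict hv 1, hv]
      exact ⟨by simp, fun v' hv' => sweeper_drive_of_verdict (ih.2 v' (hv.trans hv')) (by omega)⟩

/-- The sweeping machine has the same output as the simulated machine. -/
theorem sweeper_output {A : Language σ} {x : List Bool} {t T : ℕ} (hT : sweepTime t ≤ T)
    (coins : ℕ → Bool) {v : Verdict}
    (hv : (H.run A x (fun i => coins (sweepCoin i)) t).verdict = some v) :
    H.sweeper.output A x (fun i : Fin T => coins i) = some v := by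
  rw [ProbMachine.output, foldl_ofFn_eq_drive]
  exact sweeper_drive_of_verdict ((sweeper_drive A x coins t).2 v hv) hT

end HeadMachine
end Catalytic
end

/-! ### Invariants of the catalytic machine, and a pigeonhole principle -/

noncomputable section

namespace Catalytic

theorem length_writeAt (l : List Bool) (p : ℕ) (b : Option Bool) :
    (writeAt l p b).length = l.length := by
  unfold writeAt
  split
  · rfl
  · split_ifs <;> simp

theorem moveBounded_le {len pos : ℕ} (h : pos ≤ len + 1) (d : Dir) :
    moveBounded len pos d ≤ len + 1 := by
  cases d <;> simp only [moveBounded] <;> omega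

namespace RoundMachine

variable {σ : Type} (M : RoundMachine σ)

/-- The length of the tape of the in-place computations. -/
def zLen (n : ℕ) : ℕ := M.workLen n + M.catLen n

/-- Well-formedness of the private part of an in-place computation. -/
structure InPlaceWF (n : ℕ) (ip : InPlaceCfg) : Prop where
  aux : ip.aux.length = M.auxLen n
  auxPos : ip.auxPos ≤ M.auxLen n + 1
  one_le : 1 ≤ ip.writePos
  le_read : ip.writePos ≤ ip.readPos
  readPos : ip.readPos ≤ M.zLen n + 1

/-- Well-formedness of a configuration up to its phase. -/
structure BaseWF (n : ℕ) (c : RoundCfg σ M.Q) : Prop where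
  inPos : c.inPos ≤ n + 1
  work : c.work.length = M.workLen n
  workPos : c.workPos ≤ M.workLen n + 1
  cat : c.cat.length = M.catLen n
  catPos : c.catPos ≤ M.catLen n + 1

/-- Well-formedness of a phase. -/
def PhaseWF (n : ℕ) : Phase σ → Prop
  | .between _ ip => M.InPlaceWF n ip
  | .answers _ ip => M.InPlaceWF n ip
  | _ => True

variable {M} {A : Language σ} {x : List Bool}

theorem BaseWF.length_z {n : ℕ} {c : RoundCfg σ M.Q} (h : M.BaseWF n c) :
    (c.work ++ c.cat).length = M.zLen n := by
  rw [List.length_append, h.work, h.cat, zLen]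

theorem inPlaceWF_fresh (n : ℕ) : M.InPlaceWF n (M.freshInPlace n) := by
  constructor <;> simp [freshInPlace]

theorem inPlaceStep_wf {c : RoundCfg σ M.Q} {ip : InPlaceCfg} (hc : M.BaseWF x.length c)
    (hip : M.InPlaceWF x.length ip) :
    M.BaseWF x.length (M.inPlaceStep x c ip).1 ∧
      ∀ ip', (M.inPlaceStep x c ip).2 = some ip' → M.InPlaceWF x.length ip' := by
  have hz := hc.length_z
  unfold inPlaceStep
  dsimp only
  split
  · exact ⟨⟨hc.inPos, hc.work, hc.workPos, hc.cat, hc.catPos⟩, by simp⟩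
  · refine ⟨⟨moveBounded_le hc.inPos _, ?_, hc.workPos, ?_, hc.catPos⟩, ?_⟩
    · simp only [List.length_take, length_writeAt, List.length_append]
      have := hc.work
      omega
    · simp only [List.length_drop, length_writeAt, List.length_append]
      have := hc.cat
      omega
    · rintro ip' h
      have h := Option.some.inj h
      subst h
      have hr := hip.readPos
      have hw := hip.le_read
      have h1 := hip.one_le
      rw [hz]
      rename_i zAdvance zRead _
      have := moveBounded_le hr zRead
      refine ⟨(length_writeAt _ _ _).trans hip.aux, ?_, ?_, le_max_left _ _, ?_⟩
      · dsimp only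
        rw [hip.aux]
        exact moveBounded_le hip.auxPos _
      · dsimp only [moveBounded]
        split_ifs <;> omega
      · dsimp only [moveBounded] at this ⊢
        split_ifs <;> omega

theorem wf_step {c : RoundCfg σ M.Q} (hc : M.BaseWF x.length c) (hp : M.PhaseWF x.length c.phase) :
    M.BaseWF x.length (M.step A x c) ∧ M.PhaseWF x.length (M.step A x c).phase := by
  have base : ∀ {d : RoundCfg σ M.Q} (p s r), M.BaseWF x.length d →
      M.BaseWF x.length { d with phase := p, state := s, rounds := r } :=
    fun _ _ _ h => ⟨h.inPos, h.work, h.workPos, h.cat, h.catPos⟩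
  unfold step
  split
  · exact ⟨hc, hp⟩
  · split
    · exact ⟨base _ _ _ hc, trivial⟩
    · exact ⟨base _ _ _ hc, trivial⟩
    · rename_i hph _ _ _ _ _ _ _ _
      refine ⟨⟨moveBounded_le hc.inPos _, (length_writeAt _ _ _).trans hc.work, ?_,
        (length_writeAt _ _ _).trans hc.cat, ?_⟩, by simp only [hph, PhaseWF]⟩
      · dsimp only; rw [hc.work]; exact moveBounded_le hc.workPos _
      · dsimp only; rw [hc.cat]; exact moveBounded_le hc.catPos _
  · split
    · refine ⟨⟨moveBounded_le hc.inPos _, (length_writeAt _ _ _).trans hc.work, ?_,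
        hc.cat, ?_⟩, trivial⟩
      · dsimp only; rw [hc.work]; exact moveBounded_le hc.workPos _
      · dsimp only; rw [hc.cat]; exact moveBounded_le hc.catPos _
    · exact ⟨base _ _ _ hc, inPlaceWF_fresh _⟩
    · exact ⟨base _ _ _ hc, inPlaceWF_fresh _⟩
  · rename_i prev ip hph
    rw [hph] at hp
    have h := inPlaceStep_wf hc hp
    split
    · rename_i heq
      rw [heq] at h
      exact ⟨base _ _ _ h.1, h.2 _ rfl⟩
    · rename_i heq
      rw [heq] at h
      exact ⟨base _ _ _ h.1, trivial⟩
  · rename_i rest ip hph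
    rw [hph] at hp
    have h := inPlaceStep_wf hc hp
    split
    · rename_i heq
      rw [heq] at h
      exact ⟨base _ _ _ h.1, h.2 _ rfl⟩
    · rename_i heq
      rw [heq] at h
      split
      · exact ⟨base _ _ _ h.1, trivial⟩
      · exact ⟨base _ _ _ h.1, inPlaceWF_fresh _⟩

theorem run_succ (τ : List Bool) (t : ℕ) : M.run A x τ (t + 1) = M.step A x (M.run A x τ t) :=
  Function.iterate_succ_apply' _ _ _

theorem wf_run {τ : List Bool} (hτ : τ.length = M.catLen x.length) (t : ℕ) :
    M.BaseWF x.length (M.run A x τ t) ∧ M.PhaseWF x.length (M.run A x τ t).phase := by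
  induction t with
  | zero => exact ⟨⟨by simp [run, init], by simp [run, init], by simp [run, init], hτ,
      by simp [run, init]⟩, trivial⟩
  | succ t ih =>
    rw [run_succ]
    exact wf_step ih.1 ih.2

theorem step_of_halted {c : RoundCfg σ M.Q} {b : Bool} (h : c.phase = .halted b) :
    M.step A x c = c := by
  simp only [step, h]

theorem run_of_halted {τ : List Bool} {t s : ℕ} {b : Bool}
    (h : (M.run A x τ t).phase = .halted b) (hts : t ≤ s) : M.run A x τ s = M.run A x τ t := by
  obtain ⟨s, rfl⟩ := Nat.exists_eq_add_of_le hts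
  induction s with
  | zero => rfl
  | succ s ih =>
    have := ih (by omega)
    rw [← Nat.add_assoc, run_succ, this, step_of_halted h]

end RoundMachine

/-! ### Repetitions in deterministic computations -/

/-- The key need not determine the next configuration, only how the run goes on as long as it stays
in `P`. After a repetition the run shifted by the period `p` shadows the original one, so membership
in `P` propagates indefinitely. -/
theorem invariant_forever_of_repeat {α β : Type*} {f : α → α} {P : α → Prop} {κ : α → β}
    (hκ : ∀ a b, P a → P b → κ a = κ b → P (f a) → P (f b) ∧ κ (f a) = κ (f b))
    {u : ℕ → α} (hu : ∀ t, u (t + 1) = f (u t)) {i p : ℕ} (hp : 0 < p)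
    (hP : ∀ s ≤ i + p, P (u s)) (hrep : κ (u i) = κ (u (i + p))) (s : ℕ) : P (u s) := by
  have key : ∀ s, P (u (i + s)) ∧ P (u (i + p + s)) ∧ κ (u (i + s)) = κ (u (i + p + s)) := by
    intro s
    induction s using Nat.strong_induction_on with
    | _ s ih =>
      rcases s with _ | s
      · exact ⟨hP _ (by omega), hP _ (by omega), hrep⟩
      · have h1 : P (u (i + (s + 1))) := by
          rcases le_or_gt (s + 1) p with h | h
          · exact hP _ (by omega)
          · have := (ih (s + 1 - p) (by omega)).2.1
            rwa [show i + p + (s + 1 - p) = i + (s + 1) by omega] at this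
        obtain ⟨h2, h3, h4⟩ := ih s (by omega)
        have e1 : u (i + (s + 1)) = f (u (i + s)) := hu _
        have e2 : u (i + p + (s + 1)) = f (u (i + p + s)) := hu _
        rw [e1] at h1 ⊢
        rw [e2]
        exact ⟨h1, hκ _ _ h2 h3 h4 h1⟩
  rcases le_or_gt s i with h | h
  · exact hP _ (by omega)
  · have := (key (s - i)).1
    rwa [show i + (s - i) = s by omega] at this

/-- A computation that does not stay in `P` forever leaves `P` after at most as many steps as there
are values of a key that determines how the computation goes on within `P`. -/
theorem exists_leave {α β : Type*} {f : α → α} {P : α → Prop} {κ : α → β} {K : Set β}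
    (hK : K.Finite) (hPK : ∀ a, P a → κ a ∈ K)
    (hκ : ∀ a b, P a → P b → κ a = κ b → P (f a) → P (f b) ∧ κ (f a) = κ (f b))
    {u : ℕ → α} (hu : ∀ t, u (t + 1) = f (u t)) (hleave : ∃ s, ¬ P (u s)) :
    ∃ s ≤ K.ncard, ¬ P (u s) ∧ ∀ r < s, P (u r) := by
  classical
  let s := Nat.find hleave
  refine ⟨s, ?_, Nat.find_spec hleave, fun r hr => not_not.1 (Nat.find_min hleave hr)⟩
  by_contra! hlt
  have hP : ∀ r < s, P (u r) := fun r hr => not_not.1 (Nat.find_min hleave hr)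
  -- All of the first `s` configurations lie in `P`, and `s` exceeds the number of keys.
  have : ∃ i ∈ Finset.range s, ∃ j ∈ Finset.range s, i ≠ j ∧ κ (u i) = κ (u j) := by
    apply Finset.exists_ne_map_eq_of_card_lt_of_maps_to (t := hK.toFinset)
    · rwa [Finset.card_range, ← Set.ncard_eq_toFinset_card K hK]
    · intro i hi
      simpa using hPK _ (hP i (by simpa using hi))
  obtain ⟨i, hi, j, hj, hij, he⟩ := this
  rw [Finset.mem_range] at hi hj
  wlog hlt : i < j generalizing i j
  · exact this j hj i hi hij.symm he.symm (by omega)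
  apply Nat.find_spec hleave
  refine invariant_forever_of_repeat hκ hu (i := i) (p := j - i) (by omega)
    (fun r hr => hP r (by omega)) ?_ _
  rw [he, show i + (j - i) = j by omega]

theorem ncard_length_eq (n : ℕ) : {l : List Bool | l.length = n}.ncard = 2 ^ n := by
  change Nat.card (List.Vector Bool n) = _
  rw [Nat.card_eq_fintype_card, card_vector, Fintype.card_bool]

theorem ncard_Iic (n : ℕ) : (Set.Iic n).ncard = n + 1 := by
  rw [Set.ncard_eq_toFinset_card']
  simp

end Catalytic
end

/-! ### Duration of a single stage of a round -/

noncomputable section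

namespace Catalytic

/-- The running in-place computation. -/
def Phase.inPlace {σ : Type} : Phase σ → InPlaceCfg
  | .between _ ip => ip
  | .answers _ ip => ip
  | _ => ⟨[], 0, 0, 0⟩

/-- The phases of a round of queries. -/
def Phase.Busy {σ : Type} : Phase σ → Prop
  | .main => False
  | .halted _ => False
  | _ => True

/-- A measure of progress within a round of at most `m` queries. -/
def Phase.stage {σ : Type} (Λ m : ℕ) : Phase σ → ℕ
  | .query prev _ => (2 * prev.length + 1) * Λ
  | .between prev ip => 2 * prev.length * Λ + ip.writePos
  | .answers rest ip => (2 * m + (m - rest.length)) * Λ + ip.writePos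
  | _ => 0

namespace RoundMachine

variable {σ : Type} (M : RoundMachine σ)

/-- The data that determine the steps within the query phase before the next in-place
computation. -/
def queryKeys (n : ℕ) : Set (M.Q × ℕ × List Bool × ℕ × ℕ) :=
  Set.univ ×ˢ Set.Iic (n + 1) ×ˢ {l | l.length = M.workLen n} ×ˢ Set.Iic (M.workLen n + 1) ×ˢ
    Set.Iic (M.catLen n + 1)

/-- The data that determine the steps of an in-place computation while the write head stays. -/
def inPlaceKeys (n : ℕ) : Set (M.Q × ℕ × List Bool × ℕ × ℕ × Option Bool) :=
  Set.univ ×ˢ Set.Iic (n + 1) ×ˢ {l | l.length = M.auxLen n} ×ˢ Set.Iic (M.auxLen n + 1) ×ˢ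
    Set.Iic (M.zLen n + 1) ×ˢ Set.univ

/-- A bound on the number of steps of a stage of a round. -/
def stageTime (n : ℕ) : ℕ :=
  Nat.card M.Q * ((n + 2) * (2 ^ M.workLen n * ((M.workLen n + 2) * (M.catLen n + 2)))) +
  Nat.card M.Q * ((n + 2) * (2 ^ M.auxLen n * ((M.auxLen n + 2) * ((M.zLen n + 2) * 3))))

theorem finite_queryKeys (n : ℕ) : (M.queryKeys n).Finite :=
  have := M.finiteQ
  Set.finite_univ.prod ((Set.finite_Iic _).prod ((List.finite_length_eq _ _).prod
    ((Set.finite_Iic _).prod (Set.finite_Iic _))))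

theorem finite_inPlaceKeys (n : ℕ) : (M.inPlaceKeys n).Finite :=
  have := M.finiteQ
  Set.finite_univ.prod ((Set.finite_Iic _).prod ((List.finite_length_eq _ _).prod
    ((Set.finite_Iic _).prod ((Set.finite_Iic _).prod Set.finite_univ))))

theorem ncard_queryKeys_le (n : ℕ) : (M.queryKeys n).ncard ≤ M.stageTime n := by
  simp only [queryKeys, Set.ncard_prod, ncard_Iic, Set.ncard_univ, ncard_length_eq, stageTime]
  exact Nat.le_add_right _ _

theorem ncard_inPlaceKeys_le (n : ℕ) : (M.inPlaceKeys n).ncard ≤ M.stageTime n := by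
  simp only [inPlaceKeys, Set.ncard_prod, ncard_Iic, Set.ncard_univ, ncard_length_eq, stageTime,
    Nat.card_eq_fintype_card, Fintype.card_option, Fintype.card_bool]
  exact Nat.le_add_left _ _

variable {M} {A : Language σ} {x : List Bool}

/-- The catalytic tape is read-only here and the earlier queries are fixed, so the key may omit
both; the symbols already written of the current query do not influence the computation either.
Since the run halts, the stage must end. -/
theorem exists_leave_query {u : ℕ → RoundCfg σ M.Q} (hu : ∀ t, u (t + 1) = M.step A x (u t))
    (hwf : ∀ t, M.BaseWF x.length (u t)) {prev : List (List σ)} {cur : List σ}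
    (h0 : (u 0).phase = .query prev cur) (hhalt : ∃ t b, (u t).phase = .halted b) :
    ∃ s, 1 ≤ s ∧ s ≤ M.stageTime x.length ∧
      ((∃ w, (u s).phase = .between (prev ++ [w]) (M.freshInPlace x.length)) ∨
        ∃ w, (u s).phase = .answers ((prev ++ [w]).map (answer A)) (M.freshInPlace x.length)) := by
  let P : RoundCfg σ M.Q → Prop := fun c =>
    (∃ cur, c.phase = .query prev cur) ∧ c.cat = (u 0).cat ∧ M.BaseWF x.length c
  obtain ⟨T, b, hT⟩ := hhalt
  obtain ⟨s, hs, hnot, hbefore⟩ := exists_leave (f := M.step A x) (P := P)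
    (κ := fun c => (c.state, c.inPos, c.work, c.workPos, c.catPos)) (M.finite_queryKeys x.length)
    (fun a ha => ⟨trivial, ha.2.2.inPos, ha.2.2.work, ha.2.2.workPos, ha.2.2.catPos⟩) (by
      rintro a b ⟨⟨ca, ha⟩, hca, hwa⟩ ⟨⟨cb, hb⟩, hcb, hwb⟩ hab ⟨⟨ca', ha'⟩, hca', -⟩
      simp only [Prod.mk.injEq] at hab
      obtain ⟨e1, e2, e3, e4, e5⟩ := hab
      have hwb' := (wf_step (A := A) hwb (by simp only [hb, PhaseWF])).1
      have hcat : b.cat = a.cat := hcb.trans hca.symm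
      revert ha' hca' hwb'
      simp only [step, ha, hb, ← e1, ← e2, ← e3, ← e4, ← e5, hcat]
      split
      · intro _ hc hw
        exact ⟨⟨⟨_, rfl⟩, hc, hw⟩, rfl⟩
      · simp
      · simp) hu ⟨T, by rintro ⟨⟨_, h⟩, -⟩; rw [hT] at h; cases h⟩
  have hs0 : s ≠ 0 := by
    rintro rfl
    exact hnot ⟨⟨cur, h0⟩, rfl, hwf 0⟩
  obtain ⟨s, rfl⟩ := Nat.exists_eq_succ_of_ne_zero hs0
  refine ⟨s + 1, by omega, hs.trans (M.ncard_queryKeys_le _), ?_⟩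
  obtain ⟨⟨cur', h1⟩, h2, h3⟩ := hbefore s (by omega)
  have hnot' : ¬ P (M.step A x (u s)) := by rw [← hu]; exact hnot
  rw [hu]
  revert hnot'
  have hw' := (wf_step (A := A) h3 (by simp only [h1, PhaseWF])).1
  revert hw'
  simp only [step, h1]
  split
  · intro hw' hn
    exact absurd ⟨⟨_, rfl⟩, h2, hw'⟩ hn
  · exact fun _ _ => .inl ⟨_, rfl⟩
  · exact fun _ _ => .inr ⟨_, rfl⟩

theorem inPlaceStep_congr {a b : RoundCfg σ M.Q} (h1 : a.state = b.state) (h2 : a.inPos = b.inPos)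
    (h3 : a.work = b.work) (h4 : a.cat = b.cat) (ip : InPlaceCfg) :
    (M.inPlaceStep x b ip).2 = (M.inPlaceStep x a ip).2 ∧
    (M.inPlaceStep x b ip).1.state = (M.inPlaceStep x a ip).1.state ∧
    (M.inPlaceStep x b ip).1.inPos = (M.inPlaceStep x a ip).1.inPos ∧
    (M.inPlaceStep x b ip).1.work = (M.inPlaceStep x a ip).1.work ∧
    (M.inPlaceStep x b ip).1.cat = (M.inPlaceStep x a ip).1.cat := by
  simp only [inPlaceStep, ← h1, ← h2, ← h3, ← h4]
  split <;> simp [h2, h3, h4]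

/-- The second alternative allows for the truncation of positions beyond the right end marker; it
disappears for well-formed configurations. -/
theorem inPlaceStep_writePos {c d : RoundCfg σ M.Q} {ip ip' : InPlaceCfg}
    (h : M.inPlaceStep x c ip = (d, some ip')) :
    ip.writePos ≤ ip'.writePos ∨ ip'.writePos = (c.work ++ c.cat).length + 1 := by
  revert h
  unfold inPlaceStep
  dsimp only
  split
  · simp
  · intro h
    simp only [Prod.mk.injEq, Option.some.injEq] at h
    rw [← h.2]
    dsimp only [moveBounded]
    split_ifs <;> omega

theorem inPlaceStep_z {c d : RoundCfg σ M.Q} {ip : InPlaceCfg} {o : Option InPlaceCfg}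
    (h : M.inPlaceStep x c ip = (d, o)) (j : ℕ) (hj : j ≠ ip.writePos - 1) :
    (d.work ++ d.cat)[j]? = (c.work ++ c.cat)[j]? := by
  revert h
  unfold inPlaceStep
  dsimp only
  split
  · intro h
    simp only [Prod.mk.injEq] at h
    rw [← h.1]
  · intro h
    simp only [Prod.mk.injEq] at h
    rw [← h.1]
    dsimp only
    rw [List.take_append_drop]
    unfold writeAt
    split
    · rfl
    · split_ifs
      · rfl
      · rw [List.getElem?_set_ne (by omega)]

/-- As long as the write head rests, the tape differs from its state at the start of the stage in at
most one cell. One bit in the key therefore stands for the whole tape. The parameter `mk` treats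
in-place computations between queries and between answers alike; the stage ends when the write head
advances or the computation finishes. -/
theorem exists_leave_inPlace {u : ℕ → RoundCfg σ M.Q} (hu : ∀ t, u (t + 1) = M.step A x (u t))
    (hwf : ∀ t, M.BaseWF x.length (u t) ∧ M.PhaseWF x.length (u t).phase)
    {mk : InPlaceCfg → Phase σ}
    (hmk : ∀ ip, (mk ip).inPlace = ip)
    (hmkwf : ∀ ip, M.PhaseWF x.length (mk ip) → M.InPlaceWF x.length ip)
    (hsome : ∀ c ip d ip', c.phase = mk ip → M.inPlaceStep x c ip = (d, some ip') →
      M.step A x c = { d with phase := mk ip' })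
    (hnone : ∀ c ip d ip', c.phase = mk ip → M.inPlaceStep x c ip = (d, none) →
      (M.step A x c).phase ≠ mk ip')
    (hne : ∀ ip b, mk ip ≠ .halted b)
    {ip : InPlaceCfg} (h0 : (u 0).phase = mk ip) (hhalt : ∃ t b, (u t).phase = .halted b) :
    ∃ s, 1 ≤ s ∧ s ≤ M.stageTime x.length ∧
      ((∃ ip', (u s).phase = mk ip' ∧ ip.writePos < ip'.writePos) ∨
        ∃ t ip' d, (u t).phase = mk ip' ∧ M.inPlaceStep x (u t) ip' = (d, none) ∧
          u s = M.step A x (u t)) := by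
  let P : RoundCfg σ M.Q → Prop := fun c =>
    (∃ ip', c.phase = mk ip' ∧ ip'.writePos = ip.writePos) ∧
    (∀ j, j ≠ ip.writePos - 1 → (c.work ++ c.cat)[j]? = ((u 0).work ++ (u 0).cat)[j]?) ∧
    M.BaseWF x.length c ∧ M.PhaseWF x.length c.phase
  obtain ⟨T, b, hT⟩ := hhalt
  obtain ⟨s, hs, hnot, hbefore⟩ := exists_leave (f := M.step A x) (P := P)
    (κ := fun c => (c.state, c.inPos, c.phase.inPlace.aux, c.phase.inPlace.auxPos,
      c.phase.inPlace.readPos, (c.work ++ c.cat)[ip.writePos - 1]?))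
    (M.finite_inPlaceKeys x.length)
    (by
      rintro a ⟨⟨ip', h1, -⟩, -, hb, hp⟩
      rw [h1] at hp
      have := hmkwf _ hp
      rw [h1, hmk]
      exact ⟨trivial, hb.inPos, this.aux, this.auxPos, this.readPos, trivial⟩) (by
      rintro a b ⟨⟨ia, ha, hia⟩, hza, hwa, -⟩ ⟨⟨ib, hb, hib⟩, hzb, hwb, hpb⟩ hab hPa
      rw [ha, hb, hmk, hmk] at hab
      simp only [Prod.mk.injEq] at hab
      obtain ⟨e1, e2, e3, e4, e5, e6⟩ := hab
      have e : ia = ib := by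
        obtain ⟨_, _, _, _⟩ := ia
        obtain ⟨_, _, _, _⟩ := ib
        simp_all
      subst e
      -- Away from the write head both tapes equal the tape at time 0, and at the write head the
      -- keys agree.
      have hz : a.work ++ a.cat = b.work ++ b.cat := by
        apply List.ext_getElem?
        intro j
        by_cases hj : j = ip.writePos - 1
        · rw [hj, e6]
        · rw [hza j hj, hzb j hj]
      obtain ⟨ew, ec⟩ := List.append_inj hz (hwa.work.trans hwb.work.symm)
      obtain ⟨f1, f2, f3, f4, f5⟩ := inPlaceStep_congr (x := x) e1 e2 ew ec ia
      obtain ⟨⟨ia', ha', hia'⟩, hza', hwa', hpa'⟩ := hPa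
      have hwf' := wf_step (A := A) hwb hpb
      cases hsa : M.inPlaceStep x a ia with
      | mk d o =>
        cases hsb : M.inPlaceStep x b ia with
        | mk d' o' =>
          rw [hsa, hsb] at f1 f2 f3 f4 f5
          dsimp only at f1 f2 f3 f4 f5
          subst f1
          cases o' with
          | none => exact absurd ha' (hnone a ia d ia' ha hsa)
          | some ip' =>
            rw [hsome a ia d ip' ha hsa] at ha' hza' ⊢
            rw [hsome b ia d' ip' hb hsb] at hwf' ⊢
            refine ⟨⟨⟨ia', ha', hia'⟩, ?_, hwf'⟩, ?_⟩
            · dsimp only at hza' ⊢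
              rw [f4, f5]
              exact hza'
            · dsimp only
              rw [f2, f3, f4, f5]) hu
      ⟨T, by rintro ⟨⟨_, h, -⟩, -⟩; rw [hT] at h; exact hne _ _ h.symm⟩
  have hs0 : s ≠ 0 := by
    rintro rfl
    exact hnot ⟨⟨ip, h0, rfl⟩, fun _ _ => rfl, hwf 0⟩
  obtain ⟨s, rfl⟩ := Nat.exists_eq_succ_of_ne_zero hs0
  refine ⟨s + 1, by omega, hs.trans (M.ncard_inPlaceKeys_le _), ?_⟩
  obtain ⟨⟨ip', h1, h1'⟩, h2, h3, h4⟩ := hbefore s (by omega)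
  cases hstep : M.inPlaceStep x (u s) ip' with
  | mk d o =>
    cases o with
    | none => exact .inr ⟨s, ip', d, h1, hstep, hu s⟩
    | some ip'' =>
      left
      have e := hsome _ _ _ _ h1 hstep
      have hw := hwf (s + 1)
      have hu' := hu s
      rw [e] at hu'
      refine ⟨ip'', by rw [hu'], ?_⟩
      -- If the write head had not advanced, it would not have moved at all, and the new
      -- configuration would still satisfy `P`.
      by_contra hle
      apply hnot
      refine ⟨⟨ip'', by rw [hu'], ?_⟩, ?_, hw⟩
      · rw [h1] at h4
        have := hmkwf _ h4
        have hz := h3.length_z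
        have := inPlaceStep_writePos hstep
        have := this
        have := (hmkwf _ h4).le_read
        have := (hmkwf _ h4).readPos
        omega
      · intro j hj
        rw [← h2 j hj, ← inPlaceStep_z hstep j (by rwa [h1']), Nat.succ_eq_add_one, hu']

end RoundMachine
end Catalytic
end

/-! ### Polynomial duration of a round -/

noncomputable section

namespace Catalytic
namespace RoundMachine

variable {σ : Type} {M : RoundMachine σ} {A : Language σ} {x : List Bool}

/-- The computation on `x` and `τ` halts, and makes at most `m` queries in each round. -/
structure Tame (M : RoundMachine σ) (A : Language σ) (x : List Bool) (m : ℕ) (τ : List Bool) :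
    Prop where
  length : τ.length = M.catLen x.length
  halts : ∃ t b, (M.run A x τ t).phase = .halted b
  queries : ∀ t rest ip, (M.run A x τ t).phase = .answers rest ip → rest.length ≤ m

theorem Tame.halts_from {m : ℕ} {τ : List Bool} (h : Tame M A x m τ) (t : ℕ) :
    ∃ s b, (M.run A x τ (t + s)).phase = .halted b := by
  obtain ⟨T, b, hT⟩ := h.halts
  exact ⟨T, b, by rw [run_of_halted hT (by omega), hT]⟩

/-- Only rounds that are actually submitted have a bounded number of queries. But a round with too
many complete queries could never be submitted, hence never be left, and the run would not halt. -/
theorem Tame.query_count {m : ℕ} {τ : List Bool} (h : Tame M A x m τ) {t : ℕ}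
    {prev : List (List σ)}
    (hp : (∃ cur, (M.run A x τ t).phase = .query prev cur) ∨
      ∃ ip, (M.run A x τ t).phase = .between prev ip) : prev.length + 1 ≤ m := by
  by_contra hm
  have key : ∀ s, ∃ prev', prev.length ≤ prev'.length ∧
      ((∃ cur, (M.run A x τ (t + s)).phase = .query prev' cur) ∨
      ∃ ip, (M.run A x τ (t + s)).phase = .between prev' ip) := by
    intro s
    induction s with
    | zero => exact ⟨prev, le_rfl, hp⟩
    | succ s ih =>
      obtain ⟨prev', hle, ⟨cur, hc⟩ | ⟨ip, hc⟩⟩ := ih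
      · have hq := h.queries (t + s + 1)
        revert hq
        rw [← Nat.add_assoc, run_succ]
        simp only [step, hc]
        split
        · exact fun _ => ⟨prev', hle, .inl ⟨_, rfl⟩⟩
        · exact fun _ => ⟨prev' ++ [cur], by rw [List.length_append]; omega, .inr ⟨_, rfl⟩⟩
        · intro hq
          have := hq _ _ rfl
          simp only [List.length_map, List.length_append, List.length_singleton] at this
          omega
      · rw [← Nat.add_assoc, run_succ]
        simp only [step, hc]
        split
        · exact ⟨prev', hle, .inr ⟨_, rfl⟩⟩
        · exact ⟨prev', hle, .inl ⟨_, rfl⟩⟩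
  obtain ⟨s, b, hs⟩ := h.halts_from t
  obtain ⟨_, _, ⟨_, h'⟩ | ⟨_, h'⟩⟩ := key s <;> rw [hs] at h' <;> cases h'

/-- An upper bound for the stages of a round of at most `m` queries. -/
def stageCount (M : RoundMachine σ) (n m : ℕ) : ℕ := (3 * m + 1) * (M.zLen n + 2)

/-- The factor `zLen + 2` exceeds every position of the write head, so that position acts as a
lowest digit; the leading digit is at most 3 * m, at most 2 * m of it from the query phase and m
from the answers. -/
theorem Tame.stage_le {m : ℕ} {τ : List Bool} (h : Tame M A x m τ) (t : ℕ) :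
    (M.run A x τ t).phase.stage (M.zLen x.length + 2) m ≤ M.stageCount x.length m := by
  have hwf := (wf_run (A := A) h.length t).2
  have hcount := fun prev => h.query_count (t := t) (prev := prev)
  revert hwf hcount
  unfold stageCount
  cases (M.run A x τ t).phase with
  | main => simp [Phase.stage]
  | halted => simp [Phase.stage]
  | query prev cur =>
    intro _ hq
    have := hq prev (.inl ⟨_, rfl⟩)
    exact Nat.mul_le_mul_right _ (by omega)
  | between prev ip =>
    intro hw hq
    have := hq prev (.inr ⟨_, rfl⟩)
    have hw : M.InPlaceWF x.length ip := hw
    have h1 := hw.le_read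
    have h2 := hw.readPos
    calc 2 * prev.length * (M.zLen x.length + 2) + ip.writePos
        ≤ 2 * prev.length * (M.zLen x.length + 2) + (M.zLen x.length + 2) := by omega
      _ = (2 * prev.length + 1) * (M.zLen x.length + 2) := by ring
      _ ≤ _ := Nat.mul_le_mul_right _ (by omega)
  | answers rest ip =>
    intro hw _
    have hw : M.InPlaceWF x.length ip := hw
    have h1 := hw.le_read
    have h2 := hw.readPos
    calc (2 * m + (m - rest.length)) * (M.zLen x.length + 2) + ip.writePos
        ≤ (2 * m + (m - rest.length)) * (M.zLen x.length + 2) + (M.zLen x.length + 2) := by omega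
      _ = (2 * m + (m - rest.length) + 1) * (M.zLen x.length + 2) := by ring
      _ ≤ _ := Nat.mul_le_mul_right _ (by omega)

/-- Every stage ends within `stageTime` steps, and what follows has a larger measure: the write head
has advanced, or the next query, in-place computation or answer has begun. The only other way out is
the return to ordinary computation after the last answer. -/
theorem Tame.progress {m : ℕ} {τ : List Bool} (h : Tame M A x m τ) {t : ℕ}
    (hb : (M.run A x τ t).phase.Busy) :
    ∃ s, s ≤ M.stageTime x.length ∧ ((M.run A x τ (t + s)).phase = .main ∨
      ((M.run A x τ (t + s)).phase.Busy ∧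
        (M.run A x τ t).phase.stage (M.zLen x.length + 2) m <
          (M.run A x τ (t + s)).phase.stage (M.zLen x.length + 2) m)) := by
  have hu : ∀ s, M.run A x τ (t + (s + 1)) = M.step A x (M.run A x τ (t + s)) :=
    fun s => run_succ _ _
  have hwf := fun s => wf_run (A := A) h.length (t + s)
  have hlt : ∀ ip, M.InPlaceWF x.length ip → ip.writePos < M.zLen x.length + 2 := by
    intro ip hw
    have h1 := hw.le_read
    have h2 := hw.readPos
    omega
  cases hp : (M.run A x τ t).phase with
  | main => rw [hp] at hb; exact hb.elim
  | halted => rw [hp] at hb; exact hb.elim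
  | query prev cur =>
    have hm := h.query_count (.inl ⟨_, hp⟩)
    obtain ⟨s, -, hs, ⟨w, hw⟩ | ⟨w, hw⟩⟩ := exists_leave_query (u := fun s => M.run A x τ (t + s)) hu
      (fun s => (hwf s).1) hp (h.halts_from t)
    · refine ⟨s, hs, .inr ?_⟩
      rw [hw]
      refine ⟨trivial, ?_⟩
      simp only [Phase.stage, List.length_append, List.length_singleton]
      have : (2 * prev.length + 1) * (M.zLen x.length + 2) ≤
        2 * (prev.length + 1) * (M.zLen x.length + 2) := Nat.mul_le_mul_right _ (by omega)
      simp only [freshInPlace]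
      omega
    · refine ⟨s, hs, .inr ?_⟩
      rw [hw]
      refine ⟨trivial, ?_⟩
      simp only [Phase.stage]
      have : (2 * prev.length + 1) * (M.zLen x.length + 2) ≤
        (2 * m + (m - (List.map (answer A) (prev ++ [w])).length)) * (M.zLen x.length + 2) :=
        Nat.mul_le_mul_right _ (by omega)
      simp only [freshInPlace]
      omega
  | between prev ip =>
    obtain ⟨s, -, hs, ⟨ip', h1, h2⟩ | ⟨s', ip', d, h1, h2, h3⟩⟩ :=
      exists_leave_inPlace (u := fun s => M.run A x τ (t + s)) hu hwf (mk := .between prev)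
      (fun _ => rfl) (fun _ h => h)
      (fun c ip d ip' hc hd => by simp only [step, hc, hd])
      (fun c ip d ip' hc hd => by simp [step, hc, hd]) (by simp) hp (h.halts_from t)
    · refine ⟨s, hs, .inr ?_⟩
      rw [h1]
      exact ⟨trivial, Nat.add_lt_add_left h2 _⟩
    · refine ⟨s, hs, .inr ?_⟩
      rw [h3]
      simp only [step, h1, h2]
      refine ⟨trivial, ?_⟩
      have hw := (hwf 0).2
      rw [Nat.add_zero, hp] at hw
      have := hlt ip hw
      simp only [Phase.stage]
      rw [Nat.add_mul (2 * prev.length), one_mul]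
      omega
  | answers rest ip =>
    obtain ⟨s, -, hs, ⟨ip', h1, h2⟩ | ⟨s', ip', d, h1, h2, h3⟩⟩ :=
      exists_leave_inPlace (u := fun s => M.run A x τ (t + s)) hu hwf (mk := .answers rest)
      (fun _ => rfl) (fun _ h => h)
      (fun c ip d ip' hc hd => by simp only [step, hc, hd])
      (fun c ip d ip' hc hd => by
        simp only [step, hc, hd]
        cases rest <;> simp) (by simp) hp (h.halts_from t)
    · refine ⟨s, hs, .inr ?_⟩
      rw [h1]
      exact ⟨trivial, Nat.add_lt_add_left h2 _⟩
    · refine ⟨s, hs, ?_⟩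
      rw [h3]
      cases rest with
      | nil =>
        left
        simp only [step, h1, h2]
      | cons b rest =>
        right
        simp only [step, h1, h2]
        refine ⟨trivial, ?_⟩
        have hw := (hwf 0).2
        rw [Nat.add_zero, hp] at hw
        have := hlt ip hw
        have hm := h.queries _ _ _ hp
        simp only [List.length_cons] at hm
        simp only [Phase.stage, List.length_cons]
        rw [show 2 * m + (m - rest.length) = (2 * m + (m - (rest.length + 1))) + 1 by omega,
          Nat.succ_mul (2 * m + (m - (rest.length + 1)))]
        omega

theorem Tame.exists_main {m : ℕ} {τ : List Bool} (h : Tame M A x m τ) {t : ℕ}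
    (hb : (M.run A x τ t).phase.Busy) :
    ∃ s, s ≤ (M.stageCount x.length m + 1) * M.stageTime x.length ∧
      (M.run A x τ (t + s)).phase = .main := by
  -- Induction on the distance of the measure from its upper bound.
  generalize hr : M.stageCount x.length m -
    (M.run A x τ t).phase.stage (M.zLen x.length + 2) m = r
  have hr' : r ≤ M.stageCount x.length m := by omega
  suffices hs : ∃ s, s ≤ (r + 1) * M.stageTime x.length ∧
      (M.run A x τ (t + s)).phase = .main by
    obtain ⟨s, h1, h2⟩ := hs
    exact ⟨s, h1.trans (Nat.mul_le_mul_right _ (by omega)), h2⟩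
  clear hr'
  induction r using Nat.strong_induction_on generalizing t with
  | _ r ih =>
    obtain ⟨s, hs, h1 | ⟨h1, h2⟩⟩ := h.progress hb
    · exact ⟨s, hs.trans (Nat.le_mul_of_pos_left _ (by omega)), h1⟩
    · have h3 := h.stage_le (t + s)
      obtain ⟨s', hs', h4⟩ := ih _ (by omega) h1 rfl
      refine ⟨s + s', ?_, by rwa [← Nat.add_assoc]⟩
      calc s + s' ≤ M.stageTime x.length + r * M.stageTime x.length :=
            Nat.add_le_add hs (hs'.trans (Nat.mul_le_mul_right _ (by omega)))
        _ = (r + 1) * M.stageTime x.length := by ring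

/-! ### Averaging over the initial contents of the catalytic tape -/

/-- The number of steps before the machine halts. -/
def haltTime (M : RoundMachine σ) (A : Language σ) (x τ : List Bool) : ℕ :=
  sInf {t | ∃ b, (M.run A x τ t).phase = .halted b}

theorem Tame.halted_haltTime {m : ℕ} {τ : List Bool} (h : Tame M A x m τ) :
    ∃ b, (M.run A x τ (M.haltTime A x τ)).phase = .halted b :=
  Nat.sInf_mem (s := {t | ∃ b, (M.run A x τ t).phase = .halted b}) h.halts

theorem not_halted_of_lt {τ : List Bool} {t : ℕ} (h : t < M.haltTime A x τ) (b : Bool) :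
    (M.run A x τ t).phase ≠ .halted b :=
  fun hb => Nat.notMem_of_lt_sInf h ⟨b, hb⟩

/-- The times before halting at which the computation is outside of the rounds of queries. -/
def mainTimes (M : RoundMachine σ) (A : Language σ) (x τ : List Bool) : Finset ℕ :=
  open Classical in
  (Finset.range (M.haltTime A x τ)).filter fun t => (M.run A x τ t).phase = .main

/-- A bound on the number of steps between two steps outside of the rounds. -/
def roundTime (M : RoundMachine σ) (n m : ℕ) : ℕ := (M.stageCount n m + 1) * M.stageTime n + 1

/-- Each time before halting is charged to a time outside the rounds that follows within `roundTime`
steps, so no such time is charged more than `roundTime` times. -/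
theorem Tame.haltTime_le {m : ℕ} {τ : List Bool} (h : Tame M A x m τ) :
    M.haltTime A x τ ≤ M.roundTime x.length m * (M.mainTimes A x τ).card := by
  have hex : ∀ t, t < M.haltTime A x τ → ∃ s ∈ M.mainTimes A x τ,
      t ≤ s ∧ s < t + M.roundTime x.length m := by
    intro t ht
    unfold roundTime
    have hb := fun b => not_halted_of_lt (b := b) ht
    have : (M.run A x τ t).phase = .main ∨ (M.run A x τ t).phase.Busy := by
      revert hb
      cases (M.run A x τ t).phase <;> simp [Phase.Busy]
    rcases this with h1 | h1
    · exact ⟨t, by simp [mainTimes, h1, ht], le_rfl, by omega⟩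
    · obtain ⟨s, hs, h2⟩ := h.exists_main h1
      refine ⟨t + s, ?_, by omega, by omega⟩
      simp only [mainTimes, Finset.mem_filter, Finset.mem_range, h2, and_true]
      -- Beyond the halting time the phase would be `halted`, not `main`.
      by_contra hle
      obtain ⟨b, hb⟩ := h.halted_haltTime
      rw [run_of_halted hb (by omega), hb] at h2
      cases h2
  choose! g hg1 hg2 hg3 using hex
  rw [← Finset.card_range (M.haltTime A x τ)]
  apply Finset.card_le_mul_card_image_of_maps_to (f := g)
  · intro t ht
    exact hg1 t (Finset.mem_range.1 ht)
  · intro s _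
    calc _ ≤ (Finset.Icc (s + 1 - M.roundTime x.length m) s).card := by
          apply Finset.card_le_card
          intro t ht
          simp only [Finset.mem_filter, Finset.mem_range] at ht
          have h1 := hg2 t ht.1
          have h2 := hg3 t ht.1
          rw [Finset.mem_Icc]
          omega
      _ ≤ _ := by rw [Nat.card_Icc]; omega

/-- The data of a configuration outside of the rounds of queries. -/
def mainKeys (M : RoundMachine σ) (n k : ℕ) :
    Set (M.Q × ℕ × List Bool × ℕ × List Bool × ℕ × ℕ) :=
  Set.univ ×ˢ Set.Iic (n + 1) ×ˢ {l | l.length = M.workLen n} ×ˢ Set.Iic (M.workLen n + 1) ×ˢ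
    {l | l.length = M.catLen n} ×ˢ Set.Iic (M.catLen n + 1) ×ˢ Set.Iic k

theorem finite_mainKeys (M : RoundMachine σ) (n k : ℕ) : (M.mainKeys n k).Finite :=
  have := M.finiteQ
  Set.finite_univ.prod ((Set.finite_Iic _).prod ((List.finite_length_eq _ _).prod
    ((Set.finite_Iic _).prod ((List.finite_length_eq _ _).prod
      ((Set.finite_Iic _).prod (Set.finite_Iic _))))))

/-- A bound on the average number of steps outside of the rounds. -/
def mainTime (M : RoundMachine σ) (n k : ℕ) : ℕ :=
  Nat.card M.Q * ((n + 2) * (2 ^ M.workLen n * ((M.workLen n + 2) * ((M.catLen n + 2) * (k + 1)))))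

/-- The contents of the catalytic tape contribute exactly the number of initial contents; that
factor cancels when the average is taken. -/
theorem ncard_mainKeys (M : RoundMachine σ) (n k : ℕ) :
    (M.mainKeys n k).ncard = 2 ^ M.catLen n * M.mainTime n k := by
  simp only [mainKeys, Set.ncard_prod, ncard_Iic, Set.ncard_univ, ncard_length_eq, mainTime]
  ring

theorem run_add (τ : List Bool) (t s : ℕ) :
    M.run A x τ (t + s) = (M.step A x)^[s] (M.run A x τ t) := by
  rw [run, run, Nat.add_comm, Function.iterate_add_apply]

/-- A machine that restores its catalytic tape reaches every configuration before halting at most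
once, over all initial contents of the catalytic tape. -/
theorem eq_of_run_eq {τ τ' : List Bool}
    (h : ∃ t b, (M.run A x τ t).phase = .halted b ∧ (M.run A x τ t).cat = τ)
    (h' : ∃ t b, (M.run A x τ' t).phase = .halted b ∧ (M.run A x τ' t).cat = τ') {t t' : ℕ}
    (ht : t < M.haltTime A x τ) (ht' : t' < M.haltTime A x τ')
    (heq : M.run A x τ t = M.run A x τ' t') : τ = τ' ∧ t = t' := by
  have hadd : ∀ s, M.run A x τ (t + s) = M.run A x τ' (t' + s) := fun s => by
    rw [run_add, run_add, heq]
  obtain ⟨T, b, hT, hcat⟩ := h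
  obtain ⟨T', b', hT', hcat'⟩ := h'
  -- After T + T' further steps both runs have halted, in the same configuration, whose tape is the
  -- initial one of either run.
  have e : τ = τ' := by
    rw [← hcat, ← hcat', ← run_of_halted hT (s := t + (T + T')) (by omega), hadd,
      run_of_halted hT' (by omega)]
  refine ⟨e, ?_⟩
  subst e
  have hmem : ∃ b, (M.run A x τ (M.haltTime A x τ)).phase = .halted b :=
    Nat.sInf_mem (s := {t | ∃ b, (M.run A x τ t).phase = .halted b}) ⟨T, b, hT⟩
  obtain ⟨c, hc⟩ := hmem
  -- If the times differed, shifting the halting time by their difference would yield an earlier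
  -- halted configuration.
  rcases lt_trichotomy t t' with hlt | h | hlt
  · have := hadd (M.haltTime A x τ - t')
    rw [Nat.add_sub_cancel' ht'.le] at this
    exact absurd (this ▸ hc) (not_halted_of_lt (by omega) c)
  · exact h
  · have := hadd (M.haltTime A x τ - t)
    rw [Nat.add_sub_cancel' ht.le] at this
    exact absurd (this.symm ▸ hc) (not_halted_of_lt (by omega) c)

/-- Pairs of an initial contents and a time outside the rounds inject into the keys: with the phase
known to be `main`, a key is the whole configuration. The counter `rounds` belongs to it and costs a
factor k + 1. -/
theorem sum_mainTimes_le {k : ℕ}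
    (hrestore : ∀ τ : Fin (M.catLen x.length) → Bool, ∃ t b,
      (M.run A x (List.ofFn τ) t).phase = .halted b ∧ (M.run A x (List.ofFn τ) t).cat = List.ofFn τ)
    (hrounds : ∀ (τ : Fin (M.catLen x.length) → Bool) t, (M.run A x (List.ofFn τ) t).rounds ≤ k) :
    ∑ τ : Fin (M.catLen x.length) → Bool, (M.mainTimes A x (List.ofFn τ)).card ≤
      2 ^ M.catLen x.length * M.mainTime x.length k := by
  rw [← Finset.card_sigma, ← ncard_mainKeys, Set.ncard_eq_toFinset_card _ (M.finite_mainKeys _ _)]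
  have hmain : ∀ p ∈ (Finset.univ : Finset (Fin (M.catLen x.length) → Bool)).sigma
      (fun τ => M.mainTimes A x (List.ofFn τ)), p.2 < M.haltTime A x (List.ofFn p.1) ∧
        (M.run A x (List.ofFn p.1) p.2).phase = .main := by
    intro p hp
    simpa [mainTimes] using hp
  apply Finset.card_le_card_of_injOn (fun p =>
    let c := M.run A x (List.ofFn p.1) p.2
    (c.state, c.inPos, c.work, c.workPos, c.cat, c.catPos, c.rounds))
  · intro p hp
    have hw := (wf_run (M := M) (A := A) (x := x) (τ := List.ofFn p.1) (by simp) p.2).1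
    simp only [Set.Finite.coe_toFinset]
    exact ⟨trivial, hw.inPos, hw.work, hw.workPos, hw.cat, hw.catPos, hrounds _ _⟩
  · rintro p hp q hq hpq
    obtain ⟨h1, h2⟩ := hmain p hp
    obtain ⟨h3, h4⟩ := hmain q hq
    simp only [Prod.mk.injEq] at hpq
    have heq : M.run A x (List.ofFn p.1) p.2 = M.run A x (List.ofFn q.1) q.2 := by
      obtain ⟨e1, e2, e3, e4, e5, e6, e7⟩ := hpq
      generalize M.run A x (List.ofFn p.1) p.2 = c at *
      generalize M.run A x (List.ofFn q.1) q.2 = d at *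
      cases c; cases d
      simp_all
    obtain ⟨e1, e2⟩ := eq_of_run_eq (hrestore _) (hrestore _) h1 h3 heq
    exact Sigma.ext (List.ofFn_injective e1) (heq_of_eq e2)

/-- Most initial contents of the catalytic tape lead to a short computation. -/
theorem card_slow_le {k m : ℕ}
    (hrestore : ∀ τ : Fin (M.catLen x.length) → Bool, ∃ t b,
      (M.run A x (List.ofFn τ) t).phase = .halted b ∧ (M.run A x (List.ofFn τ) t).cat = List.ofFn τ)
    (hrounds : ∀ (τ : Fin (M.catLen x.length) → Bool) t, (M.run A x (List.ofFn τ) t).rounds ≤ k)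
    (hqueries : ∀ (τ : Fin (M.catLen x.length) → Bool) t rest ip,
      (M.run A x (List.ofFn τ) t).phase = .answers rest ip → rest.length ≤ m) {B : ℕ}
    (hB : 3 * (M.roundTime x.length m * M.mainTime x.length k) ≤ B) :
    3 * Nat.card {τ : Fin (M.catLen x.length) → Bool // B < M.haltTime A x (List.ofFn τ)} ≤
      2 ^ M.catLen x.length := by
  classical
  set S := Finset.univ.filter
    fun τ : Fin (M.catLen x.length) → Bool => B < M.haltTime A x (List.ofFn τ)
  have hS : Nat.card {τ : Fin (M.catLen x.length) → Bool // B < M.haltTime A x (List.ofFn τ)} =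
      S.card := by
    rw [Nat.card_eq_fintype_card, Fintype.card_subtype]
  rw [hS]
  -- Markov's inequality: every slow contents contributes at least B + 1 to the total running time.
  have h1 : S.card * (B + 1) ≤ ∑ τ ∈ S, M.haltTime A x (List.ofFn τ) := by
    rw [← smul_eq_mul]
    apply Finset.card_nsmul_le_sum
    intro τ hτ
    exact (Finset.mem_filter.1 hτ).2
  have h2 : ∑ τ ∈ S, M.haltTime A x (List.ofFn τ) ≤
      M.roundTime x.length m * (2 ^ M.catLen x.length * M.mainTime x.length k) := by
    calc _ ≤ ∑ τ : Fin (M.catLen x.length) → Bool, M.haltTime A x (List.ofFn τ) :=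
          Finset.sum_le_univ_sum_of_nonneg (fun _ => Nat.zero_le _)
      _ ≤ ∑ τ : Fin (M.catLen x.length) → Bool,
          M.roundTime x.length m * (M.mainTimes A x (List.ofFn τ)).card := by
        apply Finset.sum_le_sum
        intro τ _
        obtain ⟨t, b, h, -⟩ := hrestore τ
        exact Tame.haltTime_le ⟨by simp, ⟨t, b, h⟩, hqueries τ⟩
      _ ≤ _ := by
        rw [← Finset.mul_sum]
        exact Nat.mul_le_mul_left _ (sum_mainTimes_le hrestore hrounds)
  by_contra! hlt
  have h3 : 3 * (S.card * (B + 1)) ≤ 2 ^ M.catLen x.length * B := by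
    calc _ ≤ 3 * (M.roundTime x.length m * (2 ^ M.catLen x.length * M.mainTime x.length k)) :=
          Nat.mul_le_mul_left _ (h1.trans h2)
      _ = 2 ^ M.catLen x.length * (3 * (M.roundTime x.length m * M.mainTime x.length k)) := by ring
      _ ≤ _ := Nat.mul_le_mul_left _ hB
  generalize 2 ^ M.catLen x.length = N at *
  have h4 := Nat.mul_le_mul_right (B + 1) (Nat.succ_le_of_lt hlt)
  rw [Nat.succ_mul, Nat.mul_succ] at h4
  rw [← Nat.mul_assoc] at h3
  omega

end RoundMachine
end Catalytic
end

/-! ### The clock and the design of the simulating machine -/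

noncomputable section

namespace Catalytic

/-! ### The reflected counter -/

/-- Borrowing in base n, where `r j` is the distance digit j still has to go. Digits below k have
reached their ends and turn round, so their distances jump from 0 to n - 1, while digit k takes one
step. The geometric sum makes the total drop by exactly 1. -/
theorem counter_tick {n e k : ℕ} (hn : 0 < n) {r r' : ℕ → ℕ} (hk : k < e)
    (hlow : ∀ j < k, r j = 0 ∧ r' j = n - 1) (heq : r' k + 1 = r k)
    (hhigh : ∀ j, k < j → r' j = r j) :
    ∑ j ∈ Finset.range e, r' j * n ^ j + 1 = ∑ j ∈ Finset.range e, r j * n ^ j := by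
  have geom : ∀ k, ∑ j ∈ Finset.range k, (n - 1) * n ^ j + 1 = n ^ k := by
    intro k
    induction k with
    | zero => simp
    | succ k ih =>
      rw [Finset.sum_range_succ, pow_succ]
      obtain ⟨n, rfl⟩ := Nat.exists_eq_add_of_lt hn
      simp only [Nat.zero_add, Nat.add_sub_cancel] at ih ⊢
      linarith
  obtain ⟨i, rfl⟩ := Nat.exists_eq_add_of_lt hk
  clear hk
  induction i with
  | zero =>
    rw [Nat.add_zero, Finset.sum_range_succ, Finset.sum_range_succ,
      Finset.sum_congr rfl (g := fun j => (n - 1) * n ^ j)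
        (fun j hj => by rw [(hlow j (Finset.mem_range.1 hj)).2]),
      Finset.sum_eq_zero (s := Finset.range k) (f := fun j => r j * n ^ j)
        (fun j hj => by rw [(hlow j (Finset.mem_range.1 hj)).1, zero_mul]), ← heq,
      Nat.succ_mul]
    have := geom k
    omega
  | succ i ih =>
    rw [show k + (i + 1) + 1 = (k + i + 1) + 1 by omega, Finset.sum_range_succ,
      Finset.sum_range_succ _ (k + i + 1), ← ih, hhigh _ (by omega)]
    omega

/-- This is a single tick applied to the number n ^ e, written as the digit 1 at position e. -/
theorem counter_init (n e : ℕ) (hn : 0 < n) :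
    ∑ j ∈ Finset.range e, (n - 1) * n ^ j + 1 = n ^ e := by
  have := counter_tick (n := n) (e := e + 1) (k := e) hn (r := fun j => if j = e then 1 else 0)
    (r' := fun j => if j < e then n - 1 else 0) (by omega)
    (fun j hj => by simp [hj, hj.ne]) (by simp)
    (fun j hj => by simp [show ¬ j < e by omega, show j ≠ e by omega])
  rw [Finset.sum_range_succ, Finset.sum_range_succ] at this
  simp only [lt_irrefl, if_false, zero_mul, add_zero, if_true, one_mul] at this
  rw [Finset.sum_congr rfl (g := fun j => (n - 1) * n ^ j)
        (fun j hj => by rw [if_pos (Finset.mem_range.1 hj)])] at this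
  rw [this, Finset.sum_eq_zero, zero_add]
  intro j hj
  rw [if_neg (Finset.mem_range.1 hj).ne, zero_mul]

namespace RoundMachine

variable {σ : Type} (M : RoundMachine σ)

/-! ### The simulating machine -/

/-- The heads of the simulating machine. -/
inductive SimHead (d : ℕ)
  | work
  | cat
  | read
  | write
  | aux
  | ansRead
  | ansWrite
  | fst
  | snd
  /-- The digits of a counter. -/
  | digit (i : Fin d)

/-- The memory cells of the simulating machine. -/
structure SimCell where
  /-- Marks the first cell. -/
  zero : Bool
  /-- Marks the last position of the digits of the counter. -/
  last : Bool
  /-- The cells of the work tape (`false`) and of the catalytic tape (`true`). -/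
  data : Option (Bool × Bool)
  /-- The cells of the auxiliary work tape. -/
  aux : Option Bool
  /-- The answers of the oracle. -/
  ans : Option Bool

/-- The kind of a phase. -/
inductive Tag
  | main
  | query
  | between
  | answers

/-- The states of the simulating machine. -/
inductive SimState (d : ℕ)
  | boot
  | first
  | second (b : Bool)
  | scanning
  /-- Moves the value of one of the heads `fst` (for `true`) and `snd` to the other one, halved. -/
  | halve (side parity : Bool)
  /-- Appends a block of cells to the work tape and to the auxiliary tape. -/
  | block (side : Bool) (i : Fin (M.workConst + M.auxConst + 1))
  /-- Appends random cells to the catalytic tape. -/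
  | fill (dir : Fin d → Bool)
  | sim (dir : Fin d → Bool) (q : M.Q) (tag : Tag)

/-- Moves of the heads of the simulating machine. -/
structure SimMoves (d : ℕ) where
  work : HeadMove := .stay
  cat : HeadMove := .stay
  read : HeadMove := .stay
  write : HeadMove := .stay
  aux : HeadMove := .stay
  ansRead : HeadMove := .stay
  ansWrite : HeadMove := .stay
  fst : HeadMove := .stay
  snd : HeadMove := .stay
  digit : Fin d → HeadMove := fun _ => .stay

/-- The moves as a function. -/
def SimMoves.fn {d : ℕ} (m : SimMoves d) : SimHead d → HeadMove
  | .work => m.work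
  | .cat => m.cat
  | .read => m.read
  | .write => m.write
  | .aux => m.aux
  | .ansRead => m.ansRead
  | .ansWrite => m.ansWrite
  | .fst => m.fst
  | .snd => m.snd
  | .digit i => m.digit i

theorem finite_simHead (d : ℕ) : Finite (SimHead d) := by
  refine Finite.of_injective (β := Fin 9 ⊕ Fin d)
    (fun | .work => .inl 0 | .cat => .inl 1 | .read => .inl 2 | .write => .inl 3 | .aux => .inl 4
         | .ansRead => .inl 5 | .ansWrite => .inl 6 | .fst => .inl 7 | .snd => .inl 8
         | .digit i => .inr i) ?_
  intro a b h
  cases a <;> cases b <;> simp_all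

theorem finite_simCell : Finite SimCell :=
  Finite.of_injective (fun c => (c.zero, c.last, c.data, c.aux, c.ans)) (by
    rintro ⟨a, b, c, d, e⟩ ⟨a', b', c', d', e'⟩ h
    simp_all)

theorem finite_tag : Finite Tag := by
  refine Finite.of_injective (β := Fin 4)
    (fun | .main => 0 | .query => 1 | .between => 2 | .answers => 3) ?_
  intro a b h
  cases a <;> cases b <;> simp_all

theorem finite_simState (d : ℕ) : Finite (M.SimState d) := by
  have := M.finiteQ
  have := finite_tag
  refine Finite.of_injective (β := Fin 3 ⊕ Bool ⊕ (Bool × Bool) ⊕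
      (Bool × Fin (M.workConst + M.auxConst + 1)) ⊕ (Fin d → Bool) ⊕
      ((Fin d → Bool) × M.Q × Tag))
    (fun | .boot => .inl 0 | .first => .inl 1 | .scanning => .inl 2
         | .second b => .inr (.inl b)
         | .halve a b => .inr (.inr (.inl (a, b)))
         | .block a i => .inr (.inr (.inr (.inl (a, i))))
         | .fill dir => .inr (.inr (.inr (.inr (.inl dir))))
         | .sim dir q t => .inr (.inr (.inr (.inr (.inr (dir, q, t)))))) ?_
  intro a b h
  cases a <;> cases b <;> simp_all

/-- The symbol of the work tape in a cell. -/
def workScan (c : SimCell) : Scan Bool :=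
  if c.zero then .leftEnd else match c.data with
    | some (false, b) => .sym b
    | _ => .rightEnd

/-- The symbol of the catalytic tape in a cell. -/
def catScan (c : SimCell) : Scan Bool :=
  match c.data with
  | some (true, b) => .sym b
  | some (false, _) => .leftEnd
  | none => if c.zero then .leftEnd else .rightEnd

/-- The symbol of the tape of an in-place computation in a cell. -/
def zScan (c : SimCell) : Scan Bool :=
  if c.zero then .leftEnd else match c.data with
    | some (_, b) => .sym b
    | none => .rightEnd

/-- The symbol of the auxiliary tape in a cell. -/
def auxScan (c : SimCell) : Scan Bool :=
  if c.zero then .leftEnd else match c.aux with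
    | some b => .sym b
    | none => .rightEnd

/-- The move of a head that simulates a head on a bounded tape. -/
def boundedMove (s : Scan Bool) (d : Dir) : HeadMove :=
  match d with
  | .left => match s with | .leftEnd => .stay | _ => .left
  | .stay => .stay
  | .right => match s with | .rightEnd => .stay | _ => .right

/-- The move of the read head of an in-place computation. Here `same` and `next` tell whether it is
on the cell of the write head or on the following cell, and `adv` whether the write head moves. -/
def readMove (same next adv : Bool) (s : Scan Bool) (d : Dir) : HeadMove :=
  if same then
    if adv then .right else match d with
      | .left => .stay
      | d => boundedMove s d
  else match d with
    | .left => if next && adv then .stay else .left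
    | d => boundedMove s d

/-- Whether a cell is not the right end marker of the tape of an in-place computation. -/
def notRightEnd (c : SimCell) : Bool :=
  match zScan c with
  | .rightEnd => false
  | _ => true

/-- Whether a digit of the counter is at the end of its range. -/
def stuck {d : ℕ} (dir : Fin d → Bool) (g : SimHead d → View SimCell (SimHead d)) (i : Fin d) :
    Bool :=
  if dir i then (g (.digit i)).cell.last else (g (.digit i)).cell.zero

/-- The move of a digit when the counter ticks. -/
def tickMove {d : ℕ} (dir stk : Fin d → Bool) (i : Fin d) : HeadMove :=
  if (∀ j < i, stk j = true) ∧ stk i = false then if dir i then .right else .left else .stay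

/-- The directions of the digits after a tick of the counter. -/
def tickDir {d : ℕ} (dir stk : Fin d → Bool) (i : Fin d) : Bool :=
  if ∀ j ≤ i, stk j = true then !dir i else dir i

variable {M} in
/-- The instructions of the simulating machine in an in-place computation; `done` is the
instruction at its end. -/
def inPlaceAct {d : ℕ} (dir : Fin d → Bool) (dmv : Fin d → HeadMove) (q : M.Q) (tag : Tag)
    (sc : Scan Bool) (g : SimHead d → View SimCell (SimHead d))
    (done : M.Q → HeadAct σ (M.SimState d) SimCell (SimHead d)) :
    HeadAct σ (M.SimState d) SimCell (SimHead d) :=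
  match M.inPlace q sc (auxScan (g .aux).cell) (zScan (g .read).cell) with
  | .finish q => done q
  | .step q im auxWrite auxMove zWrite zAdvance zRead =>
    let adv := zAdvance && notRightEnd (g .write).cell
    .step (.sim dir q tag) im none
      (fun S c => { c with
        data := c.data.map fun p => (p.1, if S .write then zWrite.getD p.2 else p.2)
        aux := c.aux.map fun b => if S .aux then auxWrite.getD b else b })
      (SimMoves.fn
        { aux := boundedMove (auxScan (g .aux).cell) auxMove
          write := if adv then .right else .stay
          read := readMove ((g .read).here .write) ((g .read).before .write) adv
            (zScan (g .read).cell) zRead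
          digit := dmv })

variable {M} in
/-- The instructions of the simulating machine during the simulation. -/
def simAct {d : ℕ} (dir : Fin d → Bool) (dmv : Fin d → HeadMove) (q : M.Q) (tag : Tag) (ans : Bool)
    (sc : Scan Bool) (g : SimHead d → View SimCell (SimHead d)) :
    HeadAct σ (M.SimState d) SimCell (SimHead d) :=
  match tag with
  | .main =>
    match M.main q sc (workScan (g .work).cell) (catScan (g .cat).cell) with
    | .halt b => .halt (if b then .accept else .reject)
    | .enterQuery q =>
      .step (.sim dir q .query) .stay none (fun _ c => { c with ans := none })
        (SimMoves.fn { ansRead := .zero, ansWrite := .zero, digit := dmv })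
    | .step q im workWrite workMove catWrite catMove =>
      .step (.sim dir q .main) im none
        (fun S c => { c with
          data := c.data.map fun p => (p.1,
            if p.1 then if S .cat then catWrite.getD p.2 else p.2
            else if S .work then workWrite.getD p.2 else p.2) })
        (SimMoves.fn
          { work := boundedMove (workScan (g .work).cell) workMove
            cat := boundedMove (catScan (g .cat).cell) catMove
            digit := dmv })
  | .query =>
    match M.query q sc (workScan (g .work).cell) (catScan (g .cat).cell) with
    | .step q im workWrite workMove catMove out =>
      .step (.sim dir q .query) im out
        (fun S c => { c with
          data := c.data.map fun p => (p.1,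
            if p.1 then p.2 else if S .work then workWrite.getD p.2 else p.2) })
        (SimMoves.fn
          { work := boundedMove (workScan (g .work).cell) workMove
            cat := boundedMove (catScan (g .cat).cell) catMove
            digit := dmv })
    | .next q =>
      .step (.sim dir q .between) .stay none
        (fun S c => { c with
          ans := if S .ansWrite then some ans else c.ans
          aux := c.aux.map fun _ => false })
        (SimMoves.fn
          { ansWrite := .right, read := .one, write := .one, aux := .zero, digit := dmv })
    | .ask q =>
      .step (.sim dir q .answers) .stay none
        (fun S c => { c with
          ans := if S .ansWrite then some ans else c.ans
          aux := c.aux.map fun _ => false })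
        (SimMoves.fn
          { ansWrite := .right, read := .one, write := .one, aux := .zero, digit := dmv })
  | .between =>
    inPlaceAct dir dmv q .between sc g fun q =>
      .step (.sim dir q .query) .stay none (fun _ c => c) (SimMoves.fn { digit := dmv })
  | .answers =>
    inPlaceAct dir dmv q .answers sc g fun q =>
      match (g .ansRead).cell.ans with
      | none => .step (.sim dir q .main) .stay none (fun _ c => c) (SimMoves.fn { digit := dmv })
      | some b =>
        .step (.sim dir (M.receive q b) .answers) .stay none
          (fun _ c => { c with aux := c.aux.map fun _ => false })
          (SimMoves.fn
            { ansRead := .right, read := .one, write := .one, aux := .zero, digit := dmv })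

/-- The instructions of the simulating machine; `v₀` and `v₁` are the verdicts on the inputs of
length at most `1`. -/
def fullAct (d : ℕ) (v₀ : Verdict) (v₁ : Bool → Verdict) (s : M.SimState d) (coin ans : Bool)
    (sc : Scan Bool) (g : SimHead d → View SimCell (SimHead d)) :
    HeadAct σ (M.SimState d) SimCell (SimHead d) :=
  match s with
  | .boot => .step .first .right none (fun _ c => c) (SimMoves.fn { read := .one, aux := .one })
  | .first =>
    match sc with
    | .sym b => .step (.second b) .right none (fun _ c => c) (SimMoves.fn { fst := .right })
    | _ => .halt v₀
  | .second b =>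
    match sc with
    | .sym _ =>
      .step .scanning .right none (fun _ c => c) (SimMoves.fn { fst := .right, snd := .right })
    | _ => .halt (v₁ b)
  | .scanning =>
    match sc with
    | .sym _ =>
      .step .scanning .right none (fun _ c => c) (SimMoves.fn { fst := .right, snd := .right })
    | _ =>
      .step (.halve true false) .left none
        (fun S c => { c with last := c.last || S .snd }) (SimMoves.fn { snd := .zero })
  | .halve side parity =>
    if (g (if side then .fst else .snd)).cell.zero then
      .step (.block side (Fin.last _)) .stay none (fun _ c => c) (SimMoves.fn {})
    else
      .step (.halve side !parity) .left none (fun _ c => c)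
        (SimMoves.fn
          { fst := if side then .left else if parity then .right else .stay
            snd := if side then if parity then .right else .stay else .left })
  | .block side i =>
    if hi : i = 0 then
      if (g (if side then .snd else .fst)).cell.zero then
        .step (.fill fun _ => true) .stay none (fun _ c => c) (SimMoves.fn {})
      else .step (.halve (!side) false) .stay none (fun _ c => c) (SimMoves.fn {})
    else if (i : ℕ) ≤ M.workConst then
      .step (.block side ⟨i - 1, by omega⟩) .stay none
        (fun S c => { c with data := if S .read then some (false, false) else c.data })
        (SimMoves.fn { read := .right, cat := .right })
    else
      .step (.block side ⟨i - 1, by omega⟩) .stay none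
        (fun S c => { c with aux := if S .aux then some false else c.aux })
        (SimMoves.fn { aux := .right })
  | .fill dir =>
    if ∀ i : Fin d, (i : ℕ) < M.catExp → stuck dir g i = true then
      .step (.sim dir M.start .main) .stay none
        (fun S c => { c with data := if S .read then some (true, coin) else c.data })
        (SimMoves.fn {})
    else
      .step (.fill (tickDir dir (stuck dir g))) .stay none
        (fun S c => { c with data := if S .read then some (true, coin) else c.data })
        (SimMoves.fn { read := .right, digit := tickMove dir (stuck dir g) })
  | .sim dir q tag =>
    if ∀ i : Fin d, stuck dir g i = true then .halt .dontKnow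
    else
      simAct (tickDir dir (stuck dir g)) (tickMove dir (stuck dir g)) q tag ans sc g

/-- Whether the simulating machine asks the oracle. -/
def fullAsks (d : ℕ) (s : M.SimState d) (sc : Scan Bool)
    (g : SimHead d → View SimCell (SimHead d)) : Bool :=
  match s with
  | .sim _ q .query =>
    match M.query q sc (workScan (g .work).cell) (catScan (g .cat).cell) with
    | .step _ _ _ _ _ _ => false
    | _ => true
  | _ => false

/-- A blank cell. -/
def blankCell : SimCell := ⟨false, false, none, none, none⟩

theorem inPlaceAct_upd_blank {d : ℕ} {dir : Fin d → Bool} {dmv : Fin d → HeadMove} {q : M.Q}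
    {tag : Tag} {sc : Scan Bool} {g : SimHead d → View SimCell (SimHead d)}
    {done : M.Q → HeadAct σ (M.SimState d) SimCell (SimHead d)}
    (hdone : ∀ q s' im out upd mv, done q = .step s' im out upd mv →
      upd (fun _ => false) blankCell = blankCell) {s' im out upd mv}
    (h : inPlaceAct dir dmv q tag sc g done = .step s' im out upd mv) :
    upd (fun _ => false) blankCell = blankCell := by
  unfold inPlaceAct at h
  split at h
  · exact hdone _ _ _ _ _ _ h
  · cases h
    rfl

theorem simAct_upd_blank {d : ℕ} {dir : Fin d → Bool} {dmv : Fin d → HeadMove} {q : M.Q}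
    {tag : Tag} {ans : Bool} {sc : Scan Bool} {g : SimHead d → View SimCell (SimHead d)}
    {s' im out upd mv}
    (h : simAct dir dmv q tag ans sc g = .step s' im out upd mv) :
    upd (fun _ => false) blankCell = blankCell := by
  unfold simAct at h
  split at h
  · split at h <;> cases h <;> rfl
  · split at h <;> cases h <;> rfl
  · refine M.inPlaceAct_upd_blank ?_ h
    intro q _ _ _ _ _ h
    cases h
    rfl
  · refine M.inPlaceAct_upd_blank ?_ h
    intro q _ _ _ _ _ h
    split at h <;> cases h <;> rfl

theorem fullAct_upd_blank {d : ℕ} {v₀ : Verdict} {v₁ : Bool → Verdict} {s : M.SimState d}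
    {coin ans : Bool} {sc : Scan Bool} {g : SimHead d → View SimCell (SimHead d)}
    {s' im out upd mv}
    (h : M.fullAct d v₀ v₁ s coin ans sc g = .step s' im out upd mv) :
    upd (fun _ => false) blankCell = blankCell := by
  unfold fullAct at h
  split at h
  case h_8 =>
    split at h
    · cases h
    · exact M.simAct_upd_blank h
  all_goals (repeat' split at h) <;> cases h <;> rfl

/-- The simulating machine. -/
abbrev simulator (d : ℕ) (v₀ : Verdict) (v₁ : Bool → Verdict) : HeadMachine σ where
  S := M.SimState d
  finiteS := M.finite_simState d
  C := SimCell
  finiteC := finite_simCell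
  ι := SimHead d
  finiteι := finite_simHead d
  start := .boot
  blank := blankCell
  corner := { blankCell with zero := true }
  asks := M.fullAsks d
  act := M.fullAct d v₀ v₁
  upd_blank := M.fullAct_upd_blank

end RoundMachine
end Catalytic
end

/-! ### The counter in operation, and the construction of the tapes -/

noncomputable section

namespace Catalytic

theorem HeadMachine.step_of_act {σ : Type} {H : HeadMachine σ} {A : Language σ} {x : List Bool}
    {c : HeadCfg σ H.S H.C H.ι} {coin : Bool} (hv : c.verdict = none) {s im out upd mv}
    (hact : H.act c.state coin (H.asking x c && answer A c.query) (scan x c.inPos) c.view =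
      .step s im out upd mv) :
    H.step A x c coin =
      { state := s
        verdict := none
        inPos := moveBounded x.length c.inPos im
        mem := fun j => upd (fun h => decide (c.head h = j)) (c.mem j)
        head := fun h => (mv h).apply (c.head h)
        query := (if H.asking x c then [] else c.query) ++ out.toList } := by
  simp only [HeadMachine.step, hv, hact]

theorem HeadMachine.step_of_halt {σ : Type} {H : HeadMachine σ} {A : Language σ} {x : List Bool}
    {c : HeadCfg σ H.S H.C H.ι} {coin : Bool} (hv : c.verdict = none) {v}
    (hact : H.act c.state coin (H.asking x c && answer A c.query) (scan x c.inPos) c.view =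
      .halt v) :
    (H.step A x c coin).verdict = some v := by
  simp only [HeadMachine.step, hv, hact]

theorem scan_zero {α : Type} (l : List α) : scan l 0 = .leftEnd := rfl

theorem scan_succ_of_lt {α : Type} (l : List α) {i : ℕ} (h : i < l.length) :
    scan l (i + 1) = .sym l[i] := by
  simp [scan, h]

theorem scan_succ_of_le {α : Type} (l : List α) {i : ℕ} (h : l.length ≤ i) :
    scan l (i + 1) = .rightEnd := by
  simp [scan, h]

namespace RoundMachine

/-- The remaining way of the digit `i`. -/
def digitRem {d : ℕ} (n : ℕ) (dir : Fin d → Bool) (pos : Fin d → ℕ) (i : ℕ) : ℕ :=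
  if h : i < d then if dir ⟨i, h⟩ then n - 1 - pos ⟨i, h⟩ else pos ⟨i, h⟩ else 0

/-- The number of ticks until the lowest `e` digits of the counter have reached their ends. -/
def rank {d : ℕ} (n : ℕ) (dir : Fin d → Bool) (pos : Fin d → ℕ) (e : ℕ) : ℕ :=
  ∑ i ∈ Finset.range e, digitRem n dir pos i * n ^ i

section counter

variable {d n : ℕ} {dir : Fin d → Bool} {pos : Fin d → ℕ} {stk : Fin d → Bool}

theorem digitRem_eq_zero_iff (hn : 0 < n) (hpos : ∀ i, pos i < n)
    (hstk : ∀ i, stk i = if dir i then decide (pos i = n - 1) else decide (pos i = 0)) (i : Fin d) :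
    digitRem n dir pos i = 0 ↔ stk i = true := by
  have := hpos i
  rw [hstk]
  simp only [digitRem, i.2, dif_pos, Fin.eta]
  split_ifs
  · rw [decide_eq_true_iff]
    omega
  · rw [decide_eq_true_iff]

theorem rank_eq_zero_iff (hn : 0 < n) (hpos : ∀ i, pos i < n)
    (hstk : ∀ i, stk i = if dir i then decide (pos i = n - 1) else decide (pos i = 0)) {e : ℕ} :
    rank n dir pos e = 0 ↔ ∀ i : Fin d, (i : ℕ) < e → stk i = true := by
  rw [rank, Finset.sum_eq_zero_iff]
  constructor
  · intro h i hi
    rw [← digitRem_eq_zero_iff hn hpos hstk]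
    have := h i (Finset.mem_range.2 hi)
    rcases Nat.mul_eq_zero.1 this with h | h
    · exact h
    · exact absurd h (Nat.pow_pos hn).ne'
  · intro h i hi
    by_cases hd : i < d
    · rw [(digitRem_eq_zero_iff hn hpos hstk ⟨i, hd⟩).2 (h ⟨i, hd⟩ (Finset.mem_range.1 hi)), zero_mul]
    · simp [digitRem, hd]

theorem tick_lt (hn : 0 < n) (hpos : ∀ i, pos i < n)
    (hstk : ∀ i, stk i = if dir i then decide (pos i = n - 1) else decide (pos i = 0)) (i : Fin d) :
    (tickMove dir stk i).apply (pos i) < n := by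
  have h := hpos i
  have hs := hstk i
  unfold tickMove
  split_ifs with h1 h2
  · rw [h1.2, h2] at hs
    simp only [if_true] at hs
    have := decide_eq_false_iff_not.1 hs.symm
    simp only [HeadMove.apply]
    omega
  · simp only [HeadMove.apply]
    omega
  · exact h

/-- The lowest digit that can still move, k, takes one step, and all digits below it reverse their
directions without moving. Thus a tick moves one head by one cell and no digit ever has to be reset.
Since k lies below e, the same tick counts for every sufficiently long initial segment of digits. -/
theorem rank_tick (hn : 0 < n) (hpos : ∀ i, pos i < n)
    (hstk : ∀ i, stk i = if dir i then decide (pos i = n - 1) else decide (pos i = 0)) {e : ℕ}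
    (hex : ∃ i : Fin d, (i : ℕ) < e ∧ stk i = false) :
    rank n (tickDir dir stk) (fun i => (tickMove dir stk i).apply (pos i)) e + 1 =
      rank n dir pos e := by
  obtain ⟨k, ⟨hke, hk⟩, hmin⟩ : ∃ k : Fin d, ((k : ℕ) < e ∧ stk k = false) ∧
      ∀ j < k, stk j = true := by
    obtain ⟨k, hk, hmin⟩ := WellFounded.has_min (wellFounded_lt (α := Fin d))
      {i | (i : ℕ) < e ∧ stk i = false} hex
    refine ⟨k, hk, fun j hj => ?_⟩
    by_contra hne
    exact hmin j ⟨(Fin.lt_def.1 hj).trans hk.1, by simpa using hne⟩ hj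
  refine counter_tick hn hke ?_ ?_ ?_
  · intro j hj
    have hjd : j < d := hj.trans k.2
    have hs : stk ⟨j, hjd⟩ = true := hmin _ hj
    refine ⟨(digitRem_eq_zero_iff hn hpos hstk ⟨j, hjd⟩).2 hs, ?_⟩
    have h1 : tickDir dir stk ⟨j, hjd⟩ = !dir ⟨j, hjd⟩ := by
      unfold tickDir
      rw [if_pos]
      intro i hi
      exact hmin i (lt_of_le_of_lt hi hj)
    have h2 : tickMove dir stk ⟨j, hjd⟩ = .stay := by
      unfold tickMove
      rw [if_neg]
      rw [hs]
      simp
    have h3 := hstk ⟨j, hjd⟩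
    rw [hs] at h3
    simp only [digitRem, hjd, dif_pos, h1, h2, HeadMove.apply]
    cases hd : dir ⟨j, hjd⟩ <;> simp [hd] at h3 ⊢ <;> omega
  · have h1 : tickDir dir stk k = dir k := by
      unfold tickDir
      rw [if_neg]
      intro h
      have := h k le_rfl
      rw [hk] at this
      cases this
    have h2 : tickMove dir stk k = if dir k then .right else .left := by
      unfold tickMove
      rw [if_pos ⟨hmin, hk⟩]
    have h3 := hstk k
    rw [hk] at h3
    have h4 := hpos k
    simp only [digitRem, k.2, dif_pos, h1, h2]
    cases hd : dir k <;> simp [hd, HeadMove.apply] at h3 ⊢ <;> omega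
  · intro j hj
    by_cases hjd : j < d
    · have h1 : tickDir dir stk ⟨j, hjd⟩ = dir ⟨j, hjd⟩ := by
        unfold tickDir
        rw [if_neg]
        intro h
        have := h k (Fin.le_def.2 hj.le)
        rw [hk] at this
        cases this
      have h2 : tickMove dir stk ⟨j, hjd⟩ = .stay := by
        unfold tickMove
        rw [if_neg]
        rintro ⟨h, -⟩
        have := h k (Fin.lt_def.2 hj)
        rw [hk] at this
        cases this
      simp only [digitRem, hjd, dif_pos, h1, h2, HeadMove.apply]
    · simp [digitRem, hjd]

theorem rank_init (hn : 0 < n) {e : ℕ} (he : e ≤ d) :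
    rank n (fun _ : Fin d => true) (fun _ => 0) e + 1 = n ^ e := by
  rw [← counter_init n e hn, rank]
  congr 1
  apply Finset.sum_congr rfl
  intro i hi
  rw [Finset.mem_range] at hi
  simp [digitRem, show i < d by omega]

end counter

variable {σ : Type} (M : RoundMachine σ)

/-- The contents of the data track: the first `w` cells belong to the work tape. -/
def dataAt (w : ℕ) (z : List Bool) (j : ℕ) : Option (Bool × Bool) :=
  if j = 0 then none else z[j - 1]?.map fun b => (decide (w < j), b)

/-- The contents of a track with the cells `l`. -/
def trackAt (l : List Bool) (j : ℕ) : Option Bool :=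
  if j = 0 then none else l[j - 1]?

theorem dataAt_append (w : ℕ) (z : List Bool) (b : Bool) (j : ℕ) :
    dataAt w (z ++ [b]) j =
      if z.length + 1 = j then some (decide (w < j), b) else dataAt w z j := by
  unfold dataAt
  rcases j with _ | j
  · simp
  · simp only [Nat.add_eq_zero_iff, one_ne_zero, and_false, if_false, Nat.add_sub_cancel,
      Nat.add_right_cancel_iff]
    split_ifs with h
    · subst h; simp
    · rcases lt_or_gt_of_ne h with h | h
      · rw [List.getElem?_eq_none (by simp; omega), List.getElem?_eq_none (by omega)]
      · rw [List.getElem?_append_left h]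

/-- A new cell of the work tape moves the border between the tapes, but leaves the flags of the
earlier cells unchanged. -/
theorem dataAt_replicate_succ (w j : ℕ) :
    dataAt (w + 1) (List.replicate (w + 1) false) j =
      if w + 1 = j then some (false, false) else dataAt w (List.replicate w false) j := by
  rw [List.replicate_succ', dataAt_append, List.length_replicate]
  split_ifs with h
  · simp [← h]
  · unfold dataAt
    split_ifs with h0
    · rfl
    · rcases lt_or_gt_of_ne h with h | h
      · rw [List.getElem?_eq_none (by simp; omega)]; rfl
      · rw [decide_eq_false (show ¬ w + 1 < j by omega), decide_eq_false (show ¬ w < j by omega)]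

theorem trackAt_replicate_succ (a j : ℕ) :
    trackAt (List.replicate (a + 1) false) j =
      if a + 1 = j then some false else trackAt (List.replicate a false) j := by
  unfold trackAt
  simp only [List.getElem?_replicate]
  split_ifs <;> first | rfl | omega

/-- Configurations of the simulating machine. -/
abbrev SimCfg (d : ℕ) := HeadCfg σ (M.SimState d) SimCell (SimHead d)

variable {M} {d : ℕ}

/-- The memory and the heads while the tapes are being built: there are `w` cells of the work tape,
`a` cells of the auxiliary tape, and the cells `bits` of the catalytic tape. -/
structure Building (lst : ℕ → Prop) (w a : ℕ) (bits : List Bool) (c : M.SimCfg d) : Prop where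
  verdict : c.verdict = none
  query : c.query = []
  zero : ∀ j, ((c.mem j).zero = true ↔ j = 0)
  last : ∀ j, ((c.mem j).last = true ↔ lst j)
  data : ∀ j, (c.mem j).data = dataAt w (List.replicate w false ++ bits) j
  aux : ∀ j, (c.mem j).aux = trackAt (List.replicate a false) j
  ans : ∀ j, (c.mem j).ans = none
  headWork : c.head .work = 0
  headCat : c.head .cat = w
  headRead : c.head .read = w + bits.length + 1
  headAux : c.head .aux = a + 1

variable {v₀ : Verdict} {v₁ : Bool → Verdict} {A : Language σ} {x : List Bool}
  {coins : ℕ → Bool}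

/-- The machine is scanning the input. -/
structure Scanning (i : ℕ) (c : M.SimCfg d) : Prop where
  build : Building (fun _ => False) 0 0 [] c
  state : c.state = .scanning
  inPos : c.inPos = i + 1
  fst : c.head .fst = i
  snd : c.head .snd + 1 = i
  digit : ∀ i, c.head (.digit i) = 0

theorem run_succ_eq {t : ℕ} {H : HeadMachine σ} :
    H.run A x coins (t + 1) = H.step A x (H.run A x coins t) (coins t) := rfl

theorem run_short_zero (hx : x.length = 0) :
    ((M.simulator d v₀ v₁).run A x coins 2).verdict = some v₀ := by
  obtain rfl := List.length_eq_zero_iff.1 hx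
  rfl

theorem run_short_one {b : Bool} (hx : x = [b]) :
    ((M.simulator d v₀ v₁).run A x coins 3).verdict = some (v₁ b) := by
  subst hx
  rfl

theorem scanning_start (hx : 2 ≤ x.length) :
    Scanning 2 ((M.simulator d v₀ v₁).run A x coins 3) := by
  obtain ⟨b, x, rfl⟩ := List.exists_cons_of_length_pos (show 0 < x.length by omega)
  obtain ⟨b', x, rfl⟩ := List.exists_cons_of_length_pos
    (show 0 < x.length by rw [List.length_cons] at hx; omega)
  have h1 : (M.simulator d v₀ v₁).run A (b :: b' :: x) coins 3 =
    { state := .scanning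
      verdict := none
      inPos := 3
      mem := fun j => if j = 0 then { blankCell with zero := true } else blankCell
      head := fun | .fst => 2 | .snd => 1 | .read => 1 | .aux => 1 | _ => 0
      query := [] } := by
    have e1 : (M.simulator d v₀ v₁).run A (b :: b' :: x) coins 1 =
      { state := .first
        verdict := none
        inPos := 1
        mem := fun j => if j = 0 then { blankCell with zero := true } else blankCell
        head := fun | .read => 1 | .aux => 1 | _ => 0
        query := [] } := by
      rw [run_succ_eq, HeadMachine.step_of_act rfl rfl]
      congr 1
      funext h
      cases h <;> rfl
    have e2 : (M.simulator d v₀ v₁).run A (b :: b' :: x) coins 2 =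
      { state := .second b
        verdict := none
        inPos := 2
        mem := fun j => if j = 0 then { blankCell with zero := true } else blankCell
        head := fun | .fst => 1 | .read => 1 | .aux => 1 | _ => 0
        query := [] } := by
      rw [run_succ_eq, e1, HeadMachine.step_of_act rfl rfl]
      congr 1
      funext h
      cases h <;> rfl
    rw [run_succ_eq, e2, HeadMachine.step_of_act rfl rfl]
    congr 1
    funext h
    cases h <;> rfl
  rw [h1]
  refine ⟨⟨rfl, rfl, ?_, ?_, ?_, ?_, ?_, rfl, rfl, rfl, rfl⟩, rfl, rfl, rfl, rfl, fun _ => rfl⟩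
  all_goals
    intro j
    dsimp only
    split_ifs with h
    · simp [h, blankCell, dataAt, trackAt]
    · simp [h, blankCell, dataAt, trackAt]

theorem scanning_step {i t : ℕ} (hi : i < x.length)
    (h : Scanning i ((M.simulator d v₀ v₁).run A x coins t)) :
    Scanning (i + 1) ((M.simulator d v₀ v₁).run A x coins (t + 1)) := by
  rw [run_succ_eq]
  generalize (M.simulator d v₀ v₁).run A x coins t = c at h
  obtain ⟨hb, hs, hin, hf, hg, hd⟩ := h
  rw [HeadMachine.step_of_act hb.verdict (s := .scanning) (im := .right) (out := none)
    (upd := fun _ c => c) (mv := SimMoves.fn { fst := .right, snd := .right })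
    (by simp only [hs, hin, scan_succ_of_lt x hi, fullAct])]
  have hask : (M.simulator d v₀ v₁).asking x c = false := by
    simp only [HeadMachine.asking, hs, fullAsks]
  refine ⟨⟨rfl, by simp [hask, hb.query], hb.zero, hb.last, hb.data, hb.aux, hb.ans, hb.headWork,
    hb.headCat, hb.headRead, hb.headAux⟩, rfl, ?_, ?_, ?_, hd⟩
  · simp only [moveBounded, hin]; omega
  · simp only [SimMoves.fn, HeadMove.apply, hf]
  · simp only [SimMoves.fn, HeadMove.apply, hg]

/-- The machine is halving: the values of the active and of the other head are `u` and `v`. -/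
structure Halving (n w a : ℕ) (side parity : Bool) (u v : ℕ) (c : M.SimCfg d) : Prop where
  build : Building (fun j => j = n - 1) w a [] c
  state : c.state = .halve side parity
  inPos : c.inPos ≤ u
  active : c.head (if side then .fst else .snd) = u
  other : c.head (if side then .snd else .fst) = v
  digit : ∀ i, c.head (.digit i) = 0

/-- The head `snd` lags one cell behind `fst` and so stands at n - 1. That cell gets the mark that
later serves as the upper end of the digits, and `fst` holds the number n to be halved. -/
theorem scanning_end {t : ℕ}
    (h : Scanning x.length ((M.simulator d v₀ v₁).run A x coins t)) :
    Halving x.length 0 0 true false x.length 0 ((M.simulator d v₀ v₁).run A x coins (t + 1)) := by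
  rw [run_succ_eq]
  generalize (M.simulator d v₀ v₁).run A x coins t = c at h
  obtain ⟨hb, hs, hin, hf, hg, hd⟩ := h
  rw [HeadMachine.step_of_act hb.verdict (s := .halve true false) (im := .left) (out := none)
    (upd := fun S c => { c with last := c.last || S .snd }) (mv := SimMoves.fn { snd := .zero })
    (by simp only [hs, hin, scan_succ_of_le x le_rfl, fullAct])]
  have hask : (M.simulator d v₀ v₁).asking x c = false := by
    simp only [HeadMachine.asking, hs, fullAsks]
  refine ⟨⟨rfl, by simp [hask, hb.query], hb.zero, ?_, hb.data, hb.aux, hb.ans, hb.headWork,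
    hb.headCat, hb.headRead, hb.headAux⟩, rfl, ?_, ?_, ?_, hd⟩
  · intro j
    have := hb.last j
    simp only [Bool.or_eq_true, this, false_or, decide_eq_true_iff]
    omega
  · simp only [moveBounded, hin]; omega
  · simp only [SimMoves.fn, HeadMove.apply, if_true, hf]
  · simp [SimMoves.fn, HeadMove.apply]

/-- The other head advances at every second step of the active one. The input head moves left as
well, so that it is back at position 0 when the active head is. -/
theorem halving_step {n w a u v t : ℕ} {side parity : Bool}
    (h : Halving n w a side parity (u + 1) v ((M.simulator d v₀ v₁).run A x coins t)) :
    Halving n w a side (!parity) u (v + parity.toNat)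
      ((M.simulator d v₀ v₁).run A x coins (t + 1)) := by
  rw [run_succ_eq]
  generalize (M.simulator d v₀ v₁).run A x coins t = c at h
  obtain ⟨hb, hs, hin, hf, hg, hd⟩ := h
  have hz : (c.view (if side then .fst else .snd)).cell.zero = false := by
    rw [← Bool.not_eq_true, HeadCfg.view, hb.zero, hf]
    omega
  rw [HeadMachine.step_of_act hb.verdict (s := .halve side !parity) (im := .left) (out := none)
    (upd := fun _ c => c) (mv := SimMoves.fn
          { fst := if side then .left else if parity then .right else .stay
            snd := if side then if parity then .right else .stay else .left })
    (by simp only [hs, fullAct, hz, Bool.false_eq_true, if_false])]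
  have hask : (M.simulator d v₀ v₁).asking x c = false := by
    simp only [HeadMachine.asking, hs, fullAsks]
  refine ⟨⟨rfl, by simp [hask, hb.query], hb.zero, hb.last, hb.data, hb.aux, hb.ans, hb.headWork,
    hb.headCat, hb.headRead, hb.headAux⟩, rfl, ?_, ?_, ?_, hd⟩
  · simp only [moveBounded]; omega
  · cases side <;> simp [SimMoves.fn, HeadMove.apply] at hf ⊢ <;> omega
  · cases side <;> cases parity <;> simp [SimMoves.fn, HeadMove.apply] at hg ⊢ <;> omega

theorem halving_steps {n w a u v t : ℕ} {side parity : Bool}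
    (h : Halving n w a side parity u v ((M.simulator d v₀ v₁).run A x coins t)) :
    ∃ parity', Halving n w a side parity' 0 (v + (u + parity.toNat) / 2)
      ((M.simulator d v₀ v₁).run A x coins (t + u)) := by
  induction u generalizing v t parity with
  | zero => exact ⟨parity, by cases parity <;> simpa using h⟩
  | succ u ih =>
    obtain ⟨p, hp⟩ := ih (halving_step h)
    refine ⟨p, ?_⟩
    rw [show v + parity.toNat + (u + (!parity).toNat) / 2 = v + (u + 1 + parity.toNat) / 2 by
      cases parity <;> (simp; try omega), show t + 1 + u = t + (u + 1) by omega] at hp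
    exact hp

/-- The machine is appending a block of cells. -/
structure Blocking (n w a : ℕ) (side : Bool) (i v : ℕ) (c : M.SimCfg d) : Prop where
  build : Building (fun j => j = n - 1) w a [] c
  state : ∃ h, c.state = .block side ⟨i, h⟩
  inPos : c.inPos = 0
  other : c.head (if side then .snd else .fst) = v
  fst_or : c.head (if side then .fst else .snd) = 0
  digit : ∀ i, c.head (.digit i) = 0

theorem halving_end {n w a v t : ℕ} {side parity : Bool}
    (h : Halving n w a side parity 0 v ((M.simulator d v₀ v₁).run A x coins t)) :
    Blocking n w a side (M.workConst + M.auxConst) v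
      ((M.simulator d v₀ v₁).run A x coins (t + 1)) := by
  rw [run_succ_eq]
  generalize (M.simulator d v₀ v₁).run A x coins t = c at h
  obtain ⟨hb, hs, hin, hf, hg, hd⟩ := h
  have hz : (c.view (if side then .fst else .snd)).cell.zero = true := by
    rw [HeadCfg.view, hb.zero, hf]
  rw [HeadMachine.step_of_act hb.verdict (s := .block side (Fin.last _)) (im := .stay) (out := none)
    (upd := fun _ c => c) (mv := SimMoves.fn {})
    (by simp only [hs, fullAct, hz, if_true])]
  have hask : (M.simulator d v₀ v₁).asking x c = false := by
    simp only [HeadMachine.asking, hs, fullAsks]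
  refine ⟨⟨rfl, by simp [hask, hb.query], hb.zero, hb.last, hb.data, hb.aux, hb.ans, hb.headWork,
    hb.headCat, hb.headRead, hb.headAux⟩, ⟨by omega, rfl⟩, ?_, ?_, ?_, hd⟩
  · simp only [moveBounded]; omega
  · cases side <;> exact hg
  · cases side <;> exact hf

theorem blocking_work {n w a v i t : ℕ} {side : Bool} (hi : i + 1 ≤ M.workConst)
    (h : Blocking n w a side (i + 1) v ((M.simulator d v₀ v₁).run A x coins t)) :
    Blocking n (w + 1) a side i v ((M.simulator d v₀ v₁).run A x coins (t + 1)) := by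
  rw [run_succ_eq]
  generalize (M.simulator d v₀ v₁).run A x coins t = c at h
  obtain ⟨hb, ⟨hlt, hs⟩, hin, hg, hf, hd⟩ := h
  rw [HeadMachine.step_of_act hb.verdict (s := .block side ⟨i, by omega⟩) (im := .stay)
    (out := none) (upd := fun S c => { c with data := if S .read then some (false, false) else c.data })
    (mv := SimMoves.fn { read := .right, cat := .right })
    (by simp [hs, fullAct, hi])]
  have hask : (M.simulator d v₀ v₁).asking x c = false := by
    simp only [HeadMachine.asking, hs, fullAsks]
  refine ⟨⟨rfl, by simp [hask, hb.query], hb.zero, hb.last, ?_, hb.aux, hb.ans, hb.headWork,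
    ?_, ?_, hb.headAux⟩, ⟨by omega, rfl⟩, hin, ?_, ?_, hd⟩
  · intro j
    have h1 := hb.headRead
    have h2 := hb.data j
    simp only [List.append_nil, List.length_nil, add_zero] at h1 h2
    simp only [List.append_nil, dataAt_replicate_succ, h1, h2, decide_eq_true_iff]
  · simp [SimMoves.fn, HeadMove.apply, hb.headCat]
  · simp [SimMoves.fn, HeadMove.apply, hb.headRead]
  · cases side <;> exact hg
  · cases side <;> exact hf

theorem blocking_aux {n w a v i t : ℕ} {side : Bool} (hi : M.workConst ≤ i)
    (h : Blocking n w a side (i + 1) v ((M.simulator d v₀ v₁).run A x coins t)) :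
    Blocking n w (a + 1) side i v ((M.simulator d v₀ v₁).run A x coins (t + 1)) := by
  rw [run_succ_eq]
  generalize (M.simulator d v₀ v₁).run A x coins t = c at h
  obtain ⟨hb, ⟨hlt, hs⟩, hin, hg, hf, hd⟩ := h
  rw [HeadMachine.step_of_act hb.verdict (s := .block side ⟨i, by omega⟩) (im := .stay)
    (out := none) (upd := fun S c => { c with aux := if S .aux then some false else c.aux })
    (mv := SimMoves.fn { aux := .right })
    (by simp [hs, fullAct, show ¬ i + 1 ≤ M.workConst by omega])]
  have hask : (M.simulator d v₀ v₁).asking x c = false := by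
    simp only [HeadMachine.asking, hs, fullAsks]
  refine ⟨⟨rfl, by simp [hask, hb.query], hb.zero, hb.last, hb.data, ?_, hb.ans, hb.headWork,
    hb.headCat, hb.headRead, ?_⟩, ⟨by omega, rfl⟩, hin, ?_, ?_, hd⟩
  · intro j
    have h1 := hb.headAux
    have h2 := hb.aux j
    simp only [trackAt_replicate_succ, h1, h2, decide_eq_true_iff]
  · simp [SimMoves.fn, HeadMove.apply, hb.headAux]
  · cases side <;> exact hg
  · cases side <;> exact hf

theorem blocking_steps {n w a v t : ℕ} {side : Bool}
    (h : Blocking n w a side (M.workConst + M.auxConst) v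
      ((M.simulator d v₀ v₁).run A x coins t)) :
    Blocking n (w + M.workConst) (a + M.auxConst) side 0 v
      ((M.simulator d v₀ v₁).run A x coins (t + (M.workConst + M.auxConst))) := by
  have haux : ∀ i a t, Blocking n w a side (M.workConst + i) v
      ((M.simulator d v₀ v₁).run A x coins t) → Blocking n w (a + i) side M.workConst v
      ((M.simulator d v₀ v₁).run A x coins (t + i)) := by
    intro i
    induction i with
    | zero => exact fun _ _ h => h
    | succ i ih =>
      intro a t h
      have := ih _ _ (blocking_aux (by omega) h)
      rwa [show a + 1 + i = a + (i + 1) by omega, show t + 1 + i = t + (i + 1) by omega] at this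
  have hwork : ∀ i w a t, i ≤ M.workConst → Blocking n w a side i v
      ((M.simulator d v₀ v₁).run A x coins t) → Blocking n (w + i) a side 0 v
      ((M.simulator d v₀ v₁).run A x coins (t + i)) := by
    intro i
    induction i with
    | zero => exact fun _ _ _ _ h => h
    | succ i ih =>
      intro w a t hi h
      have := ih _ _ _ (by omega) (blocking_work hi h)
      rwa [show w + 1 + i = w + (i + 1) by omega, show t + 1 + i = t + (i + 1) by omega] at this
  have := hwork _ _ _ _ le_rfl (haux _ _ _ h)
  rwa [show t + M.auxConst + M.workConst = t + (M.workConst + M.auxConst) by omega] at this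

/-- The machine is filling the catalytic tape. -/
structure Filling (n w a : ℕ) (bits : List Bool) (dir : Fin d → Bool) (c : M.SimCfg d) : Prop where
  build : Building (fun j => j = n - 1) w a bits c
  state : c.state = .fill dir
  inPos : c.inPos = 0
  digit_lt : ∀ i, c.head (.digit i) < n
  rank_eq : ∀ e, M.catExp ≤ e → e ≤ d →
    rank n dir (fun i => c.head (.digit i)) e + bits.length + 1 = n ^ e

/-- If the quotient is positive, the two heads exchange their roles for the next halving; otherwise
all cells of the work and auxiliary tapes exist and the filling starts with a fresh counter. -/
theorem blocking_end {n w a v t : ℕ} {side : Bool} (hn : 0 < n)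
    (h : Blocking n w a side 0 v ((M.simulator d v₀ v₁).run A x coins t)) :
    if v = 0 then Filling n w a [] (fun _ => true) ((M.simulator d v₀ v₁).run A x coins (t + 1))
    else Halving n w a (!side) false v 0 ((M.simulator d v₀ v₁).run A x coins (t + 1)) := by
  rw [run_succ_eq]
  generalize (M.simulator d v₀ v₁).run A x coins t = c at h
  obtain ⟨hb, ⟨hlt, hs⟩, hin, hg, hf, hd⟩ := h
  have hz := hb.zero (c.head (if side then .snd else .fst))
  rw [hg] at hz
  have hask : (M.simulator d v₀ v₁).asking x c = false := by
    simp only [HeadMachine.asking, hs, fullAsks]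
  split_ifs with hv
  · rw [HeadMachine.step_of_act hb.verdict (s := .fill fun _ => true) (im := .stay)
      (out := none) (upd := fun _ c => c) (mv := SimMoves.fn {})
      (by
        have : (c.view (if side then .snd else .fst)).cell.zero = true := by
          rw [HeadCfg.view, hg]; exact hz.2 hv
        simp [hs, fullAct, this])]
    refine ⟨⟨rfl, by simp [hask, hb.query], hb.zero, hb.last, hb.data, hb.aux, hb.ans, hb.headWork,
      hb.headCat, hb.headRead, hb.headAux⟩, rfl, hin, ?_, ?_⟩
    · intro i
      simp [SimMoves.fn, HeadMove.apply, hd, hn]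
    · intro e _ he
      simp only [SimMoves.fn, HeadMove.apply, hd, List.length_nil, add_zero]
      exact rank_init hn he
  · rw [HeadMachine.step_of_act hb.verdict (s := .halve (!side) false) (im := .stay)
      (out := none) (upd := fun _ c => c) (mv := SimMoves.fn {})
      (by
        have : (c.view (if side then .snd else .fst)).cell.zero = false := by
          rw [HeadCfg.view, hg, ← Bool.not_eq_true]; exact fun h => hv (hz.1 h)
        simp [hs, fullAct, this])]
    refine ⟨⟨rfl, by simp [hask, hb.query], hb.zero, hb.last, hb.data, hb.aux, hb.ans, hb.headWork,
      hb.headCat, hb.headRead, hb.headAux⟩, rfl, ?_, ?_, ?_, hd⟩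
    · simp only [moveBounded, hin]; omega
    · cases side <;> exact hg
    · cases side <;> exact hf

/-- Halving u until it vanishes takes log₂ u + 1 passes, and each pass appends one block, which
yields exactly the required tape lengths. The number `s` of steps is chosen before the coins: the
coins that fill the catalytic tape must sit at fixed times. -/
theorem halving_total (d : ℕ) (v₀ : Verdict) (v₁ : Bool → Verdict) (A : Language σ) (x : List Bool)
    {n : ℕ} (hn : 0 < n) (u : ℕ) (hu : 0 < u) :
    ∃ s ≤ u * (M.workConst + M.auxConst + 4), ∀ coins w a t side,
      Halving n w a side false u 0 ((M.simulator d v₀ v₁).run A x coins t) →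
      Filling n (w + M.workConst * (Nat.log 2 u + 1)) (a + M.auxConst * (Nat.log 2 u + 1)) []
        (fun _ => true) ((M.simulator d v₀ v₁).run A x coins (t + s)) := by
  induction u using Nat.strong_induction_on with
  | _ u ih =>
    have hpass : ∀ coins w a t side,
        Halving n w a side false u 0 ((M.simulator d v₀ v₁).run A x coins t) →
        if u / 2 = 0 then Filling n (w + M.workConst) (a + M.auxConst) [] (fun _ => true)
          ((M.simulator d v₀ v₁).run A x coins (t + (u + M.workConst + M.auxConst + 2)))
        else Halving n (w + M.workConst) (a + M.auxConst) (!side) false (u / 2) 0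
          ((M.simulator d v₀ v₁).run A x coins (t + (u + M.workConst + M.auxConst + 2))) := by
      intro coins w a t side h
      obtain ⟨p, hp⟩ := halving_steps h
      have := blocking_end hn (blocking_steps (halving_end hp))
      rw [show t + u + 1 + (M.workConst + M.auxConst) + 1 =
        t + (u + M.workConst + M.auxConst + 2) by omega] at this
      simpa using this
    by_cases h2 : u / 2 = 0
    · refine ⟨u + M.workConst + M.auxConst + 2, ?_, ?_⟩
      · have : u = 1 := by omega
        subst this
        omega
      · intro coins w a t side h
        have := hpass coins w a t side h
        rw [if_pos h2] at this
        rwa [Nat.log_of_lt (show u < 2 by omega), Nat.zero_add, Nat.mul_one, Nat.mul_one]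
    · obtain ⟨s, hs, h⟩ := ih (u / 2) (by omega) (by omega)
      refine ⟨(u + M.workConst + M.auxConst + 2) + s, ?_, ?_⟩
      · obtain ⟨q, hq⟩ : ∃ q, u = u / 2 + (q + 1) := ⟨u - u / 2 - 1, by omega⟩
        have h3 : u ≤ 2 * (q + 1) := by omega
        calc _ ≤ (2 * (q + 1) + (M.workConst + M.auxConst + 2)) +
              u / 2 * (M.workConst + M.auxConst + 4) := by omega
          _ ≤ (q + 1) * (M.workConst + M.auxConst + 4) +
              u / 2 * (M.workConst + M.auxConst + 4) := by
            apply Nat.add_le_add_right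
            nlinarith [Nat.zero_le (q * (M.workConst + M.auxConst + 2))]
          _ = (u / 2 + (q + 1)) * (M.workConst + M.auxConst + 4) := by ring
          _ = _ := by rw [← hq]
      · intro coins w a t side h'
        have h4 := hpass coins w a t side h'
        rw [if_neg h2] at h4
        have h5 := h _ _ _ _ _ h4
        have hlog : Nat.log 2 u = Nat.log 2 (u / 2) + 1 :=
          Nat.log_of_one_lt_of_le (by omega) (by omega)
        rw [hlog]
        rw [← Nat.add_assoc t]
        convert h5 using 1 <;> ring

end RoundMachine
end Catalytic
end

/-! ### Tapes as tracks: scanning, writing and moving heads -/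

noncomputable section

namespace Catalytic

theorem getElem?_writeAt (l : List Bool) (p : ℕ) (o : Option Bool) (j : ℕ) :
    (writeAt l p o)[j]? = l[j]?.map fun b => if p = j + 1 then o.getD b else b := by
  cases o with
  | none => simp [writeAt]
  | some b =>
    by_cases hp : p = 0
    · simp [writeAt, hp]
    · simp only [writeAt, hp, if_false, List.getElem?_set]
      by_cases h : p = j + 1
      · subst h
        simp only [Nat.add_sub_cancel, if_true, Option.getD_some]
        split_ifs with hj
        · simp [hj]
        · simp [hj]
      · rw [if_neg (by omega)]
        simp [h]

namespace RoundMachine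

theorem dataAt_writeAt (w : ℕ) (z : List Bool) (p : ℕ) (o : Option Bool) (j : ℕ) :
    dataAt w (writeAt z p o) j =
      (dataAt w z j).map fun q => (q.1, if p = j then o.getD q.2 else q.2) := by
  rcases j with _ | j
  · rfl
  · simp only [dataAt, Nat.add_eq_zero_iff, one_ne_zero, and_false, if_false, Nat.add_sub_cancel,
      getElem?_writeAt, Option.map_map, Function.comp_def]

/-- Work tape and catalytic tape share one track, so that the tape of the in-place computations
needs no copying. The flag in a cell tells which of the two heads may write there. -/
theorem dataAt_writeAt_append (u v : List Bool) (p q : ℕ) (o o' : Option Bool) (j : ℕ) :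
    dataAt u.length (writeAt u p o ++ writeAt v q o') j =
      (dataAt u.length (u ++ v) j).map fun r => (r.1,
        if r.1 then if u.length + q = j then o'.getD r.2 else r.2
        else if p = j then o.getD r.2 else r.2) := by
  rcases j with _ | j
  · rfl
  · simp only [dataAt, Nat.add_eq_zero_iff, one_ne_zero, and_false, if_false, Nat.add_sub_cancel]
    rcases lt_or_ge j u.length with h | h
    · rw [List.getElem?_append_left (by rwa [length_writeAt]), List.getElem?_append_left h,
        getElem?_writeAt]
      simp [Option.map_map, Function.comp_def, show ¬ u.length < j + 1 by omega]
    · rw [List.getElem?_append_right (by rwa [length_writeAt]), List.getElem?_append_right h,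
        getElem?_writeAt, length_writeAt]
      have e : q = j - u.length + 1 ↔ u.length + q = j + 1 := by omega
      simp [Option.map_map, Function.comp_def, show u.length < j + 1 by omega, e]

theorem trackAt_writeAt (l : List Bool) (p : ℕ) (o : Option Bool) (j : ℕ) :
    trackAt (writeAt l p o) j = (trackAt l j).map fun b => if p = j then o.getD b else b := by
  rcases j with _ | j
  · rfl
  · simp only [trackAt, Nat.add_eq_zero_iff, one_ne_zero, and_false, if_false, Nat.add_sub_cancel,
      getElem?_writeAt]

theorem trackAt_blank (l : List Bool) (j : ℕ) :
    (trackAt l j).map (fun _ => false) = trackAt (List.replicate l.length false) j := by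
  rcases j with _ | j
  · rfl
  · simp only [trackAt, Nat.add_eq_zero_iff, one_ne_zero, and_false, if_false, Nat.add_sub_cancel,
      List.getElem?_replicate]
    split_ifs with h
    · simp [h]
    · simp [h]

theorem workScan_eq {c : SimCell} {u v : List Bool} {p : ℕ} (hz : c.zero = true ↔ p = 0)
    (hd : c.data = dataAt u.length (u ++ v) p) (hp : p ≤ u.length + 1) :
    workScan c = scan u p := by
  unfold workScan
  rcases p with _ | p
  · rw [if_pos (hz.2 rfl), scan_zero]
  · rw [if_neg (by rw [hz]; omega), hd]
    simp only [dataAt, Nat.add_eq_zero_iff, one_ne_zero, and_false, if_false, Nat.add_sub_cancel]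
    rcases lt_or_ge p u.length with h | h
    · rw [List.getElem?_append_left h, scan_succ_of_lt u h]
      simp [h, show ¬ u.length < p + 1 by omega]
    · rw [scan_succ_of_le u h, decide_eq_true (show u.length < p + 1 by omega)]
      cases (u ++ v)[p]? <;> rfl

/-- The position 0 of the catalytic tape falls on the last cell of the work tape, or on the corner
cell if the work tape is empty; either is read as the left end marker. -/
theorem catScan_eq {c : SimCell} {u v : List Bool} {p : ℕ} (hz : c.zero = true ↔ u.length + p = 0)
    (hd : c.data = dataAt u.length (u ++ v) (u.length + p)) :
    catScan c = scan v p := by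
  unfold catScan
  rw [hd]
  rcases p with _ | p
  · rw [scan_zero]
    by_cases h : u.length = 0
    · simp [dataAt, h, hz]
    · simp only [dataAt, Nat.add_zero, h, if_false]
      rw [List.getElem?_append_left (by omega), List.getElem?_eq_getElem (by omega)]
      simp
  · simp only [dataAt, Nat.add_eq_zero_iff, one_ne_zero, and_false, if_false,
      show u.length + (p + 1) - 1 = u.length + p by omega]
    rw [List.getElem?_append_right (by omega), Nat.add_sub_cancel_left,
      decide_eq_true (show u.length < u.length + (p + 1) by omega)]
    rcases lt_or_ge p v.length with h | h
    · rw [scan_succ_of_lt v h]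
      simp [h]
    · rw [scan_succ_of_le v h, List.getElem?_eq_none h]
      have : c.zero = false := by
        rw [← Bool.not_eq_true, hz]; omega
      simp [this]

theorem zScan_eq {c : SimCell} {w : ℕ} {z : List Bool} {p : ℕ} (hz : c.zero = true ↔ p = 0)
    (hd : c.data = dataAt w z p) : zScan c = scan z p := by
  unfold zScan
  rcases p with _ | p
  · rw [if_pos (hz.2 rfl), scan_zero]
  · rw [if_neg (by rw [hz]; omega), hd]
    simp only [dataAt, scan, Nat.add_eq_zero_iff, one_ne_zero, and_false, if_false,
      Nat.add_sub_cancel]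
    cases z[p]? <;> rfl

theorem auxScan_eq {c : SimCell} {l : List Bool} {p : ℕ} (hz : c.zero = true ↔ p = 0)
    (hd : c.aux = trackAt l p) : auxScan c = scan l p := by
  unfold auxScan
  rcases p with _ | p
  · rw [if_pos (hz.2 rfl), scan_zero]
  · rw [if_neg (by rw [hz]; omega), hd]
    simp only [trackAt, scan, Nat.add_eq_zero_iff, one_ne_zero, and_false, if_false,
      Nat.add_sub_cancel]
    cases l[p]? <;> rfl

/-- The offset `w` is the length of the work tape when the catalytic head is simulated, and 0 for
the other heads. -/
theorem boundedMove_apply (l : List Bool) (w p : ℕ) (hp : p ≤ l.length + 1) (m : Dir) :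
    (boundedMove (scan l p) m).apply (w + p) = w + moveBounded l.length p m := by
  rcases p with _ | p
  · cases m <;> simp [boundedMove, scan_zero, HeadMove.apply, moveBounded]
  · rcases lt_or_ge p l.length with h | h
    · rw [scan_succ_of_lt l h]
      cases m <;> simp only [boundedMove, HeadMove.apply, moveBounded] <;> omega
    · rw [scan_succ_of_le l h]
      cases m <;> simp only [boundedMove, HeadMove.apply, moveBounded] <;> omega

theorem boundedMove_apply' (l : List Bool) (p : ℕ) (hp : p ≤ l.length + 1) (m : Dir) :
    (boundedMove (scan l p) m).apply p = moveBounded l.length p m := by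
  simpa using boundedMove_apply l 0 p hp m

theorem notRightEnd_eq {c : SimCell} {z : List Bool} {p : ℕ} (h : zScan c = scan z p)
    (hp : p ≤ z.length + 1) : notRightEnd c = decide (p ≠ z.length + 1) := by
  unfold notRightEnd
  rw [h]
  rcases p with _ | p
  · simp [scan_zero]
  · rcases lt_or_ge p z.length with h | h
    · rw [scan_succ_of_lt z h, decide_eq_true (by omega)]
    · rw [scan_succ_of_le z h, decide_eq_false (by omega)]

theorem writeMove_apply {len w : ℕ} (hw : w ≤ len + 1) (adv : Bool) :
    (if (adv && decide (w ≠ len + 1)) = true then HeadMove.right else .stay).apply w =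
      if adv then moveBounded len w .right else w := by
  cases adv
  · rfl
  · simp only [Bool.true_and, decide_eq_true_iff, if_true, moveBounded]
    split_ifs <;> simp only [HeadMove.apply] <;> omega

/-- The maximum with the new position of the write head is computed locally. It matters only if the
read head is on the cell of the write head, or on the next cell and moving left while the write head
advances; the view of the read head detects both. -/
theorem readMove_apply {z : List Bool} {w r : ℕ} (hw : 1 ≤ w) (hwr : w ≤ r) (hr : r ≤ z.length + 1)
    (adv : Bool) (m : Dir) :
    (readMove (decide (w = r)) (decide (w + 1 = r)) (adv && decide (w ≠ z.length + 1)) (scan z r)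
      m).apply r =
      max (if adv then moveBounded z.length w .right else w) (moveBounded z.length r m) := by
  have hb := boundedMove_apply' z r hr
  unfold readMove
  by_cases h1 : w = r
  · subst h1
    by_cases h2 : w = z.length + 1
    · cases m with
      | left => cases adv <;> simp [h2, HeadMove.apply, moveBounded]
      | stay => cases adv <;> simp [h2, HeadMove.apply, moveBounded, boundedMove]
      | right =>
        have := hb .right
        cases adv <;> simp [h2, moveBounded] at this ⊢ <;> simp [this]
    · cases adv with
      | true => cases m <;> simp [h2, HeadMove.apply, moveBounded] <;> omega
      | false =>
        cases m with
        | left => simp [HeadMove.apply, moveBounded]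
        | stay => simp [HeadMove.apply, moveBounded, boundedMove]
        | right =>
          have := hb .right
          simp only [moveBounded] at this
          simp [moveBounded, this]
          omega
  · rw [decide_eq_false h1, decide_eq_true (show w ≠ z.length + 1 by omega)]
    cases m with
    | left =>
      by_cases h3 : w + 1 = r
      · subst h3
        cases adv <;> simp [HeadMove.apply, moveBounded]
        omega
      · cases adv <;> simp [h3, HeadMove.apply, moveBounded] <;> omega
    | stay =>
      simp only [boundedMove, HeadMove.apply, moveBounded, Bool.false_eq_true, if_false]
      cases adv <;> simp <;> omega
    | right =>
      simp only [Bool.false_eq_true, if_false]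
      rw [hb]
      simp only [moveBounded]
      cases adv <;> simp <;> omega

end RoundMachine
end Catalytic
end

/-! ### Simulation of single steps -/

noncomputable section

namespace Catalytic
namespace RoundMachine

variable {σ : Type} {M : RoundMachine σ} {d : ℕ} {v₀ : Verdict} {v₁ : Bool → Verdict}
  {A : Language σ} {x : List Bool}

/-- The kind of a phase. -/
def _root_.Catalytic.Phase.tag : Phase σ → Tag
  | .query _ _ => .query
  | .between _ _ => .between
  | .answers _ _ => .answers
  | _ => .main

/-- The private part of an in-place computation is represented by the configuration `h`. -/
structure InPlaceRel (ip : InPlaceCfg) (h : M.SimCfg d) : Prop where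
  aux : ∀ j, (h.mem j).aux = trackAt ip.aux j
  headAux : h.head .aux = ip.auxPos
  headRead : h.head .read = ip.readPos
  headWrite : h.head .write = ip.writePos

/-- The answers to the queries `prev` are stored. -/
structure QueueRel (A : Language σ) (prev : List (List σ)) (h : M.SimCfg d) : Prop where
  ans : ∀ j, (h.mem j).ans = (prev.map (answer A))[j]?
  headRead : h.head .ansRead = 0
  headWrite : h.head .ansWrite = prev.length

/-- The data of the phase are represented by the configuration `h`. -/
def PhaseRel (A : Language σ) (h : M.SimCfg d) : Phase σ → Prop
  | .main => h.query = []
  | .halted _ => False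
  | .query prev cur => h.query = cur ∧ QueueRel A prev h
  | .between prev ip => h.query = [] ∧ QueueRel A prev h ∧ InPlaceRel ip h
  | .answers rest ip =>
    h.query = [] ∧ (∀ j, (h.mem (h.head .ansRead + j)).ans = rest[j]?) ∧ InPlaceRel ip h

/-- The part of the simulation relation that does not depend on the phase. -/
structure CoreRel (n : ℕ) (c : RoundCfg σ M.Q) (h : M.SimCfg d) : Prop where
  wf : M.BaseWF n c
  verdict : h.verdict = none
  inPos : h.inPos = c.inPos
  zero : ∀ j, ((h.mem j).zero = true ↔ j = 0)
  last : ∀ j, ((h.mem j).last = true ↔ j = n - 1)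
  data : ∀ j, (h.mem j).data = dataAt c.work.length (c.work ++ c.cat) j
  headWork : h.head .work = c.workPos
  headCat : h.head .cat = c.work.length + c.catPos
  aux : ∃ l, l.length = M.auxLen n ∧ ∀ j, (h.mem j).aux = trackAt l j

/-- The configuration `h` represents the configuration `c`. -/
structure SimRel (A : Language σ) (n : ℕ) (dir : Fin d → Bool) (c : RoundCfg σ M.Q)
    (h : M.SimCfg d) : Prop where
  core : CoreRel n c h
  phaseWF : M.PhaseWF n c.phase
  state : h.state = .sim dir c.state c.phase.tag
  phase : PhaseRel A h c.phase

/-- The verdict of a halted configuration. -/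
def toVerdict (b : Bool) : Verdict := if b then .accept else .reject

/-- The configuration `h'` is the result of simulating a step from `h` that leads to `c'`. -/
def SimNext (A : Language σ) (n : ℕ) (dir : Fin d → Bool) (h : M.SimCfg d) (c' : RoundCfg σ M.Q)
    (h' : M.SimCfg d) : Prop :=
  (∃ b, c'.phase = .halted b ∧ h'.verdict = some (toVerdict b)) ∨
  (SimRel A n (tickDir dir (stuck dir h.view)) c' h' ∧
    ∀ i, h'.head (.digit i) = (tickMove dir (stuck dir h.view) i).apply (h.head (.digit i)))

section views

variable {n : ℕ} {c : RoundCfg σ M.Q} {h : M.SimCfg d}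

theorem CoreRel.view_work (hc : CoreRel n c h) :
    workScan (h.view .work).cell = scan c.work c.workPos := by
  apply workScan_eq (v := c.cat)
  · rw [← hc.headWork]; exact hc.zero _
  · rw [← hc.headWork]; exact hc.data _
  · rw [hc.wf.work]; exact hc.wf.workPos

theorem CoreRel.view_cat (hc : CoreRel n c h) :
    catScan (h.view .cat).cell = scan c.cat c.catPos := by
  apply catScan_eq (u := c.work)
  · rw [← hc.headCat]; exact hc.zero _
  · rw [← hc.headCat]; exact hc.data _

theorem CoreRel.view_z (hc : CoreRel n c h) (k : SimHead d) :
    zScan (h.view k).cell = scan (c.work ++ c.cat) (h.head k) :=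
  zScan_eq (hc.zero _) (hc.data _)

theorem InPlaceRel.view_aux {ip : InPlaceCfg} (hi : InPlaceRel ip h) (hc : CoreRel n c h) :
    auxScan (h.view .aux).cell = scan ip.aux ip.auxPos := by
  apply auxScan_eq
  · rw [← hi.headAux]; exact hc.zero _
  · rw [← hi.headAux]; exact hi.aux _

end views

section steps

variable {dir : Fin d → Bool} {c : RoundCfg σ M.Q} {h : M.SimCfg d} {coin : Bool}

theorem fullAct_sim {q : M.Q} {tag : Tag} {ans : Bool} {sc : Scan Bool}
    (hs : h.state = .sim dir q tag) (hns : ¬ ∀ i, stuck dir h.view i = true) :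
    M.fullAct d v₀ v₁ h.state coin ans sc h.view =
      simAct (tickDir dir (stuck dir h.view)) (tickMove dir (stuck dir h.view)) q tag ans sc
        h.view := by
  rw [hs]
  simp only [fullAct, if_neg hns]

theorem simStep_main (hr : SimRel A x.length dir c h) (hph : c.phase = .main)
    (hns : ¬ ∀ i, stuck dir h.view i = true) :
    SimNext A x.length dir h (M.step A x c) ((M.simulator d v₀ v₁).step A x h coin) := by
  have hwf' := wf_step (A := A) hr.core.wf hr.phaseWF
  obtain ⟨hc, hp, hs, hph'⟩ := hr
  rw [hph] at hs hph'
  have hask : (M.simulator d v₀ v₁).asking x h = false := by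
    simp only [HeadMachine.asking, hs, fullAsks, Phase.tag]
  have hact := fun ans => fullAct_sim (v₀ := v₀) (v₁ := v₁) (coin := coin) (ans := ans)
    (sc := scan x h.inPos) hs hns
  simp only [Phase.tag, simAct, hc.view_work, hc.view_cat, hc.inPos] at hact
  revert hwf'
  simp only [step, hph]
  have hq : h.query = [] := hph'
  cases hm : M.main c.state (scan x c.inPos) (scan c.work c.workPos) (scan c.cat c.catPos) with
  | halt b =>
    intro _
    simp only [hm] at hact
    left
    refine ⟨b, rfl, ?_⟩
    rw [← hc.inPos] at hact
    exact HeadMachine.step_of_halt hc.verdict (hact _)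
  | enterQuery q =>
    intro hwf'
    simp only [hm] at hact
    rw [← hc.inPos] at hact
    rw [HeadMachine.step_of_act hc.verdict (hact _)]
    right
    refine ⟨⟨⟨hwf'.1, rfl, hc.inPos, hc.zero, hc.last, hc.data, hc.headWork, hc.headCat, hc.aux⟩,
      trivial, rfl, ?_, ?_, rfl, rfl⟩, fun _ => rfl⟩
    · simp [hask, hq]
    · intro j
      simp
  | step q im ww wm cw cm =>
    intro hwf'
    simp only [hm] at hact
    rw [← hc.inPos] at hact
    rw [HeadMachine.step_of_act hc.verdict (hact _)]
    right
    refine ⟨⟨⟨hwf'.1, rfl, ?_, hc.zero, hc.last, ?_, ?_, ?_, hc.aux⟩,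
      by simp [PhaseWF], by simp [Phase.tag], ?_⟩, fun _ => rfl⟩
    · simp only [hc.inPos]
    · intro j
      simp only [length_writeAt, dataAt_writeAt_append, hc.data, hc.headWork, hc.headCat,
        decide_eq_true_iff]
    · simp only [SimMoves.fn, hc.headWork]
      exact boundedMove_apply' _ _ (by rw [hc.wf.work]; exact hc.wf.workPos) _
    · simp only [SimMoves.fn, hc.headCat, length_writeAt]
      exact boundedMove_apply _ _ _ (by rw [hc.wf.cat]; exact hc.wf.catPos) _
    · simp [PhaseRel, hask, hq]

/-- The auxiliary track keeps its length outside the in-place computations too, so a single update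
of all cells blanks it for the next one. -/
theorem CoreRel.fresh {n : ℕ} (hc : CoreRel n c h) {j : ℕ} :
    ((h.mem j).aux.map fun _ => false) = trackAt (M.freshInPlace n).aux j := by
  obtain ⟨l, hl, hl'⟩ := hc.aux
  rw [hl', trackAt_blank, hl]
  rfl

/-- Each query is asked when it is complete, not when the round is submitted, and its answer is
appended to the queue. At submission the queue thus holds exactly the list of answers that `step`
hands over. -/
theorem simStep_query {prev : List (List σ)} {cur : List σ} (hr : SimRel A x.length dir c h)
    (hph : c.phase = .query prev cur) (hns : ¬ ∀ i, stuck dir h.view i = true) :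
    SimNext A x.length dir h (M.step A x c) ((M.simulator d v₀ v₁).step A x h coin) := by
  have hwf' := wf_step (A := A) hr.core.wf hr.phaseWF
  obtain ⟨hc, hp, hs, hph'⟩ := hr
  rw [hph] at hs hph'
  obtain ⟨hq, hans, hqr, hqw⟩ := hph'
  have hask : (M.simulator d v₀ v₁).asking x h =
      M.fullAsks d (.sim dir c.state .query) (scan x c.inPos) h.view := by
    simp only [HeadMachine.asking, hs, Phase.tag, hc.inPos]
  simp only [fullAsks, hc.view_work, hc.view_cat] at hask
  have hact := fun ans => fullAct_sim (v₀ := v₀) (v₁ := v₁) (coin := coin) (ans := ans)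
    (sc := scan x h.inPos) hs hns
  simp only [Phase.tag, simAct, hc.view_work, hc.view_cat, hc.inPos] at hact
  revert hwf'
  simp only [step, hph]
  -- Writing at `ansWrite`, which stands behind the last answer, appends to the queue.
  have hnew : ∀ j, (if h.head .ansWrite = j then some (answer A cur) else (h.mem j).ans) =
      ((prev ++ [cur]).map (answer A))[j]? := by
    intro j
    rw [hqw, hans, List.map_append, List.map_singleton]
    split_ifs with hj
    · subst hj; simp
    · rcases lt_or_gt_of_ne hj with hj | hj
      · rw [List.getElem?_eq_none (by simp; omega), List.getElem?_eq_none (by simp; omega)]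
      · rw [List.getElem?_append_left (by simpa using hj)]
  cases hm : M.query c.state (scan x c.inPos) (scan c.work c.workPos) (scan c.cat c.catPos) with
  | step q im ww wm cm out =>
    intro hwf'
    right
    simp only [hm] at hact hask
    rw [← hc.inPos] at hact
    rw [HeadMachine.step_of_act hc.verdict (hact _)]
    refine ⟨⟨⟨hwf'.1, rfl, ?_, hc.zero, hc.last, ?_, ?_, ?_, hc.aux⟩,
      trivial, rfl, ?_, hans, hqr, hqw⟩, fun _ => rfl⟩
    · simp only [hc.inPos]
    · intro j
      -- Writing `none` expresses that the catalytic tape is read-only in this phase.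
      have := dataAt_writeAt_append c.work c.cat c.workPos c.catPos ww none j
      rw [show writeAt c.cat c.catPos none = c.cat from rfl] at this
      simp only [Option.getD_none, ite_self] at this
      simp only [length_writeAt, hc.data, hc.headWork, decide_eq_true_iff, this]
    · simp only [SimMoves.fn, hc.headWork]
      exact boundedMove_apply' _ _ (by rw [hc.wf.work]; exact hc.wf.workPos) _
    · simp only [SimMoves.fn, hc.headCat, length_writeAt]
      exact boundedMove_apply _ _ _ (by rw [hc.wf.cat]; exact hc.wf.catPos) _
    · simp [hask, hq]
  | next q =>
    intro hwf'
    right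
    simp only [hm] at hact hask
    rw [← hc.inPos] at hact
    rw [HeadMachine.step_of_act hc.verdict (hact _)]
    refine ⟨⟨⟨hwf'.1, rfl, hc.inPos, hc.zero, hc.last, hc.data, hc.headWork, hc.headCat,
      ⟨_, (inPlaceWF_fresh _).aux, fun j => hc.fresh⟩⟩, inPlaceWF_fresh _, rfl, ?_,
      ⟨?_, hqr, ?_⟩, fun j => hc.fresh, rfl, rfl, rfl⟩, fun _ => rfl⟩
    · simp [hask]
    · intro j
      simpa [hask, hq] using hnew j
    · simp [SimMoves.fn, HeadMove.apply, hqw]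
  | ask q =>
    intro hwf'
    right
    simp only [hm] at hact hask
    rw [← hc.inPos] at hact
    rw [HeadMachine.step_of_act hc.verdict (hact _)]
    refine ⟨⟨⟨hwf'.1, rfl, hc.inPos, hc.zero, hc.last, hc.data, hc.headWork, hc.headCat,
      ⟨_, (inPlaceWF_fresh _).aux, fun j => hc.fresh⟩⟩, inPlaceWF_fresh _, rfl, ?_,
      ?_, fun j => hc.fresh, rfl, rfl, rfl⟩, fun _ => rfl⟩
    · simp [hask]
    · intro j
      simpa [hask, hq, SimMoves.fn, HeadMove.apply, hqr] using hnew j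

/-- The effect of a step of an in-place computation that does not finish. -/
theorem simStep_inPlace {ip ip' : InPlaceCfg} {c' : RoundCfg σ M.Q} {tag : Tag}
    {done : M.Q → HeadAct σ (M.SimState d) SimCell (SimHead d)}
    (hc : CoreRel x.length c h) (hiw : M.InPlaceWF x.length ip) (hi : InPlaceRel ip h)
    (hask : (M.simulator d v₀ v₁).asking x h = false)
    (hact : ∀ ans, M.fullAct d v₀ v₁ h.state coin ans (scan x h.inPos) h.view =
      inPlaceAct (tickDir dir (stuck dir h.view)) (tickMove dir (stuck dir h.view)) c.state tag
        (scan x h.inPos) h.view done)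
    (hstep : M.inPlaceStep x c ip = (c', some ip')) :
    let h' := (M.simulator d v₀ v₁).step A x h coin
    CoreRel x.length c' h' ∧ InPlaceRel ip' h' ∧
      h'.state = .sim (tickDir dir (stuck dir h.view)) c'.state tag ∧ h'.query = h.query ∧
      (∀ j, (h'.mem j).ans = (h.mem j).ans) ∧ h'.head .ansRead = h.head .ansRead ∧
      h'.head .ansWrite = h.head .ansWrite ∧
      ∀ i, h'.head (.digit i) = (tickMove dir (stuck dir h.view) i).apply (h.head (.digit i)) := by
  intro h'
  have hz := hc.wf.length_z
  have hwf' := (inPlaceStep_wf hc.wf hiw).1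
  have hwlen : c.work.length = M.workLen x.length := hc.wf.work
  rw [hstep] at hwf'
  have hw1 := hiw.one_le
  have hw2 := hiw.le_read
  have hw3 := hiw.readPos
  have hnr : notRightEnd (h.view .write).cell =
      decide (ip.writePos ≠ (c.work ++ c.cat).length + 1) := by
    rw [← hi.headWrite]
    exact notRightEnd_eq (hc.view_z _) (by rw [hi.headWrite, hz]; omega)
  have hvr := hc.view_z .read
  rw [hi.headRead] at hvr
  revert hstep
  unfold inPlaceStep
  unfold inPlaceAct at hact
  simp only [hi.view_aux hc, hvr, hnr, hc.inPos] at hact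
  dsimp only
  cases hm : M.inPlace c.state (scan x c.inPos) (scan ip.aux ip.auxPos)
    (scan (c.work ++ c.cat) ip.readPos) with
  | finish q => simp
  | step q im aw am zw adv rm =>
    simp only [hm] at hact
    intro hstep
    simp only [Prod.mk.injEq, Option.some.injEq] at hstep
    obtain ⟨rfl, rfl⟩ := hstep
    rw [← hc.inPos] at hact
    have hh : h' = _ := HeadMachine.step_of_act hc.verdict (hact _)
    rw [hh]
    have hww := hwf'.work
    dsimp only at hww
    refine ⟨⟨hwf', rfl, ?_, hc.zero, hc.last, ?_, hc.headWork, ?_,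
      ⟨writeAt ip.aux ip.auxPos aw, (length_writeAt _ _ _).trans hiw.aux, ?_⟩⟩, ⟨?_, ?_, ?_, ?_⟩,
      rfl, ?_, fun _ => rfl, rfl, rfl, fun _ => rfl⟩
    · simp only [hc.inPos]
    · intro j
      simp only [List.take_append_drop, hww, ← hwlen, dataAt_writeAt, hc.data, hi.headWrite,
        decide_eq_true_iff]
    · simp only [hww, ← hwlen]
      exact hc.headCat
    · intro j
      simp only [trackAt_writeAt, hi.aux, hi.headAux, decide_eq_true_iff]
    · intro j
      simp only [trackAt_writeAt, hi.aux, hi.headAux, decide_eq_true_iff]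
    · simp only [SimMoves.fn, hi.headAux]
      exact boundedMove_apply' _ _ (by rw [hiw.aux]; exact hiw.auxPos) _
    · simp only [SimMoves.fn, HeadCfg.view, hi.headRead, hi.headWrite]
      exact readMove_apply hw1 hw2 (by rw [hz]; exact hw3) adv rm
    · simp only [SimMoves.fn, hi.headWrite]
      exact writeMove_apply (by rw [hz]; omega) adv
    · simp [hask]

theorem inPlaceStep_none {c c' : RoundCfg σ M.Q} {ip : InPlaceCfg}
    (hstep : M.inPlaceStep x c ip = (c', none)) :
    ∃ q, c' = { c with state := q } ∧ M.inPlace c.state (scan x c.inPos) (scan ip.aux ip.auxPos)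
      (scan (c.work ++ c.cat) ip.readPos) = .finish q := by
  revert hstep
  unfold inPlaceStep
  dsimp only
  cases hm : M.inPlace c.state (scan x c.inPos) (scan ip.aux ip.auxPos)
    (scan (c.work ++ c.cat) ip.readPos) with
  | finish q =>
    intro h
    simp only [Prod.mk.injEq, and_true] at h
    exact ⟨q, h.symm, rfl⟩
  | step => simp

theorem inPlaceAct_finish {ip : InPlaceCfg} {q : M.Q} {tag : Tag}
    {done : M.Q → HeadAct σ (M.SimState d) SimCell (SimHead d)} {dir' : Fin d → Bool}
    {dmv : Fin d → HeadMove}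
    (hc : CoreRel x.length c h) (hi : InPlaceRel ip h)
    (hm : M.inPlace c.state (scan x c.inPos) (scan ip.aux ip.auxPos)
      (scan (c.work ++ c.cat) ip.readPos) = .finish q) :
    inPlaceAct dir' dmv c.state tag (scan x h.inPos) h.view done = done q := by
  have hvr := hc.view_z .read
  rw [hi.headRead] at hvr
  simp only [inPlaceAct, hi.view_aux hc, hvr, hc.inPos, hm]

theorem simStep_between {prev : List (List σ)} {ip : InPlaceCfg} (hr : SimRel A x.length dir c h)
    (hph : c.phase = .between prev ip) (hns : ¬ ∀ i, stuck dir h.view i = true) :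
    SimNext A x.length dir h (M.step A x c) ((M.simulator d v₀ v₁).step A x h coin) := by
  have hwf' := wf_step (A := A) hr.core.wf hr.phaseWF
  obtain ⟨hc, hp, hs, hph'⟩ := hr
  rw [hph] at hs hph' hp
  obtain ⟨hq, hqueue, hi⟩ := hph'
  have hask : (M.simulator d v₀ v₁).asking x h = false := by
    simp only [HeadMachine.asking, hs, fullAsks, Phase.tag]
  have hact := fun ans => fullAct_sim (v₀ := v₀) (v₁ := v₁) (coin := coin) (ans := ans)
    (sc := scan x h.inPos) hs hns
  simp only [Phase.tag, simAct] at hact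
  right
  revert hwf'
  cases hstep : M.inPlaceStep x c ip with
  | mk c' o =>
    simp only [step, hph, hstep]
    cases o with
    | some ip' =>
      intro hwf'
      obtain ⟨h1, h2, h3, h4, h5, h6, h7, h8⟩ := simStep_inPlace (A := A) hc hp hi hask hact hstep
      refine ⟨⟨⟨hwf'.1, h1.verdict, h1.inPos, h1.zero, h1.last, h1.data, h1.headWork, h1.headCat,
        h1.aux⟩, hwf'.2, h3, h4.trans hq, ⟨?_, h6.trans hqueue.headRead, h7.trans hqueue.headWrite⟩,
        h2⟩, h8⟩
      intro j
      rw [h5]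
      exact hqueue.ans j
    | none =>
      intro hwf'
      obtain ⟨q, rfl, hm⟩ := inPlaceStep_none hstep
      rw [HeadMachine.step_of_act hc.verdict ((hact _).trans (inPlaceAct_finish hc hi hm))]
      refine ⟨⟨⟨hwf'.1, rfl, hc.inPos, hc.zero, hc.last, hc.data, hc.headWork, hc.headCat,
        hc.aux⟩, trivial, rfl, ?_, hqueue.ans, hqueue.headRead, hqueue.headWrite⟩, fun _ => rfl⟩
      simp [hask, hq]

/-- The queue from `ansRead` on is the list of answers not yet read. Cells behind its end hold
`none`, which tells the simulating machine that the round is over. -/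
theorem simStep_answers {rest : List Bool} {ip : InPlaceCfg} (hr : SimRel A x.length dir c h)
    (hph : c.phase = .answers rest ip) (hns : ¬ ∀ i, stuck dir h.view i = true) :
    SimNext A x.length dir h (M.step A x c) ((M.simulator d v₀ v₁).step A x h coin) := by
  have hwf' := wf_step (A := A) hr.core.wf hr.phaseWF
  obtain ⟨hc, hp, hs, hph'⟩ := hr
  rw [hph] at hs hph' hp
  obtain ⟨hq, hrest, hi⟩ := hph'
  have hask : (M.simulator d v₀ v₁).asking x h = false := by
    simp only [HeadMachine.asking, hs, fullAsks, Phase.tag]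
  have hact := fun ans => fullAct_sim (v₀ := v₀) (v₁ := v₁) (coin := coin) (ans := ans)
    (sc := scan x h.inPos) hs hns
  simp only [Phase.tag, simAct] at hact
  right
  revert hwf'
  cases hstep : M.inPlaceStep x c ip with
  | mk c' o =>
    simp only [step, hph, hstep]
    cases o with
    | some ip' =>
      intro hwf'
      obtain ⟨h1, h2, h3, h4, h5, h6, h7, h8⟩ := simStep_inPlace (A := A) hc hp hi hask hact hstep
      refine ⟨⟨⟨hwf'.1, h1.verdict, h1.inPos, h1.zero, h1.last, h1.data, h1.headWork, h1.headCat,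
        h1.aux⟩, hwf'.2, h3, h4.trans hq, ?_, h2⟩, h8⟩
      intro j
      rw [h5, h6]
      exact hrest j
    | none =>
      obtain ⟨q, rfl, hm⟩ := inPlaceStep_none hstep
      have hact' := fun ans => (hact ans).trans (inPlaceAct_finish hc hi hm)
      have hhead : (h.view .ansRead).cell.ans = rest[0]? := hrest 0
      cases rest with
      | nil =>
        intro hwf'
        rw [hhead] at hact'
        rw [HeadMachine.step_of_act hc.verdict (hact' _)]
        refine ⟨⟨⟨hwf'.1, rfl, hc.inPos, hc.zero, hc.last, hc.data, hc.headWork, hc.headCat,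
          hc.aux⟩, trivial, rfl, ?_⟩, fun _ => rfl⟩
        simp [hask, hq, PhaseRel]
      | cons b rest =>
        intro hwf'
        rw [hhead] at hact'
        rw [HeadMachine.step_of_act hc.verdict (hact' _)]
        refine ⟨⟨⟨hwf'.1, rfl, hc.inPos, hc.zero, hc.last, hc.data, hc.headWork, hc.headCat,
          ⟨_, (inPlaceWF_fresh _).aux, fun j => hc.fresh⟩⟩, inPlaceWF_fresh _, rfl, ?_,
          ?_, fun j => hc.fresh, rfl, rfl, rfl⟩, fun _ => rfl⟩
        · simp [hask, hq]
        · intro j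
          have := hrest (j + 1)
          rw [List.getElem?_cons_succ] at this
          rw [← this]
          simp only [SimMoves.fn, HeadMove.apply]
          rw [show h.head .ansRead + 1 + j = h.head .ansRead + (j + 1) by omega]

theorem simStep (hr : SimRel A x.length dir c h) (hns : ¬ ∀ i, stuck dir h.view i = true) :
    SimNext A x.length dir h (M.step A x c) ((M.simulator d v₀ v₁).step A x h coin) := by
  cases hph : c.phase with
  | main => exact simStep_main hr hph hns
  | halted b =>
    have := hr.phase
    rw [hph] at this
    exact this.elim
  | query prev cur => exact simStep_query hr hph hns
  | between prev ip => exact simStep_between hr hph hns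
  | answers rest ip => exact simStep_answers hr hph hns

end steps

end RoundMachine
end Catalytic
end

/-! ### The complete run of the simulating machine -/

noncomputable section

namespace Catalytic
namespace RoundMachine

variable {σ : Type} {M : RoundMachine σ} {d : ℕ} {v₀ : Verdict} {v₁ : Bool → Verdict}
  {A : Language σ} {x : List Bool} {coins : ℕ → Bool}

theorem stuck_view {n : ℕ} {c : M.SimCfg d} (hzero : ∀ j, ((c.mem j).zero = true ↔ j = 0))
    (hlast : ∀ j, ((c.mem j).last = true ↔ j = n - 1)) (dir : Fin d → Bool) (i : Fin d) :
    stuck dir c.view i = if dir i then decide (c.head (.digit i) = n - 1)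
      else decide (c.head (.digit i) = 0) := by
  unfold stuck
  split_ifs
  · rw [Bool.eq_iff_iff, decide_eq_true_iff]
    exact hlast _
  · rw [Bool.eq_iff_iff, decide_eq_true_iff]
    exact hzero _

/-- The clock with all `d` digits is already running. The test for the end looks only at the lowest
`catExp` digits, which all reach their ends for the first time after n ^ catExp - 1 ticks. -/
theorem filling_step {n w a t : ℕ} {bits : List Bool} {dir : Fin d → Bool} (hn : 0 < n)
    (hd : M.catExp ≤ d)
    (h : Filling n w a bits dir ((M.simulator d v₀ v₁).run A x coins t))
    (hlt : bits.length + 1 < n ^ M.catExp) :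
    ∃ dir', Filling n w a (bits ++ [coins t]) dir'
      ((M.simulator d v₀ v₁).run A x coins (t + 1)) := by
  rw [run_succ_eq]
  generalize (M.simulator d v₀ v₁).run A x coins t = c at h
  obtain ⟨hb, hs, hin, hpos, hrank⟩ := h
  have hstk := stuck_view hb.zero hb.last dir
  have hnot : ¬ ∀ i : Fin d, (i : ℕ) < M.catExp → stuck dir c.view i = true := by
    rw [← rank_eq_zero_iff hn hpos hstk]
    have := hrank _ le_rfl hd
    omega
  have hask : (M.simulator d v₀ v₁).asking x c = false := by
    simp only [HeadMachine.asking, hs, fullAsks]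
  have hact : ∀ ans, M.fullAct d v₀ v₁ c.state (coins t) ans (scan x c.inPos) c.view =
      .step (.fill (tickDir dir (stuck dir c.view))) .stay none
        (fun S c => { c with data := if S .read then some (true, coins t) else c.data })
        (SimMoves.fn { read := .right, digit := tickMove dir (stuck dir c.view) }) := by
    intro ans
    rw [hs]
    simp only [fullAct, if_neg hnot]
  rw [HeadMachine.step_of_act hb.verdict (hact _)]
  refine ⟨_, ⟨rfl, by simp [hask, hb.query], hb.zero, hb.last, ?_, hb.aux, hb.ans, hb.headWork,
    hb.headCat, ?_, hb.headAux⟩, rfl, hin, tick_lt hn hpos hstk, ?_⟩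
  · intro j
    have h1 := hb.headRead
    rw [← List.append_assoc, dataAt_append]
    simp only [hb.data, h1, decide_eq_true_iff, List.length_append, List.length_replicate]
    split_ifs with hj
    · simp [← hj]
    · rfl
  · simp only [SimMoves.fn, HeadMove.apply, hb.headRead, List.length_append, List.length_singleton]
    omega
  · intro e he hed
    push Not at hnot
    obtain ⟨i, hi, hi'⟩ := hnot
    have := rank_tick hn hpos hstk (e := e) ⟨i, hi.trans_le he, by simpa using hi'⟩
    have h2 := hrank e he hed
    rw [← this] at h2
    rw [← h2, List.length_append, List.length_singleton]
    simp only [SimMoves.fn]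
    omega

/-- The last cell is written without a tick, so n ^ catExp cells use up n ^ catExp - 1 of the n ^ d
- 1 ticks. The remaining n ^ d - n ^ catExp are the time allowed for the simulation. -/
theorem filling_end {t : ℕ} {bits : List Bool} {dir : Fin d → Bool} (hn : 0 < x.length)
    (hd : M.catExp ≤ d)
    (h : Filling x.length (M.workLen x.length) (M.auxLen x.length) bits dir
      ((M.simulator d v₀ v₁).run A x coins t))
    (heq : bits.length + 1 = x.length ^ M.catExp) :
    ∃ dir', SimRel A x.length dir' (M.init x (bits ++ [coins t]))
        ((M.simulator d v₀ v₁).run A x coins (t + 1)) ∧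
      (∀ i, ((M.simulator d v₀ v₁).run A x coins (t + 1)).head (.digit i) < x.length) ∧
      rank x.length dir' (fun i => ((M.simulator d v₀ v₁).run A x coins (t + 1)).head (.digit i)) d +
        x.length ^ M.catExp = x.length ^ d := by
  rw [run_succ_eq]
  generalize (M.simulator d v₀ v₁).run A x coins t = c at h
  obtain ⟨hb, hs, hin, hpos, hrank⟩ := h
  have hstk := stuck_view hb.zero hb.last dir
  have hall : ∀ i : Fin d, (i : ℕ) < M.catExp → stuck dir c.view i = true := by
    rw [← rank_eq_zero_iff hn hpos hstk]
    have := hrank _ le_rfl hd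
    omega
  have hask : (M.simulator d v₀ v₁).asking x c = false := by
    simp only [HeadMachine.asking, hs, fullAsks]
  have hact : ∀ ans, M.fullAct d v₀ v₁ c.state (coins t) ans (scan x c.inPos) c.view =
      .step (.sim dir M.start .main) .stay none
        (fun S c => { c with data := if S .read then some (true, coins t) else c.data })
        (SimMoves.fn {}) := by
    intro ans
    rw [hs]
    simp only [fullAct, if_pos hall]
  rw [HeadMachine.step_of_act hb.verdict (hact _)]
  refine ⟨dir, ⟨⟨(wf_run (M := M) (A := A) (x := x) (τ := bits ++ [coins t]) ?_ 0).1, rfl, hin,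
    hb.zero, hb.last, ?_, hb.headWork, ?_, ⟨_, List.length_replicate, hb.aux⟩⟩, trivial, rfl, ?_⟩,
    hpos, ?_⟩
  · rw [List.length_append, List.length_singleton, heq, catLen]
  · intro j
    have h1 := hb.headRead
    simp only [init, List.length_replicate]
    rw [← List.append_assoc, dataAt_append]
    simp only [hb.data, h1, decide_eq_true_iff, List.length_append, List.length_replicate]
    split_ifs with hj
    · simp [← hj]
    · rfl
  · simpa [init, SimMoves.fn, HeadMove.apply] using hb.headCat
  · simp [init, PhaseRel, hask, hb.query]
  · rw [← hrank d hd le_rfl, ← heq, Nat.add_assoc]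
    rfl

theorem filling_total {t : ℕ} {dir : Fin d → Bool} (hn : 0 < x.length) (hd : M.catExp ≤ d)
    (h : Filling x.length (M.workLen x.length) (M.auxLen x.length) [] dir
      ((M.simulator d v₀ v₁).run A x coins t)) :
    ∃ dir', SimRel A x.length dir'
        (M.init x (List.ofFn fun i : Fin (M.catLen x.length) => coins (t + i)))
        ((M.simulator d v₀ v₁).run A x coins (t + M.catLen x.length)) ∧
      (∀ i, ((M.simulator d v₀ v₁).run A x coins (t + M.catLen x.length)).head (.digit i) <
        x.length) ∧
      rank x.length dir'
        (fun i => ((M.simulator d v₀ v₁).run A x coins (t + M.catLen x.length)).head (.digit i)) d +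
        x.length ^ M.catExp = x.length ^ d := by
  have hofFn : ∀ m, (List.ofFn fun i : Fin (m + 1) => coins (t + i)) =
      (List.ofFn fun i : Fin m => coins (t + i)) ++ [coins (t + m)] := by
    intro m
    rw [List.ofFn_succ']
    simp
  have hfill : ∀ s, s < x.length ^ M.catExp → ∃ dir', Filling x.length (M.workLen x.length)
      (M.auxLen x.length) (List.ofFn fun i : Fin s => coins (t + i)) dir'
      ((M.simulator d v₀ v₁).run A x coins (t + s)) := by
    intro s
    induction s with
    | zero => exact fun _ => ⟨dir, h⟩
    | succ s ih =>
      intro hs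
      obtain ⟨dir', h'⟩ := ih (by omega)
      rw [hofFn]
      exact filling_step hn hd h' (by rwa [List.length_ofFn])
  unfold catLen
  obtain ⟨m, hm⟩ : ∃ m, x.length ^ M.catExp = m + 1 :=
    ⟨x.length ^ M.catExp - 1, by have := Nat.pow_pos (n := M.catExp) hn; omega⟩
  obtain ⟨dir', h'⟩ := hfill m (by omega)
  have := filling_end hn hd h' (by rw [List.length_ofFn, hm])
  rw [hm] at this ⊢
  rw [hofFn]
  exact this

/-- Every simulated step makes one tick, so elapsed steps and remaining rank add up to R and the
clock cannot stop before the rank is exhausted. -/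
theorem sim_steps {t R : ℕ} {dir : Fin d → Bool} {τ : List Bool} (hn : 0 < x.length)
    (h : SimRel A x.length dir (M.init x τ) ((M.simulator d v₀ v₁).run A x coins t))
    (hpos : ∀ i, ((M.simulator d v₀ v₁).run A x coins t).head (.digit i) < x.length)
    (hrank : rank x.length dir
      (fun i => ((M.simulator d v₀ v₁).run A x coins t).head (.digit i)) d = R)
    (s : ℕ) (hsR : s ≤ R) (hs : s < M.haltTime A x τ) :
    ∃ dir', SimRel A x.length dir' (M.run A x τ s)
        ((M.simulator d v₀ v₁).run A x coins (t + s)) ∧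
      (∀ i, ((M.simulator d v₀ v₁).run A x coins (t + s)).head (.digit i) < x.length) ∧
      rank x.length dir'
        (fun i => ((M.simulator d v₀ v₁).run A x coins (t + s)).head (.digit i)) d + s = R := by
  induction s with
  | zero => exact ⟨dir, h, hpos, hrank⟩
  | succ s ih =>
    obtain ⟨dir', h1, h2, h3⟩ := ih (by omega) (by omega)
    have hstk := stuck_view h1.core.zero h1.core.last dir'
    have hns : ¬ ∀ i, stuck dir' ((M.simulator d v₀ v₁).run A x coins (t + s)).view i = true := by
      intro hall
      have := (rank_eq_zero_iff hn h2 hstk (e := d)).2 fun i _ => hall i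
      omega
    rcases simStep (v₀ := v₀) (v₁ := v₁) (coin := coins (t + s)) h1 hns with
      ⟨b, hb, -⟩ | ⟨h4, h5⟩
    · rw [← run_succ] at hb
      exact absurd hb (not_halted_of_lt hs b)
    · rw [← run_succ] at h4
      refine ⟨_, h4, ?_, ?_⟩
      · intro i
        rw [← Nat.add_assoc, run_succ_eq, h5]
        exact tick_lt hn h2 hstk i
      · push Not at hns
        obtain ⟨i, hi⟩ := hns
        have := rank_tick hn h2 hstk (e := d) ⟨i, i.2, by simpa using hi⟩
        rw [← this] at h3
        rw [← h3]
        simp only [← Nat.add_assoc t, run_succ_eq, h5]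
        omega

theorem sim_total {t R : ℕ} {dir : Fin d → Bool} {τ : List Bool} (hn : 0 < x.length)
    (h : SimRel A x.length dir (M.init x τ) ((M.simulator d v₀ v₁).run A x coins t))
    (hpos : ∀ i, ((M.simulator d v₀ v₁).run A x coins t).head (.digit i) < x.length)
    (hrank : rank x.length dir
      (fun i => ((M.simulator d v₀ v₁).run A x coins t).head (.digit i)) d = R)
    {b : Bool} (hb : (M.run A x τ (M.haltTime A x τ)).phase = .halted b) :
    ((M.simulator d v₀ v₁).run A x coins (t + R + 1)).verdict =
      some (if M.haltTime A x τ ≤ R then toVerdict b else .dontKnow) := by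
  have hsteps := sim_steps hn h hpos hrank
  split_ifs with hR
  · obtain ⟨s, hs⟩ : ∃ s, M.haltTime A x τ = s + 1 := by
      refine Nat.exists_eq_succ_of_ne_zero fun h0 => ?_
      rw [h0] at hb
      cases hb
    obtain ⟨dir', h1, h2, h3⟩ := hsteps s (by omega) (by omega)
    have hstk := stuck_view h1.core.zero h1.core.last dir'
    have hns : ¬ ∀ i, stuck dir' ((M.simulator d v₀ v₁).run A x coins (t + s)).view i = true := by
      intro hall
      have := (rank_eq_zero_iff hn h2 hstk (e := d)).2 fun i _ => hall i
      omega
    have hv : ((M.simulator d v₀ v₁).run A x coins (t + s + 1)).verdict = some (toVerdict b) := by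
      rcases simStep (v₀ := v₀) (v₁ := v₁) (coin := coins (t + s)) h1 hns with
        ⟨b', hb', hv⟩ | ⟨h4, -⟩
      · rw [← run_succ, ← hs, hb] at hb'
        obtain rfl := Phase.halted.inj hb'
        exact hv
      · have := h4.phase
        rw [← run_succ, ← hs, hb] at this
        exact this.elim
    obtain ⟨r, hr⟩ := Nat.exists_eq_add_of_le (show t + s + 1 ≤ t + R + 1 by omega)
    rw [hr, HeadMachine.run_of_verdict hv, hv]
  · obtain ⟨dir', h1, h2, h3⟩ := hsteps R le_rfl (by omega)
    have hstk := stuck_view h1.core.zero h1.core.last dir'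
    have hall : ∀ i, stuck dir' ((M.simulator d v₀ v₁).run A x coins (t + R)).view i = true := by
      have := (rank_eq_zero_iff hn h2 hstk (e := d)).1 (by omega)
      exact fun i => this i i.2
    rw [run_succ_eq]
    apply HeadMachine.step_of_halt h1.core.verdict
    rw [h1.state]
    simp only [fullAct, if_pos hall]

/-- After the preparatory phases, which end at a time `t` that does not depend on the coins, the
simulating machine draws the catalytic tape from the coins and reports the verdict of the simulated
run if the counter lasts long enough. -/
theorem simulator_run (hx : 2 ≤ x.length) (hd : M.catExp ≤ d) :
    ∃ t ≤ x.length + 2 + x.length * (M.workConst + M.auxConst + 4), ∀ coins b,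
      let τ := List.ofFn fun i : Fin (M.catLen x.length) => coins (t + i)
      (M.run A x τ (M.haltTime A x τ)).phase = .halted b →
      ((M.simulator d v₀ v₁).run A x coins (t + x.length ^ d + 1)).verdict =
        some (if M.haltTime A x τ ≤ x.length ^ d - M.catLen x.length then toVerdict b
          else .dontKnow) := by
  obtain ⟨s, hs, hhalf⟩ := M.halving_total d v₀ v₁ A x (n := x.length) (by omega) x.length (by omega)
  refine ⟨x.length + 2 + s, by omega, fun coins b => ?_⟩
  intro τ hb
  have hscan : ∀ i, 2 + i ≤ x.length →
      Scanning (2 + i) ((M.simulator d v₀ v₁).run A x coins (3 + i)) := by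
    intro i
    induction i with
    | zero => exact fun _ => scanning_start hx
    | succ i ih => exact fun hi => scanning_step (show 2 + i < x.length by omega) (ih (by omega))
  have h1 := hscan (x.length - 2) (by omega)
  rw [show 2 + (x.length - 2) = x.length by omega,
    show 3 + (x.length - 2) = x.length + 1 by omega] at h1
  have h2 := hhalf _ _ _ _ _ (scanning_end h1)
  simp only [Nat.zero_add] at h2
  obtain ⟨dir, h3, h4, h5⟩ := filling_total (by omega) hd h2
  have h6 := sim_total (by omega) h3 h4 rfl hb
  have h7 : rank x.length dir (fun i => ((M.simulator d v₀ v₁).run A x coins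
      (x.length + 1 + 1 + s + M.catLen x.length)).head (.digit i)) d =
      x.length ^ d - M.catLen x.length := by
    unfold catLen at h5 ⊢
    omega
  rw [h7] at h6
  have h8 : M.catLen x.length ≤ x.length ^ d := Nat.pow_le_pow_right (by omega) hd
  rwa [show x.length + 1 + 1 + s + M.catLen x.length + (x.length ^ d - M.catLen x.length) + 1 =
    x.length + 2 + s + x.length ^ d + 1 by omega] at h6

end RoundMachine

/-! ### Polynomial bounds -/

/-- Functions that are bounded by a power on the numbers greater than `1`. -/
def PolyBounded (f : ℕ → ℕ) : Prop := ∃ d, ∀ n, 2 ≤ n → f n ≤ n ^ d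

namespace PolyBounded

variable {f g : ℕ → ℕ}

theorem mono (hg : PolyBounded g) (h : ∀ n, 2 ≤ n → f n ≤ g n) : PolyBounded f :=
  let ⟨d, hd⟩ := hg
  ⟨d, fun n hn => (h n hn).trans (hd n hn)⟩

theorem const (C : ℕ) : PolyBounded fun _ => C :=
  ⟨C, fun _ hn => Nat.lt_two_pow_self.le.trans (Nat.pow_le_pow_left hn C)⟩

theorem id : PolyBounded fun n => n := ⟨1, fun n _ => (pow_one n).ge⟩

theorem mul (hf : PolyBounded f) (hg : PolyBounded g) : PolyBounded fun n => f n * g n := by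
  obtain ⟨a, ha⟩ := hf
  obtain ⟨b, hb⟩ := hg
  refine ⟨a + b, fun n hn => ?_⟩
  rw [pow_add]
  exact Nat.mul_le_mul (ha n hn) (hb n hn)

/-- The factor 2 is absorbed by one more power of n, since n ≥ 2; this is why inputs of length at
most 1 are treated separately. -/
theorem add (hf : PolyBounded f) (hg : PolyBounded g) : PolyBounded fun n => f n + g n := by
  obtain ⟨a, ha⟩ := hf
  obtain ⟨b, hb⟩ := hg
  refine ⟨max a b + 1, fun n hn => ?_⟩
  have h1 : n ^ a ≤ n ^ max a b := Nat.pow_le_pow_right (by omega) (le_max_left a b)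
  have h2 : n ^ b ≤ n ^ max a b := Nat.pow_le_pow_right (by omega) (le_max_right a b)
  calc f n + g n ≤ n ^ max a b * 2 := by
        have := ha n hn; have := hb n hn; omega
    _ ≤ n ^ (max a b + 1) := by rw [pow_succ]; exact Nat.mul_le_mul_left _ hn

theorem pow (hf : PolyBounded f) (k : ℕ) : PolyBounded fun n => f n ^ k := by
  induction k with
  | zero => simpa using const 1
  | succ k ih => simpa only [pow_succ] using ih.mul hf

theorem log : PolyBounded fun n => Nat.log 2 n + 1 :=
  id.mono fun _ hn => Nat.succ_le_of_lt (Nat.log_lt_self 2 (by omega))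

theorem two_pow_log (C : ℕ) : PolyBounded fun n => 2 ^ (C * (Nat.log 2 n + 1)) := by
  refine ((const 2).mul id |>.pow C).mono fun n hn => ?_
  rw [Nat.mul_comm C, pow_mul]
  apply Nat.pow_le_pow_left
  rw [pow_succ, Nat.mul_comm]
  exact Nat.mul_le_mul_left 2 (Nat.pow_log_le_self 2 (by omega))

theorem eval (p : Polynomial ℕ) : PolyBounded fun n => p.eval n := by
  induction p using Polynomial.induction_on' with
  | add p q hp hq => simpa only [Polynomial.eval_add] using hp.add hq
  | monomial k a => simpa only [Polynomial.eval_monomial] using (const a).mul (id.pow k)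

end PolyBounded

namespace RoundMachine

variable {σ : Type} (M : RoundMachine σ)

theorem polyBounded_workLen : PolyBounded M.workLen := (PolyBounded.const _).mul .log

theorem polyBounded_catLen : PolyBounded M.catLen := PolyBounded.id.pow _

theorem polyBounded_auxLen : PolyBounded M.auxLen := (PolyBounded.const _).mul .log

theorem polyBounded_zLen : PolyBounded M.zLen := M.polyBounded_workLen.add M.polyBounded_catLen

theorem polyBounded_stageTime : PolyBounded M.stageTime :=
  ((PolyBounded.const _).mul ((PolyBounded.id.add (.const 2)).mul
    ((PolyBounded.two_pow_log _).mul ((M.polyBounded_workLen.add (.const 2)).mul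
      (M.polyBounded_catLen.add (.const 2)))))).add
  ((PolyBounded.const _).mul ((PolyBounded.id.add (.const 2)).mul
    ((PolyBounded.two_pow_log _).mul ((M.polyBounded_auxLen.add (.const 2)).mul
      ((M.polyBounded_zLen.add (.const 2)).mul (.const 3))))))

theorem polyBounded_mainTime (k : ℕ) : PolyBounded fun n => M.mainTime n k :=
  (PolyBounded.const _).mul ((PolyBounded.id.add (.const 2)).mul
    ((PolyBounded.two_pow_log _).mul ((M.polyBounded_workLen.add (.const 2)).mul
      ((M.polyBounded_catLen.add (.const 2)).mul (.const _)))))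

theorem polyBounded_roundTime (m : Polynomial ℕ) :
    PolyBounded fun n => M.roundTime n (m.eval n) :=
  ((((((PolyBounded.const 3).mul (.eval m)).add (.const 1)).mul
    (M.polyBounded_zLen.add (.const 2))).add (.const 1)).mul M.polyBounded_stageTime).add (.const 1)

end RoundMachine

/-! ### Counting coin tosses -/

/-- Fixing the tosses at c distinct positions leaves T - c free ones, so the selected tosses inherit
the uniform distribution. -/
theorem card_comp_mem_le {c T : ℕ} {φ : Fin c → Fin T} (hφ : Function.Injective φ)
    (S : Finset (Fin c → Bool)) :
    (Finset.univ.filter fun coins : Fin T → Bool => coins ∘ φ ∈ S).card ≤ 2 ^ (T - c) * S.card := by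
  classical
  apply Finset.card_le_mul_card_image_of_maps_to (f := fun coins => coins ∘ φ)
  · intro coins h
    exact (Finset.mem_filter.1 h).2
  · intro τ _
    have hcard : Fintype.card ({i // i ∉ Set.range φ} → Bool) = 2 ^ (T - c) := by
      rw [Fintype.card_fun, Fintype.card_bool, Fintype.card_subtype_compl, Fintype.card_fin]
      congr 2
      rw [← Nat.card_eq_fintype_card]
      exact (Nat.card_range_of_injective hφ).trans (Nat.card_fin c)
    rw [← hcard, ← Finset.card_univ]
    apply Finset.card_le_card_of_injOn (fun coins i => coins i.1) (fun _ _ => Finset.mem_univ _)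
    intro a ha b hb hab
    simp only [Finset.coe_filter, Set.mem_ofPred_eq] at ha hb
    funext i
    by_cases hi : i ∈ Set.range φ
    · obtain ⟨j, rfl⟩ := hi
      exact congrFun (ha.2.trans hb.2.symm) j
    · exact congrFun hab ⟨i, hi⟩

end Catalytic
end

/-! ### Assembling the zero-error machine -/

noncomputable section

namespace Catalytic
namespace HeadMachine

theorem sweepTime_mono {s t : ℕ} (h : s ≤ t) : sweepTime s ≤ sweepTime t := by
  unfold sweepTime
  have := Nat.pow_le_pow_left h 2
  omega

theorem sweepCoin_lt (t : ℕ) : sweepCoin t < sweepTime (t + 1) := by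
  unfold sweepCoin sweepTime
  have : (t + 1) ^ 2 = t ^ 2 + 2 * t + 1 := by ring
  omega

/-- Different simulated steps use different coins, so the cells of the catalytic tape are filled
independently. -/
theorem sweepCoin_strictMono : StrictMono sweepCoin :=
  strictMono_nat_of_lt_succ fun t => (sweepCoin_lt t).trans_le (by unfold sweepCoin; omega)

end HeadMachine

open HeadMachine RoundMachine in
theorem CLRound_subset_ZPP {σ : Type} (A : Language σ) (k : ℕ) : CLRound A k ⊆ ZPP A := by
  classical
  rintro L ⟨M, m, hM⟩
  -- The number of digits: n ^ d ticks must cover the filling of the catalytic tape and three times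
  -- the average running time.
  obtain ⟨d, hd⟩ := ((((PolyBounded.const 3).mul
    ((M.polyBounded_roundTime m).mul (M.polyBounded_mainTime k))).add M.polyBounded_catLen))
  have hde : M.catExp ≤ d := by
    -- At n = 2 the bound on `catLen` reads 2 ^ catExp ≤ 2 ^ d.
    have := (Nat.le_add_left _ _).trans (hd 2 le_rfl)
    exact (Nat.pow_le_pow_iff_right (by omega)).1 this
  let verdict : List Bool → Verdict := fun x => toVerdict (decide (x ∈ L))
  have hverdict : ∀ x (b : Bool), (b = true ↔ x ∈ L) → toVerdict b = verdict x := by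
    intro x b h
    simp only [verdict]
    congr 1
    rw [Bool.eq_iff_iff, h, decide_eq_true_iff]
  have hcorrect : ∀ {x : List Bool} {v : Option Verdict}, v = some (verdict x) →
      v = some .accept ∧ x ∈ L ∨ v = some .reject ∧ x ∉ L := by
    intro x v h
    by_cases hx : x ∈ L <;> simp [h, verdict, toVerdict, hx]
  let H := M.simulator d (verdict []) (fun b => verdict [b])
  -- The bound on the preparation time from `simulator_run`, plus the n ^ d + 1 steps after it; `p`
  -- below is the corresponding time of the sweeping machine.
  let q : Polynomial ℕ := .X + 2 + .X * .C (M.workConst + M.auxConst + 4) + .X ^ d + 1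
  have hq : ∀ n, q.eval n = n + 2 + n * (M.workConst + M.auxConst + 4) + n ^ d + 1 := by
    intro n
    simp [q]
  let p : Polynomial ℕ := q ^ 2 + 5 * q + 1
  have hp : ∀ n, p.eval n = sweepTime (q.eval n) := by
    intro n
    simp [p, sweepTime]
  refine ⟨H.sweeper, p, fun x => ?_⟩
  -- Runs are driven by infinite sequences of coins; the default beyond the tosses is irrelevant,
  -- since the tosses used to fill the tape lie within the range and the output reads only the first
  -- p(n) coins.
  let ext : (Fin (p.eval x.length) → Bool) → ℕ → Bool :=
    fun coins i => if h : i < p.eval x.length then coins ⟨i, h⟩ else false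
  have hout : ∀ (coins : Fin (p.eval x.length) → Bool) {t : ℕ} {v : Verdict},
      t ≤ q.eval x.length →
      (H.run A x (fun i => ext coins (sweepCoin i)) t).verdict = some v →
      H.sweeper.output A x coins = some v := by
    intro coins t v ht hv
    have h1 : coins = fun i : Fin (p.eval x.length) => ext coins i := by
      funext i
      simp [ext]
    rw [h1]
    exact sweeper_output ((sweepTime_mono ht).trans (hp _).ge) _ hv
  rcases Nat.lt_or_ge x.length 2 with hx | hx
  · have hshort : ∀ coins : Fin (p.eval x.length) → Bool, H.sweeper.output A x coins = some (verdict x) := by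
      intro coins
      rcases Nat.lt_or_ge x.length 1 with h | h
      · refine hout coins (t := 2) (by rw [hq]; omega) ?_
        rw [List.length_eq_zero_iff.1 (show x.length = 0 by omega)]
        exact run_short_zero rfl
      · obtain ⟨b, rfl⟩ := List.length_eq_one_iff.1 (show x.length = 1 by omega)
        exact hout coins (t := 3) (by rw [hq, List.length_singleton, one_pow]; omega) (run_short_one rfl)
    refine ⟨fun coins => ?_, ?_⟩
    · rcases hcorrect (hshort coins) with h | h
      · exact .inl h
      · exact .inr (.inl h)
    · have hempty : IsEmpty {coins : Fin (p.eval x.length) → Bool //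
          H.sweeper.output A x coins = some .dontKnow} := by
        refine ⟨fun c => ?_⟩
        have := (hshort c.1).symm.trans c.2
        by_cases hxL : x ∈ L <;> simp [verdict, toVerdict, hxL] at this
      rw [Nat.card_of_isEmpty]
      norm_num
  · obtain ⟨t₀, ht₀, hrun⟩ := simulator_run (M := M) (d := d) (v₀ := verdict [])
      (v₁ := fun b => verdict [b]) (A := A) hx hde
    -- The catalytic contents drawn by the sweeping machine, as a function of its coin tosses.
    let τ : (Fin (p.eval x.length) → Bool) → Fin (M.catLen x.length) → Bool :=
      fun coins i => ext coins (sweepCoin (t₀ + i))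
    have hhalt : ∀ τ : List Bool, τ.length = M.catLen x.length → ∃ b,
        (M.run A x τ (M.haltTime A x τ)).phase = .halted b ∧ toVerdict b = verdict x := by
      intro τ hτ
      obtain ⟨⟨t, b, h1, h2, -⟩, -⟩ := hM x τ hτ
      have hmem : ∃ b, (M.run A x τ (M.haltTime A x τ)).phase = .halted b :=
        Nat.sInf_mem (s := {t | ∃ b, (M.run A x τ t).phase = .halted b}) ⟨t, b, h1⟩
      obtain ⟨b', hb'⟩ := hmem
      rw [run_of_halted hb' (Nat.sInf_le ⟨b, h1⟩), hb'] at h1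
      obtain rfl := Phase.halted.inj h1
      exact ⟨_, hb', hverdict x _ h2⟩
    have houtput : ∀ coins : Fin (p.eval x.length) → Bool, H.sweeper.output A x coins =
        some (if M.haltTime A x (List.ofFn (τ coins)) ≤ x.length ^ d - M.catLen x.length
          then verdict x else .dontKnow) := by
      intro coins
      obtain ⟨b, hb, hb'⟩ := hhalt (List.ofFn (τ coins)) (List.length_ofFn)
      rw [← hb']
      exact hout coins (by rw [hq]; omega) (hrun (fun i => ext coins (sweepCoin i)) b hb)
    refine ⟨fun coins => ?_, ?_⟩
    · rw [houtput]
      split_ifs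
      · rcases hcorrect (x := x) rfl with h | h
        · exact .inl h
        · exact .inr (.inl h)
      · exact .inr (.inr rfl)
    · have hslow := card_slow_le (M := M) (A := A) (x := x) (k := k) (m := m.eval x.length)
        (fun τ => by
          obtain ⟨⟨t, b, h1, -, h2⟩, -⟩ := hM x (List.ofFn τ) List.length_ofFn
          exact ⟨t, b, h1, h2⟩)
        (fun τ => (hM x (List.ofFn τ) List.length_ofFn).2.1)
        (fun τ => (hM x (List.ofFn τ) List.length_ofFn).2.2)
        (B := x.length ^ d - M.catLen x.length) (Nat.le_sub_of_add_le (hd x.length hx))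
      set S := Finset.univ.filter fun τ : Fin (M.catLen x.length) → Bool =>
        x.length ^ d - M.catLen x.length < M.haltTime A x (List.ofFn τ)
      rw [Nat.card_eq_fintype_card, Fintype.card_subtype] at hslow
      have hbound : ∀ i : Fin (M.catLen x.length), sweepCoin (t₀ + i) < p.eval x.length := by
        intro i
        have h1 := i.2
        have h2 : M.catLen x.length ≤ x.length ^ d := Nat.pow_le_pow_right (by omega) hde
        rw [hp]
        refine (sweepCoin_lt _).trans_le (sweepTime_mono ?_)
        rw [hq]
        omega
      let φ : Fin (M.catLen x.length) → Fin (p.eval x.length) :=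
        fun i => ⟨sweepCoin (t₀ + i), hbound i⟩
      have hφ : Function.Injective φ := by
        intro i j hij
        have := sweepCoin_strictMono.injective (Fin.mk.inj hij)
        exact Fin.ext (by omega)
      have hτ : ∀ coins, τ coins = coins ∘ φ := by
        intro coins
        funext i
        simp [τ, ext, φ, hbound i]
      have hcT : M.catLen x.length ≤ p.eval x.length := by
        have := Fintype.card_le_of_injective φ hφ
        simpa using this
      -- A run with output "don't know" must have drawn slow contents, for otherwise the output
      -- would be the verdict on `x`.
      have hcard : Nat.card {coins : Fin (p.eval x.length) → Bool //
          H.sweeper.output A x coins = some .dontKnow} ≤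
          2 ^ (p.eval x.length - M.catLen x.length) * S.card := by
        rw [Nat.card_eq_fintype_card, Fintype.card_subtype]
        refine (Finset.card_le_card ?_).trans (card_comp_mem_le hφ S)
        intro coins hc
        rw [Finset.mem_filter] at hc ⊢
        refine ⟨Finset.mem_univ _, ?_⟩
        have hc := hc.2
        rw [houtput, hτ] at hc
        simp only [S, Finset.mem_filter, Finset.mem_univ, true_and]
        by_contra hle
        rw [if_pos (by omega)] at hc
        by_cases hxL : x ∈ L <;> simp [verdict, toVerdict, hxL] at hc
      have hfinal : 3 * Nat.card {coins : Fin (p.eval x.length) → Bool //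
          H.sweeper.output A x coins = some .dontKnow} ≤ 2 ^ (p.eval x.length) := by
        calc _ ≤ 3 * (2 ^ (p.eval x.length - M.catLen x.length) * S.card) :=
              Nat.mul_le_mul_left _ hcard
          _ = 2 ^ (p.eval x.length - M.catLen x.length) * (3 * S.card) := by ring
          _ ≤ 2 ^ (p.eval x.length - M.catLen x.length) * 2 ^ M.catLen x.length :=
              Nat.mul_le_mul_left _ hslow
          _ = _ := by rw [← pow_add, Nat.sub_add_cancel hcT]
      rw [div_le_iff₀ (by positivity)]
      have : (3 : ℝ) * Nat.card {coins : Fin (p.eval x.length) → Bool //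
          H.sweeper.output A x coins = some .dontKnow} ≤ 2 ^ (p.eval x.length) := by
        exact_mod_cast hfinal
      linarith

end Catalytic
end

theorem mainTheorem10 {σ : Type} [Finite σ] (A : Language σ) (k : ℕ) :
    Catalytic.CLRound A k ⊆ Catalytic.ZPP A :=
  Catalytic.CLRound_subset_ZPP A k
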